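/- Let $\lambda_W,\lambda_L,P_W,P_L,\Gamma^L,\mu,\alpha,\lambda_c>0$ and let $l(d)=(4\pi/\lambda_c)^2d^{\alpha}$ be the path loss. Let the Wi-Fi access points (APs) $\Phi_W=\{x_j\}$ and the LTE base stations (eNBs) $\Phi_L=\{y_k\}$ be independent homogeneous Poisson point processes on $\mathbb R^2$ with intensities $\lambda_W$, $\lambda_L$. Let the back-off timers $t^W_j$, $t^L_k$ be uniform on $[0,1]$, and let the fading variables $G^{WL}_{jk}$ (from AP $x_j$ to eNB $y_k$) and $G^{L}_{mk}$ (from eNB $y_m$ to eNB $y_k$) be exponential with parameter $\mu$, all of these being mutually independent and independent of the locations. Under listen-before-talk with back-off window $(0,1)$, eNB $y_k$ transmits (written $e^L_k=1$) if and only if, for every $x_j\in\Phi_W$, $t^W_j\ge t^L_k$ or $G^{WL}_{jk}/l(\|y_k-x_j\|)\le \Gamma^L/P_W$, and, for every $y_m\in\Phi_L\setminus\{y_k\}$, $t^L_m\ge t^L_k$ or $G^{L}_{mk}/l(\|y_m-y_k\|)\le\Gamma^L/P_L$. The tagged eNB $y_0$ is the eNB closest to the origin. For $\ast\in\{W,L\}$,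 with $B(0,r)$ the closed ball, put $$N^\ast_0(y,r,\Gamma)=\lambda_\ast\int_{\mathbb R^2\setminus B(0,r)}e^{-\mu\frac{\Gamma}{P_\ast}l(\|x-y\|)}\,dx,\qquad C^\ast_0(z_1,\Gamma_1,z_2,\Gamma_2)=\lambda_\ast\int_{\mathbb R^2\setminus B(0,\|z_2\|)}e^{-\mu\frac{\Gamma_1}{P_\ast}l(\|x-z_1\|)-\mu\frac{\Gamma_2}{P_\ast}l(\|x-z_2\|)}\,dx,$$ $N^W_3(\Gamma)=N^W_0(o,0,\Gamma)$, $N^L_1(r,\Gamma)=N^L_0((r,0),r,\Gamma)$, where $o$ is the origin, and $$M(N_1,N_2,N_3)=\frac{1}{N_2-N_3}\left(\frac{1-e^{-N_1}}{N_1}-\frac{1-e^{-N_1-N_2+N_3}}{N_1+N_2-N_3}\right),$$ $$V(x,s_1,s_2,N_1,N_2,N_3)=(1-e^{-\mu s_1l(\|x\|)})M(N_1,N_2,N_3)+(1-e^{-\mu s_2l(\|x\|)})M(N_2,N_1,N_3),$$ $$U(x,s,N_1)=\frac{1-e^{-N_1}}{N_1}-e^{-\mu s\,l(\|x\|)}\left(\frac{1-e^{-N_1}}{N_1^2}-\frac{e^{-N_1}}{N_1}\right).$$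 Then, conditionally on the tagged eNB being at $y_0=(r_0,0)$ and transmitting, the probability that another eNB located at $y_k\in\Phi_L\cap B^c(0,r_0)$ transmits is $$h_3^L(r_0,y_k)=\frac{V\left(y_k-y_0,\frac{\Gamma^L}{P_L},\frac{\Gamma^L}{P_L},N_4,N_5,N_6\right)}{U\left(y_k-y_0,\frac{\Gamma^L}{P_L},N_4\right)},$$ where $N_4=N^W_3(\Gamma^L)+N^L_1(r_0,\Gamma^L)$, $N_5=N^W_3(\Gamma^L)+N^L_0(y_k,r_0,\Gamma^L)$ and $N_6=C^W_0(y_0-y_k,\Gamma^L,o,\Gamma^L)+C^L_0(y_k,\Gamma^L,y_0,\Gamma^L)$. Here the conditional probability is the Palm conditional probability, for a tagged eNB at an arbitrary angle: writing $\rho_{y}$ for the rotation about $o$ that takes $y\ne o$ to $(\|y\|,0)$, the claim is that the function $(y,y')\mapsto h_3^L(\|y\|,\rho_{y}y')$ is measurable and, for every Borel set $A\subseteq\mathbb R^2\times\mathbb R^2$, $$\mathbb E\sum_{k\ne0}\mathbf 1\{(y_0,y_k)\in A,\ e^L_0=1,\ e^L_k=1\}=\mathbb E\sum_{k\ne0}\mathbf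 1\{(y_0,y_k)\in A,\ e^L_0=1\}\,h_3^L(\|y_0\|,\rho_{y_0}y_k).$$ -/

import Mathlib

open MeasureTheory ProbabilityTheory
open scoped ENNReal NNReal

namespace LBT

/-- The Euclidean plane. -/
abbrev Plane : Type := EuclideanSpace ℝ (Fin 2)

/-- The system parameters: AP and eNB intensities `lamW`, `lamL`, transmit powers `PW`, `PL`, the
sensing threshold `Gam` of the eNBs, the Rayleigh fading parameter `mu`, the path loss exponent
`alpha` and the wavelength `lamC`. All of them are positive. -/
structure Params where
  lamW : ℝ
  lamL : ℝ
  PW : ℝ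
  PL : ℝ
  Gam : ℝ
  mu : ℝ
  alpha : ℝ
  lamC : ℝ
  lamW_pos : 0 < lamW
  lamL_pos : 0 < lamL
  PW_pos : 0 < PW
  PL_pos : 0 < PL
  Gam_pos : 0 < Gam
  mu_pos : 0 < mu
  alpha_pos : 0 < alpha
  lamC_pos : 0 < lamC

noncomputable section

/-! ### The special functions -/

namespace Params

variable (p : Params)

/-- Free space path loss with reference distance one metre, in linear scale; in decibel it is
`20 log₁₀ (4π/λ_c) + 10 α log₁₀ d`. -/
def pathLoss (d : ℝ) : ℝ := (4 * Real.pi / p.lamC) ^ 2 * d ^ p.alpha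

/-- `N^L_0(y, r, Γ)`. -/
def NL0 (y : Plane) (r Γ : ℝ) : ℝ :=
  p.lamL * ∫ x in (Metric.closedBall (0 : Plane) r)ᶜ,
    Real.exp (-(p.mu * (Γ / p.PL) * p.pathLoss ‖x - y‖))

/-- `N^W_0(y, r, Γ)`. -/
def NW0 (y : Plane) (r Γ : ℝ) : ℝ :=
  p.lamW * ∫ x in (Metric.closedBall (0 : Plane) r)ᶜ,
    Real.exp (-(p.mu * (Γ / p.PW) * p.pathLoss ‖x - y‖))

/-- `N^L_1(r, Γ)`. -/
def NL1 (r Γ : ℝ) : ℝ := p.NL0 !₂[r, 0] r Γ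

/-- `N^W_3(Γ)`. -/
def NW3 (Γ : ℝ) : ℝ := p.NW0 0 0 Γ

/-- `C^L_0(y₁, Γ₁, y₂, Γ₂)`. -/
def CL0 (y₁ : Plane) (Γ₁ : ℝ) (y₂ : Plane) (Γ₂ : ℝ) : ℝ :=
  p.lamL * ∫ x in (Metric.closedBall (0 : Plane) ‖y₂‖)ᶜ,
    Real.exp (-(p.mu * (Γ₁ / p.PL) * p.pathLoss ‖x - y₁‖)
      - p.mu * (Γ₂ / p.PL) * p.pathLoss ‖x - y₂‖)

/-- `C^W_0(y₁, Γ₁, y₂, Γ₂)`. -/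
def CW0 (y₁ : Plane) (Γ₁ : ℝ) (y₂ : Plane) (Γ₂ : ℝ) : ℝ :=
  p.lamW * ∫ x in (Metric.closedBall (0 : Plane) ‖y₂‖)ᶜ,
    Real.exp (-(p.mu * (Γ₁ / p.PW) * p.pathLoss ‖x - y₁‖)
      - p.mu * (Γ₂ / p.PW) * p.pathLoss ‖x - y₂‖)

/-- `M(N₁, N₂, N₃)`. -/
def M (N₁ N₂ N₃ : ℝ) : ℝ :=
  ((1 - Real.exp (-N₁)) / N₁ - (1 - Real.exp (-N₁ - N₂ + N₃)) / (N₁ + N₂ - N₃)) / (N₂ - N₃)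

/-- `V(x, s₁, s₂, N₁, N₂, N₃)`. -/
def V (x : Plane) (s₁ s₂ N₁ N₂ N₃ : ℝ) : ℝ :=
  (1 - Real.exp (-(p.mu * s₁ * p.pathLoss ‖x‖))) * M N₁ N₂ N₃
    + (1 - Real.exp (-(p.mu * s₂ * p.pathLoss ‖x‖))) * M N₂ N₁ N₃

/-- `U(x, s, N₁)`. -/
def U (x : Plane) (s N₁ : ℝ) : ℝ :=
  (1 - Real.exp (-N₁)) / N₁
    - Real.exp (-(p.mu * s * p.pathLoss ‖x‖))
      * ((1 - Real.exp (-N₁)) / N₁ ^ 2 - Real.exp (-N₁) / N₁)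

/-- `h_3^L(r₀, y)`: the tagged eNB is at `y₀ = (r₀, 0)`, the other eNB is at `y`. -/
def h3L (r₀ : ℝ) (y : Plane) : ℝ :=
  let y₀ : Plane := !₂[r₀, 0]
  let N₄ := p.NW3 p.Gam + p.NL1 r₀ p.Gam
  let N₅ := p.NW3 p.Gam + p.NL0 y r₀ p.Gam
  let N₆ := p.CW0 (y₀ - y) p.Gam 0 p.Gam + p.CL0 y p.Gam y₀ p.Gam
  p.V (y - y₀) (p.Gam / p.PL) (p.Gam / p.PL) N₄ N₅ N₆ / p.U (y - y₀) (p.Gam / p.PL) N₄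

end Params

/-! ### The network -/

/-- The number of points of the enumerated point process `pts` in `B`. -/
def count {Ω : Type*} (pts : ℕ → Ω → Plane) (B : Set Plane) (ω : Ω) : ℝ≥0∞ :=
  ∑' i, B.indicator (fun _ => 1) (pts i ω)

/-- `pts` enumerates the points of a homogeneous Poisson point process of intensity `lam` on the
plane: the number of points in a Borel set of finite area is Poisson with mean `lam` times the
area, and the numbers of points in finitely many disjoint Borel sets are independent. -/
structure IsPoissonProcess {Ω : Type*} [MeasurableSpace Ω] (pts : ℕ → Ω → Plane) (lam : ℝ)
    (P : Measure Ω) : Prop where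
  measurable : ∀ i, Measurable (pts i)
  count_law : ∀ B : Set Plane, MeasurableSet B → volume B ≠ ∞ →
    HasLaw (count pts B)
      ((poissonMeasure (lam * volume.real B).toNNReal).map (fun n : ℕ => (n : ℝ≥0∞))) P
  count_indep : ∀ (n : ℕ) (B : Fin n → Set Plane), (∀ j, MeasurableSet (B j)) →
    Pairwise (fun i j => Disjoint (B i) (B j)) → iIndepFun (fun j => count pts (B j)) P

/-- The variables that determine which eNBs transmit: AP locations `x`, eNB locations `y`, back-off
timers `tW` of the APs and `tL` of the eNBs, fading `GWL j k` from AP `j` to eNB `k` and `GLL m k`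
from eNB `m` to eNB `k`. -/
structure Network (Ω : Type*) where
  x : ℕ → Ω → Plane
  y : ℕ → Ω → Plane
  tW : ℕ → Ω → ℝ
  tL : ℕ → Ω → ℝ
  GWL : ℕ → ℕ → Ω → ℝ
  GLL : ℕ → ℕ → Ω → ℝ

namespace Network

variable {Ω : Type*} (net : Network Ω)

/-- The index set of the marks: AP timers, eNB timers, AP-eNB fading, eNB-eNB fading. -/
abbrev MarkIndex : Type := (ℕ ⊕ ℕ) ⊕ ((ℕ × ℕ) ⊕ (ℕ × ℕ))

/-- All timers and fading variables as one family. -/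
def mark : MarkIndex → Ω → ℝ
  | .inl (.inl j) => net.tW j
  | .inl (.inr k) => net.tL k
  | .inr (.inl q) => net.GWL q.1 q.2
  | .inr (.inr q) => net.GLL q.1 q.2

/-- The law of the network under listen-before-talk with back-off window `(0,1)`: two independent
homogeneous Poisson processes, whose points carry mutually independent marks that are independent
of all locations: timers uniform on `[0,1]`, fading exponential with parameter `mu`. -/
structure IsLBTNetwork [MeasurableSpace Ω] (p : Params) (P : Measure Ω) : Prop where
  poissonW : IsPoissonProcess net.x p.lamW P
  poissonL : IsPoissonProcess net.y p.lamL P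
  indep_locations : IndepFun (fun ω i => net.x i ω) (fun ω i => net.y i ω) P
  measurable_mark : ∀ m, Measurable (net.mark m)
  law_tW : ∀ j, HasLaw (net.tW j) (volume.restrict (Set.Icc (0 : ℝ) 1)) P
  law_tL : ∀ k, HasLaw (net.tL k) (volume.restrict (Set.Icc (0 : ℝ) 1)) P
  law_GWL : ∀ j k, HasLaw (net.GWL j k) (expMeasure p.mu) P
  law_GLL : ∀ m k, HasLaw (net.GLL m k) (expMeasure p.mu) P
  indep_marks : iIndepFun net.mark P
  indep_marks_locations :
    IndepFun (fun ω => (fun i => net.x i ω, fun i => net.y i ω)) (fun ω m => net.mark m ω) P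

/-- The event that eNB `k` transmits (its medium access indicator is one): no AP and no other eNB
with a smaller timer is received by it with power above the threshold. -/
def transmits (p : Params) (k : ℕ) : Set Ω :=
  {ω | (∀ j, net.tL k ω ≤ net.tW j ω ∨
        net.GWL j k ω / p.pathLoss ‖net.y k ω - net.x j ω‖ ≤ p.Gam / p.PW) ∧
      ∀ m, m ≠ k → (net.tL k ω ≤ net.tL m ω ∨
        net.GLL m k ω / p.pathLoss ‖net.y m ω - net.y k ω‖ ≤ p.Gam / p.PL)}

/-- The event that eNB `i` is the tagged one, i.e. the eNB closest to the typical UE, which is at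
the origin. -/
def tagged (i : ℕ) : Set Ω := {ω | ∀ m, ‖net.y i ω‖ ≤ ‖net.y m ω‖}

/-- The Campbell measure of pairs of distinct eNBs restricted to events `S i k`: the mass of `A` is
the expected number of pairs `(i, k)`, `i ≠ k`, for which `S i k` occurs and whose locations
`(y i, y k)` lie in `A`. -/
def campbell [MeasurableSpace Ω] (P : Measure Ω) (S : ℕ → ℕ → Set Ω) : Measure (Plane × Plane) :=
  Measure.sum fun q : {q : ℕ × ℕ // q.1 ≠ q.2} =>
    (P.restrict (S q.1.1 q.1.2)).map (fun ω => (net.y q.1.1 ω, net.y q.1.2 ω))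

/-- `g y₀ y` is (a version of) the conditional probability that another eNB, located at `y`,
transmits, given that the tagged eNB, located at `y₀`, transmits. As always for conditioning on
points of a point process (Palm probabilities), this is the density of the Campbell measure of the
pairs (tagged eNB, other eNB) where both transmit with respect to the Campbell measure of such
pairs where the tagged eNB transmits. -/
def IsCondTransmitProb [MeasurableSpace Ω] (p : Params) (P : Measure Ω)
    (g : Plane → Plane → ℝ) : Prop :=
  (Measurable fun z : Plane × Plane => g z.1 z.2) ∧
  net.campbell P (fun i k => net.tagged i ∩ net.transmits p i ∩ net.transmits p k) =
    (net.campbell P (fun i _ => net.tagged i ∩ net.transmits p i)).withDensity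
      (fun z => ENNReal.ofReal (g z.1 z.2))

end Network

/-- The position of `y` after the rotation about the origin that moves `y₀ ≠ 0` to `(‖y₀‖, 0)`. -/
def rotateTo (y₀ y : Plane) : Plane :=
  !₂[(y₀ 0 * y 0 + y₀ 1 * y 1) / ‖y₀‖, (y₀ 0 * y 1 - y₀ 1 * y 0) / ‖y₀‖]

end

end LBT

/-! Both Campbell measures have densities with respect to Lebesgue measure on pairs of locations
(v₁, v₂), and the conditional probability is the quotient of the two densities.

The densities come from Mecke's equation of order two: a sum over ordered pairs of distinct eNBs has
as mean `lamL ^ 2` times an integral over two fixed locations, the remaining eNBs being replaced by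
the whole Poisson process. Fix the two locations, the timers s, t and the two mutual fading
variables. The other devices now act independently, each violating the requirements (by being closer
to the origin than v₁, or by blocking) with a probability that depends on its location. By the
Laplace functional, no violation occurs with probability e^{-m}, where m is the mean number of
violating devices. A device received by the two eNBs with probabilities q₁, q₂ blocks at least one
of them with probability s q₁ + t q₂ - min(s,t) q₁ q₂, so that e^{-m} is the void probability of the
disc of radius ‖v₁‖ times exp(-(s N₄ + t N₅ - min(s,t) N₆)); if only the first eNB has to transmit,
the last exponent is just -s N₄.

It remains to average over the pair's own marks. If both transmit, the eNB with the larger timer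
must not receive the other one: a factor 1 - q whichever timer is larger. The exponential averages
to M(N₄,N₅,N₆) + M(N₅,N₄,N₆), which gives V. If only the first must transmit, the factor 1 - q
appears only for t < s, which gives U > 0. The void probability cancels in V/U, and rotations and
translations bring the mean numbers into the form used in `h3L`.

The enumeration of the points is arbitrary and only the law of the counts is given, so Mecke's
equation has to be built up: from the Poisson distribution to disjoint sets, to overlapping sets
through atoms, to cylinder events, to random measures. Infinite products of probabilities are
written as `negexp` of a sum of `neglog`s in [0, ∞], where vanishing factors need no special
treatment.

The argument is carried by `IsPoissonProcess.laplace`, `IsPoissonProcess.mecke`,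
`Network.IsLBTNetwork.tsum_pairEvent`, `Params.negexp_mul_negexp_thirdProb`,
`Params.pairDensity_true`, `Params.pairDensity_false` and `Params.h3L_rotateTo`. -/

namespace LBT

noncomputable section

/-! ### The exponential `x ↦ e^{-x}` on `[0, ∞]` -/

/-- The decreasing bijection `x ↦ e^{-x}` from `[0, ∞]` to `[0, 1]`. -/
def negexp (x : ℝ≥0∞) : ℝ≥0∞ := EReal.exp (-(x : EReal))

/-- The inverse of `negexp`. -/
def neglog (w : ℝ≥0∞) : ℝ≥0∞ := (-(ENNReal.log w)).toENNReal

@[simp] lemma negexp_zero : negexp 0 = 1 := by simp [negexp]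

lemma negexp_add (x y : ℝ≥0∞) : negexp (x + y) = negexp x * negexp y := by
  rw [negexp, EReal.coe_ennreal_add, EReal.neg_add (by simp) (by simp), sub_eq_add_neg,
    EReal.exp_add]
  rfl

lemma negexp_antitone : Antitone negexp := fun _ _ h =>
  EReal.exp_monotone (EReal.neg_le_neg_iff.2 (EReal.coe_ennreal_le_coe_ennreal_iff.2 h))

lemma continuous_negexp : Continuous negexp :=
  ENNReal.continuous_exp.comp (continuous_neg.comp continuous_coe_ennreal_ereal)

@[fun_prop]
lemma measurable_negexp : Measurable negexp := continuous_negexp.measurable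

lemma negexp_le_one (x : ℝ≥0∞) : negexp x ≤ 1 := by
  simpa using negexp_antitone (zero_le (a := x))

lemma negexp_ne_top (x : ℝ≥0∞) : negexp x ≠ ∞ :=
  ((negexp_le_one x).trans_lt ENNReal.one_lt_top).ne

lemma negexp_ofReal {x : ℝ} (hx : 0 ≤ x) :
    negexp (ENNReal.ofReal x) = ENNReal.ofReal (Real.exp (-x)) := by
  rw [negexp, EReal.coe_ennreal_ofReal, max_eq_left hx, ← EReal.coe_neg, EReal.exp_coe]

lemma negexp_nat_mul (n : ℕ) (x : ℝ≥0∞) : negexp (n * x) = negexp x ^ n := by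
  induction n with
  | zero => simp
  | succ n ih => rw [Nat.cast_succ, add_mul, one_mul, negexp_add, ih, pow_succ]

lemma negexp_sum {ι : Type*} (s : Finset ι) (f : ι → ℝ≥0∞) :
    negexp (∑ i ∈ s, f i) = ∏ i ∈ s, negexp (f i) := by
  classical
  induction s using Finset.induction_on with
  | empty => simp
  | insert a s ha ih => rw [Finset.sum_insert ha, Finset.prod_insert ha, negexp_add, ih]

lemma negexp_iSup {ι : Sort*} [Nonempty ι] (f : ι → ℝ≥0∞) :
    negexp (⨆ i, f i) = ⨅ i, negexp (f i) :=
  Antitone.map_ciSup_of_continuousAt continuous_negexp.continuousAt negexp_antitone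

@[fun_prop]
lemma measurable_neglog : Measurable neglog :=
  measurable_ereal_toENNReal.comp
    (continuous_neg.measurable.comp ENNReal.measurable_log)

lemma negexp_neglog {w : ℝ≥0∞} (hw : w ≤ 1) : negexp (neglog w) = w := by
  have h : 0 ≤ -(ENNReal.log w) := by
    rw [EReal.le_neg]; simpa using hw
  rw [negexp, neglog, EReal.coe_toENNReal h, neg_neg, ENNReal.exp_log]

/-! ### The Poisson distribution -/

lemma lintegral_poisson (r : ℝ≥0) (f : ℕ → ℝ≥0∞) :
    ∫⁻ n, f n ∂(poissonMeasure r) =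
      ∑' n, ENNReal.ofReal (Real.exp (-r) * r ^ n / (n.factorial)) * f n := by
  simp [lintegral_countable', poissonMeasure_singleton, mul_comm]

/-- Mecke's equation for the Poisson distribution. -/
lemma lintegral_poisson_mul (r : ℝ≥0) (f : ℕ → ℝ≥0∞) :
    ∫⁻ n, (n : ℝ≥0∞) * f (n - 1) ∂(poissonMeasure r) = r * ∫⁻ n, f n ∂(poissonMeasure r) := by
  -- The term n = 0, where n - 1 is truncated, carries the factor zero. Shifting the rest by one
  -- uses (n + 1) r^(n+1) / (n+1)! = r · r^n / n!.
  rw [lintegral_poisson, lintegral_poisson, tsum_eq_zero_add' ENNReal.summable,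
    ← ENNReal.tsum_mul_left]
  simp only [Nat.cast_zero, zero_mul, mul_zero, zero_add, Nat.add_sub_cancel]
  refine tsum_congr fun n => ?_
  rw [← mul_assoc, ← mul_assoc]
  congr 1
  rw [← ENNReal.ofReal_coe_nnreal, ← ENNReal.ofReal_mul (by positivity),
    ← ENNReal.ofReal_natCast, ← ENNReal.ofReal_mul (by positivity)]
  congr 1
  rw [Nat.factorial_succ]
  push_cast
  field_simp
  ring

/-- The Laplace transform of the Poisson distribution. -/
lemma lintegral_poisson_negexp (r : ℝ≥0) (c : ℝ≥0∞) :
    ∫⁻ n, negexp (n * c) ∂(poissonMeasure r) = negexp (r * (1 - negexp c)) := by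
  obtain ⟨q, hq, hq0, hq1⟩ : ∃ q : ℝ, negexp c = ENNReal.ofReal q ∧ 0 ≤ q ∧ q ≤ 1 := by
    refine ⟨(negexp c).toReal, (ENNReal.ofReal_toReal (negexp_ne_top c)).symm, by positivity, ?_⟩
    exact ENNReal.toReal_le_of_le_ofReal (by norm_num) (by simpa using negexp_le_one c)
  rw [lintegral_poisson]
  simp_rw [negexp_nat_mul, hq, ← ENNReal.ofReal_pow hq0]
  have h1 : (1 : ℝ≥0∞) - ENNReal.ofReal q = ENNReal.ofReal (1 - q) := by
    rw [ENNReal.ofReal_sub _ hq0, ENNReal.ofReal_one]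
  have h2 : (r : ℝ≥0∞) = ENNReal.ofReal r := by simp
  rw [h1, h2, ← ENNReal.ofReal_mul (by positivity), negexp_ofReal (by nlinarith [r.2])]
  simp_rw [← ENNReal.ofReal_mul' (pow_nonneg hq0 _)]
  have hs : HasSum (fun n : ℕ => Real.exp (-r) * r ^ n / n.factorial * q ^ n)
      (Real.exp (-(r * (1 - q)))) := by
    have := (NormedSpace.expSeries_div_hasSum_exp ((r : ℝ) * q)).mul_left (Real.exp (-r))
    rw [← Real.exp_eq_exp_ℝ, ← Real.exp_add] at this
    have hF : (fun n : ℕ => Real.exp (-r) * r ^ n / n.factorial * q ^ n) =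
        fun n => Real.exp (-r) * ((r * q) ^ n / n.factorial) := by
      funext n
      rw [mul_pow]
      ring
    rw [hF, show -((r : ℝ) * (1 - q)) = -r + r * q by ring]
    exact this
  rw [← ENNReal.ofReal_tsum_of_nonneg (fun n => by positivity) hs.summable, hs.tsum_eq]

/-- Mecke's equation for finitely many independent Poisson variables. -/
lemma lintegral_pi_poisson_mul {L : Type*} [Fintype L] [DecidableEq L] (r : L → ℝ≥0) (l : L)
    (H : (L → ℕ) → ℝ≥0∞) :
    ∫⁻ n, (n l : ℝ≥0∞) * H (Function.update n l (n l - 1)) ∂(Measure.pi fun l => poissonMeasure (r l))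
      = r l * ∫⁻ n, H n ∂(Measure.pi fun l => poissonMeasure (r l)) := by
  rw [← lintegral_const_mul _ (measurable_of_countable _)]
  -- It suffices to integrate out coordinate `l` with the others held fixed.
  refine lintegral_eq_of_lmarginal_eq {l} (measurable_of_countable _) (measurable_of_countable _) ?_
  funext z
  rw [lmarginal_singleton, lmarginal_singleton]
  simp only [Function.update_self, Function.update_idem]
  rw [lintegral_poisson_mul (r l) (fun x => H (Function.update z l x)),
    lintegral_const_mul _ (measurable_of_countable _)]

/-! ### Sums over pairs of distinct points -/

lemma tsum_eq_add_tsum_ne (i : ℕ) (f : ℕ → ℝ≥0∞) :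
    ∑' m, f m = f i + ∑' m : {m // m ≠ i}, f m := by
  rw [ENNReal.tsum_eq_add_tsum_ite i]
  congr 1
  refine (tsum_congr fun m => ?_).trans (tsum_subtype {m | m ≠ i} f).symm
  by_cases h : m = i <;> simp [h]

lemma tsum_eq_add_add_tsum_ne {i k : ℕ} (hik : i ≠ k) (f : ℕ → ℝ≥0∞) :
    ∑' m, f m = f i + f k + ∑' m : {m // m ≠ i ∧ m ≠ k}, f m := by
  rw [ENNReal.tsum_eq_add_tsum_ite i, ENNReal.tsum_eq_add_tsum_ite k, if_neg hik.symm, add_assoc]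
  congr 2
  refine (tsum_congr fun m => ?_).trans (tsum_subtype {m | m ≠ i ∧ m ≠ k} f).symm
  by_cases h : m = i <;> by_cases h' : m = k <;> simp [h, h', Set.indicator]

lemma tsum_ne_pairs (f : ℕ → ℕ → ℝ≥0∞) :
    ∑' q : {q : ℕ × ℕ // q.1 ≠ q.2}, f q.1.1 q.1.2 = ∑' i, ∑' k : {k // k ≠ i}, f i k := by
  let e : {q : ℕ × ℕ // q.1 ≠ q.2} ≃ (i : ℕ) × {k // k ≠ i} :=
    (Equiv.subtypeEquivRight fun q => ne_comm).trans
      (Equiv.subtypeProdEquivSigmaSubtype fun i k : ℕ => k ≠ i)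
  rw [← ENNReal.tsum_sigma (fun i (k : {k // k ≠ i}) => f i k), ← e.tsum_eq]
  rfl

/-- Since the sets are disjoint, removing a point of `Q l₁` and then a point of `Q l₂` lowers
exactly these counts by one, whichever points are removed. So the summand is constant over the
admissible pairs, and these number n_{l₁} times the lowered count of `Q l₂`. The iterated `update`
also covers l₁ = l₂. -/
lemma tsum_pairs_mem_atoms {E L : Type*} [DecidableEq L] {Q : L → Set E}
    (hd : Pairwise fun l l' => Disjoint (Q l) (Q l')) (y : ℕ → E) {n : L → ℝ≥0∞}
    (hn : ∀ l, ∑' m, (Q l).indicator (fun _ => (1 : ℝ≥0∞)) (y m) = n l)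
    (l₁ l₂ : L) (F : (L → ℝ≥0∞) → ℝ≥0∞) :
    ∑' q : {q : ℕ × ℕ // q.1 ≠ q.2},
      (Q l₁).indicator (fun _ => (1 : ℝ≥0∞)) (y q.1.1) *
        (Q l₂).indicator (fun _ => (1 : ℝ≥0∞)) (y q.1.2) *
        F (fun l => ∑' m : {m // m ≠ q.1.1 ∧ m ≠ q.1.2},
          (Q l).indicator (fun _ => (1 : ℝ≥0∞)) (y m)) =
      n l₁ * (Function.update n l₁ (n l₁ - 1) l₂ *
        F (Function.update (Function.update n l₁ (n l₁ - 1)) l₂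
          (Function.update n l₁ (n l₁ - 1) l₂ - 1))) := by
  have key : ∀ {l l' z}, z ∈ Q l → (Q l').indicator (fun _ => (1 : ℝ≥0∞)) z =
      if l' = l then 1 else 0 := by
    intro l l' z hz
    by_cases h : l' = l
    · subst h; simp [hz]
    · have : z ∉ Q l' := fun hz' => Set.disjoint_left.1 (hd h) hz' hz
      simp [h, this]
  set n₁ := Function.update n l₁ (n l₁ - 1) with hn₁
  set n₂ := Function.update n₁ l₂ (n₁ l₂ - 1) with hn₂
  have h1 : ∀ q : {q : ℕ × ℕ // q.1 ≠ q.2},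
      (Q l₁).indicator (fun _ => (1 : ℝ≥0∞)) (y q.1.1) *
        (Q l₂).indicator (fun _ => (1 : ℝ≥0∞)) (y q.1.2) *
        F (fun l => ∑' m : {m // m ≠ q.1.1 ∧ m ≠ q.1.2},
          (Q l).indicator (fun _ => (1 : ℝ≥0∞)) (y m)) =
      (Q l₁).indicator (fun _ => (1 : ℝ≥0∞)) (y q.1.1) *
        (Q l₂).indicator (fun _ => (1 : ℝ≥0∞)) (y q.1.2) * F n₂ := by
    rintro ⟨⟨i, k⟩, hik⟩
    simp only at hik ⊢
    by_cases hi : y i ∈ Q l₁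
    · by_cases hk : y k ∈ Q l₂
      · congr 2
        funext l
        have h := hn l
        rw [tsum_eq_add_add_tsum_ne hik, key hi, key hk] at h
        have hR : ∑' m : {m // m ≠ i ∧ m ≠ k}, (Q l).indicator (fun _ => (1 : ℝ≥0∞)) (y m) =
            n l - (if l = l₁ then 1 else 0) - (if l = l₂ then 1 else 0) := by
          rw [← h, tsub_tsub, ENNReal.add_sub_cancel_left]
          split_ifs <;> norm_num
        rw [hR, hn₂, hn₁]
        simp only [Function.update_apply]
        split_ifs <;> simp_all
      · simp [hk]
    · simp [hi]
  rw [tsum_congr h1, ENNReal.tsum_mul_right, tsum_ne_pairs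
    (fun i k => (Q l₁).indicator (fun _ => (1 : ℝ≥0∞)) (y i) *
        (Q l₂).indicator (fun _ => (1 : ℝ≥0∞)) (y k)), ← mul_assoc]
  congr 1
  rw [← hn l₁, ← ENNReal.tsum_mul_right]
  refine tsum_congr fun i => ?_
  rw [ENNReal.tsum_mul_left]
  by_cases hi : y i ∈ Q l₁
  · congr 1
    have h := hn l₂
    rw [tsum_eq_add_tsum_ne i, key hi] at h
    have : ∑' m : {m // m ≠ i}, (Q l₂).indicator (fun _ => (1 : ℝ≥0∞)) (y m) =
        n l₂ - (if l₂ = l₁ then 1 else 0) := by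
      rw [← h, ENNReal.add_sub_cancel_left]
      split_ifs <;> norm_num
    rw [this, hn₁]
    simp only [Function.update_apply]
    split_ifs <;> simp_all
  · simp [hi]

/-! ### Poisson processes on finite families of sets -/

section Poisson

variable {Ω : Type*} [MeasurableSpace Ω] {P : Measure Ω} {pts : ℕ → Ω → Plane} {lam : ℝ}

lemma measurable_count (h : ∀ i, Measurable (pts i)) {B : Set Plane} (hB : MeasurableSet B) :
    Measurable (count pts B) :=
  Measurable.tsum fun i => (measurable_const.indicator hB).comp (h i)

/-- The joint law of the counts is a product of Poisson laws. Here alone the independence of counts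
on disjoint sets is used. -/
lemma IsPoissonProcess.lintegral_counts [IsProbabilityMeasure P] (h : IsPoissonProcess pts lam P)
    {L : Type*} [Fintype L] {Q : L → Set Plane} (hm : ∀ l, MeasurableSet (Q l))
    (hv : ∀ l, volume (Q l) ≠ ∞) (hd : Pairwise fun l l' => Disjoint (Q l) (Q l'))
    {G : (L → ℝ≥0∞) → ℝ≥0∞} (hG : Measurable G) :
    ∫⁻ ω, G (fun l => count pts (Q l) ω) ∂P =
      ∫⁻ n, G (fun l => (n l : ℝ≥0∞))
        ∂(Measure.pi fun l => poissonMeasure (lam * volume.real (Q l)).toNNReal) := by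
  have hind : iIndepFun (fun l => count pts (Q l)) P := by
    let e := (Fintype.equivFin L)
    have := h.count_indep (Fintype.card L) (fun j => Q (e.symm j)) (fun j => hm _)
      (fun i j hij => hd fun h' => hij (e.symm.injective h'))
    simpa using this.precomp e.injective
  have hmc : ∀ l, Measurable (count pts (Q l)) := fun l => measurable_count h.measurable (hm l)
  have hmap : P.map (fun ω l => count pts (Q l) ω) =
      (Measure.pi fun l => poissonMeasure (lam * volume.real (Q l)).toNNReal).map
        (fun n l => ((n l : ℕ) : ℝ≥0∞)) := by
    rw [hind.map_fun_eq_pi_map fun l => (hmc l).aemeasurable,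
      Measure.pi_map_pi (hμ := fun l => inferInstance) fun l => (measurable_of_countable _).aemeasurable]
    congr 1
    funext l
    exact (h.count_law _ (hm l) (hv l)).map_eq
  rw [← lintegral_map hG (measurable_pi_lambda _ hmc), hmap,
    lintegral_map hG (measurable_of_countable _)]

lemma IsPoissonProcess.count_ne_top_ae [IsProbabilityMeasure P] (h : IsPoissonProcess pts lam P)
    {B : Set Plane} (hB : MeasurableSet B) (hv : volume B ≠ ∞) :
    ∀ᵐ ω ∂P, count pts B ω ≠ ∞ := by
  rw [(h.count_law B hB hv).ae_iff (p := fun x => x ≠ ∞) (by measurability),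
    ae_map_iff (measurable_of_countable _).aemeasurable (by measurability)]
  exact Filter.Eventually.of_forall fun n => ENNReal.natCast_ne_top n

/-- Mecke's equation of order two for counts on disjoint sets. -/
lemma IsPoissonProcess.mecke_atoms [IsProbabilityMeasure P] (h : IsPoissonProcess pts lam P)
    {L : Type*} [Fintype L] {Q : L → Set Plane} (hm : ∀ l, MeasurableSet (Q l))
    (hv : ∀ l, volume (Q l) ≠ ∞) (hd : Pairwise fun l l' => Disjoint (Q l) (Q l'))
    {F : (L → ℝ≥0∞) → ℝ≥0∞} (hF : Measurable F) (l₁ l₂ : L) :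
    ∑' q : {q : ℕ × ℕ // q.1 ≠ q.2}, ∫⁻ ω,
      (Q l₁).indicator (fun _ => (1 : ℝ≥0∞)) (pts q.1.1 ω) *
        (Q l₂).indicator (fun _ => (1 : ℝ≥0∞)) (pts q.1.2 ω) *
        F (fun l => ∑' m : {m // m ≠ q.1.1 ∧ m ≠ q.1.2},
          (Q l).indicator (fun _ => (1 : ℝ≥0∞)) (pts m ω)) ∂P =
      ENNReal.ofReal (lam * volume.real (Q l₁)) * (ENNReal.ofReal (lam * volume.real (Q l₂)) *
        ∫⁻ ω, F (fun l => count pts (Q l) ω) ∂P) := by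
  classical
  have hmi : ∀ l m, Measurable fun ω => (Q l).indicator (fun _ => (1 : ℝ≥0∞)) (pts m ω) :=
    fun l m => (measurable_const.indicator (hm l)).comp (h.measurable m)
  have hmq : ∀ q : {q : ℕ × ℕ // q.1 ≠ q.2}, Measurable fun ω =>
      (Q l₁).indicator (fun _ => (1 : ℝ≥0∞)) (pts q.1.1 ω) *
        (Q l₂).indicator (fun _ => (1 : ℝ≥0∞)) (pts q.1.2 ω) *
        F (fun l => ∑' m : {m // m ≠ q.1.1 ∧ m ≠ q.1.2},
          (Q l).indicator (fun _ => (1 : ℝ≥0∞)) (pts m ω)) := fun q =>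
    ((hmi _ _).mul (hmi _ _)).mul (hF.comp
      (measurable_pi_lambda _ fun l => Measurable.tsum fun m => hmi _ _))
  rw [← lintegral_tsum fun q => (hmq q).aemeasurable]
  -- Summed over all pairs, the integrand is a function of the counts alone; the order of the
  -- enumeration disappears.
  let G : (L → ℝ≥0∞) → ℝ≥0∞ := fun n => n l₁ * (Function.update n l₁ (n l₁ - 1) l₂ *
        F (Function.update (Function.update n l₁ (n l₁ - 1)) l₂
          (Function.update n l₁ (n l₁ - 1) l₂ - 1)))
  have hu : ∀ l, Measurable fun n : L → ℝ≥0∞ => Function.update n l (n l - 1) := fun l =>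
    measurable_pi_lambda _ fun l' => by
      by_cases hl : l' = l
      · subst hl; simpa using (measurable_pi_apply l').sub_const 1
      · simpa [hl] using measurable_pi_apply l'
  have hG : Measurable G := by
    have h2 := (hu l₂).comp (hu l₁)
    exact (measurable_pi_apply l₁).mul
      (((measurable_pi_apply l₂).comp (hu l₁)).mul (hF.comp h2))
  have e1 : ∫⁻ ω, ∑' q : {q : ℕ × ℕ // q.1 ≠ q.2},
      (Q l₁).indicator (fun _ => (1 : ℝ≥0∞)) (pts q.1.1 ω) *
        (Q l₂).indicator (fun _ => (1 : ℝ≥0∞)) (pts q.1.2 ω) *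
        F (fun l => ∑' m : {m // m ≠ q.1.1 ∧ m ≠ q.1.2},
          (Q l).indicator (fun _ => (1 : ℝ≥0∞)) (pts m ω)) ∂P =
      ∫⁻ ω, G (fun l => count pts (Q l) ω) ∂P := by
    exact lintegral_congr fun ω =>
      tsum_pairs_mem_atoms hd (fun m => pts m ω) (fun l => rfl) l₁ l₂ F
  rw [e1, h.lintegral_counts hm hv hd hG, h.lintegral_counts hm hv hd hF]
  have hcast : ∀ (n : L → ℕ) (l : L), (fun l' => (Function.update n l (n l - 1) l' : ℝ≥0∞)) =
      Function.update (fun l' => (n l' : ℝ≥0∞)) l ((n l : ℝ≥0∞) - 1) := by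
    intro n l
    funext l'
    simp only [Function.update_apply]
    split_ifs <;> simp
  -- The one-coordinate equation is applied twice: first to remove the point of `Q l₁`, then the
  -- point of `Q l₂`.
  have e2 := lintegral_pi_poisson_mul (fun l => (lam * volume.real (Q l)).toNNReal) l₁
    (fun n => (n l₂ : ℝ≥0∞) * F (fun l => (Function.update n l₂ (n l₂ - 1) l : ℝ≥0∞)))
  have e3 := lintegral_pi_poisson_mul (fun l => (lam * volume.real (Q l)).toNNReal) l₂
    (fun n => F (fun l => (n l : ℝ≥0∞)))
  rw [e3] at e2
  refine Eq.trans (lintegral_congr fun n => ?_) e2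
  simp only [G]
  rw [hcast, ← hcast n l₁]

end Poisson

/-! ### Atoms of a family of overlapping sets -/

section Atoms

variable {E K : Type*} (S : K → Set E)

/-- The atom of the algebra generated by the sets `S r` on which membership is prescribed by `ε`. -/
def atom (ε : K → Bool) : Set E := {z | ∀ r, z ∈ S r ↔ ε r = true}

lemma atom_disjoint {ε ε' : K → Bool} (h : ε ≠ ε') : Disjoint (atom S ε) (atom S ε') :=
  Set.disjoint_left.2 fun z hz hz' => h (funext fun r => by
    have := (hz r).symm.trans (hz' r)
    exact Bool.eq_iff_iff.2 this)

lemma measurableSet_atom [Finite K] [MeasurableSpace E] (hS : ∀ r, MeasurableSet (S r))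
    (ε : K → Bool) : MeasurableSet (atom S ε) := by
  have : Countable K := Finite.to_countable
  have e : atom S ε = ⋂ r, if ε r = true then S r else (S r)ᶜ := by
    ext z
    simp only [atom, Set.mem_ofPred_eq, Set.mem_iInter]
    refine forall_congr' fun r => ?_
    cases ε r <;> simp
  rw [e]
  refine MeasurableSet.iInter fun r => ?_
  split_ifs
  exacts [hS r, (hS r).compl]

/-- The labels of the atoms that are contained in some `S r`. -/
abbrev Label (K : Type*) : Type _ := {ε : K → Bool // ε ≠ fun _ => false}

/-- `1` if the atom with label `ε` is contained in `S r`, else `0`. -/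
def labelMem (r : K) (ε : Label K) : ℝ≥0∞ := if ε.1 r = true then 1 else 0

lemma indicator_eq_sum_atom [Fintype K] [DecidableEq K] (r : K) (z : E) :
    (S r).indicator (fun _ => (1 : ℝ≥0∞)) z =
      ∑ ε : Label K, labelMem r ε * (atom S ε.1).indicator (fun _ => (1 : ℝ≥0∞)) z := by
  classical
  by_cases hz : z ∈ S r
  · have hne : (fun r => decide (z ∈ S r)) ≠ fun _ => false := fun h => by
      simpa [hz] using congrFun h r
    rw [Finset.sum_eq_single ⟨_, hne⟩]
    · have : z ∈ atom S fun r => decide (z ∈ S r) := fun r => by simp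
      simp [hz, labelMem, this]
    · intro ε _ hε
      have : z ∉ atom S ε.1 := fun h => hε (Subtype.ext (funext fun r => by
        have := h r
        rw [Bool.eq_iff_iff]; simp [this]))
      simp [this]
    · simp
  · rw [Finset.sum_eq_zero]
    · simp [hz]
    · intro ε _
      by_cases h : z ∈ atom S ε.1
      · have : ¬ ε.1 r = true := fun h' => hz ((h r).2 h')
        simp [labelMem, this]
      · simp [h]

lemma tsum_indicator_eq_sum_atom [Fintype K] [DecidableEq K] {ι : Type*} (r : K) (y : ι → E) :
    ∑' m, (S r).indicator (fun _ => (1 : ℝ≥0∞)) (y m) =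
      ∑ ε : Label K, labelMem r ε * ∑' m, (atom S ε.1).indicator (fun _ => (1 : ℝ≥0∞)) (y m) := by
  simp_rw [indicator_eq_sum_atom S r, ← tsum_fintype (L := .unconditional _)]
  rw [ENNReal.tsum_comm]
  simp_rw [ENNReal.tsum_mul_left]

end Atoms

/-! ### Mecke's equation for overlapping sets -/

section Poisson

variable {Ω : Type*} [MeasurableSpace Ω] {P : Measure Ω} {pts : ℕ → Ω → Plane} {lam : ℝ}

/-- Mecke's equation of order two for counts. -/
lemma IsPoissonProcess.mecke_counts [IsProbabilityMeasure P] (h : IsPoissonProcess pts lam P)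
    (hlam : 0 ≤ lam) {K : Type*} [Fintype K] [DecidableEq K] {S : K → Set Plane}
    (hm : ∀ r, MeasurableSet (S r)) (hv : ∀ r, volume (S r) ≠ ∞)
    {F : (K → ℝ≥0∞) → ℝ≥0∞} (hF : Measurable F) (a b : K) :
    ∑' q : {q : ℕ × ℕ // q.1 ≠ q.2}, ∫⁻ ω,
      (S a).indicator (fun _ => (1 : ℝ≥0∞)) (pts q.1.1 ω) *
        (S b).indicator (fun _ => (1 : ℝ≥0∞)) (pts q.1.2 ω) *
        F (fun r => ∑' m : {m // m ≠ q.1.1 ∧ m ≠ q.1.2},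
          (S r).indicator (fun _ => (1 : ℝ≥0∞)) (pts m ω)) ∂P =
      ENNReal.ofReal lam * volume (S a) * (ENNReal.ofReal lam * volume (S b)) *
        ∫⁻ ω, F (fun r => count pts (S r) ω) ∂P := by
  classical
  have hma : ∀ ε, MeasurableSet (atom S ε) := measurableSet_atom S hm
  have hva : ∀ ε : Label K, volume (atom S ε.1) ≠ ∞ := by
    intro ε
    -- This is why the all-false label is excluded: every other atom lies in some `S r` and so has
    -- finite area.
    obtain ⟨r, hr⟩ : ∃ r, ε.1 r = true := by
      by_contra! hc
      exact ε.2 (funext fun r => by simpa using hc r)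
    exact measure_ne_top_of_subset (fun z hz => (hz r).2 hr) (hv r)
  have hda : Pairwise fun ε ε' : Label K => Disjoint (atom S ε.1) (atom S ε'.1) :=
    fun ε ε' hne => atom_disjoint S fun h' => hne (Subtype.ext h')
  -- Counts of the `S r` are sums of counts of atoms, so `F` becomes a function of the latter. Both
  -- sides of the claim then expand bilinearly over the atoms that contain the two points.
  let F' : (Label K → ℝ≥0∞) → ℝ≥0∞ := fun v => F fun r => ∑ ε, labelMem r ε * v ε
  have hF' : Measurable F' := hF.comp (by fun_prop)
  have hvol : ∀ r, ENNReal.ofReal lam * volume (S r) =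
      ∑ ε : Label K, labelMem r ε * ENNReal.ofReal (lam * volume.real (atom S ε.1)) := by
    intro r
    have h1 : volume (S r) = ∑ ε : Label K, labelMem r ε * volume (atom S ε.1) := by
      rw [← lintegral_indicator_one (hm r)]
      simp_rw [← lintegral_indicator_one (hma _)]
      have : ∀ z, (S r).indicator (1 : Plane → ℝ≥0∞) z = _ := indicator_eq_sum_atom S r
      simp_rw [this]
      rw [lintegral_finsetSum _ fun ε _ =>
        (measurable_const.indicator (hma _)).const_mul _]
      refine Finset.sum_congr rfl fun ε _ => ?_
      rw [lintegral_const_mul _ (measurable_const.indicator (hma _))]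
      rfl
    rw [h1, Finset.mul_sum]
    refine Finset.sum_congr rfl fun ε _ => ?_
    rw [ENNReal.ofReal_mul hlam, ofReal_measureReal (hva ε)]
    ring
  have hmi : ∀ ε m, Measurable fun ω => (atom S ε).indicator (fun _ => (1 : ℝ≥0∞)) (pts m ω) :=
    fun l m => (measurable_const.indicator (hma l)).comp (h.measurable m)
  have hF1 : ∀ ω, F (fun r => count pts (S r) ω) =
      F' fun ε => count pts (atom S ε.1) ω := by
    intro ω
    simp only [F', count]
    congr 1
    funext r
    exact tsum_indicator_eq_sum_atom S r _
  have hL : ∀ q : {q : ℕ × ℕ // q.1 ≠ q.2}, ∫⁻ ω,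
      (S a).indicator (fun _ => (1 : ℝ≥0∞)) (pts q.1.1 ω) *
        (S b).indicator (fun _ => (1 : ℝ≥0∞)) (pts q.1.2 ω) *
        F (fun r => ∑' m : {m // m ≠ q.1.1 ∧ m ≠ q.1.2},
          (S r).indicator (fun _ => (1 : ℝ≥0∞)) (pts m ω)) ∂P =
      ∑ ε : Label K, ∑ ε' : Label K, labelMem a ε * labelMem b ε' * ∫⁻ ω,
        (atom S ε.1).indicator (fun _ => (1 : ℝ≥0∞)) (pts q.1.1 ω) *
          (atom S ε'.1).indicator (fun _ => (1 : ℝ≥0∞)) (pts q.1.2 ω) *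
          F' (fun ε => ∑' m : {m // m ≠ q.1.1 ∧ m ≠ q.1.2},
            (atom S ε.1).indicator (fun _ => (1 : ℝ≥0∞)) (pts m ω)) ∂P := by
    intro q
    have hms : ∀ ε ε' : Label K, Measurable fun ω =>
        (atom S ε.1).indicator (fun _ => (1 : ℝ≥0∞)) (pts q.1.1 ω) *
          (atom S ε'.1).indicator (fun _ => (1 : ℝ≥0∞)) (pts q.1.2 ω) *
          F' (fun ε => ∑' m : {m // m ≠ q.1.1 ∧ m ≠ q.1.2},
            (atom S ε.1).indicator (fun _ => (1 : ℝ≥0∞)) (pts m ω)) := fun ε ε' =>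
      ((hmi _ _).mul (hmi _ _)).mul (hF'.comp
        (measurable_pi_lambda _ fun l => Measurable.tsum fun m => hmi _ _))
    simp_rw [← lintegral_const_mul _ (hms _ _)]
    simp_rw [← lintegral_finsetSum _ fun ε' _ => (hms _ ε').const_mul _]
    rw [← lintegral_finsetSum _ fun ε _ => Finset.measurable_fun_sum _ fun ε' _ =>
      (hms ε ε').const_mul _]
    refine lintegral_congr fun ω => ?_
    have e : (fun r => ∑' m : {m // m ≠ q.1.1 ∧ m ≠ q.1.2},
          (S r).indicator (fun _ => (1 : ℝ≥0∞)) (pts m ω)) = _ :=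
      funext fun r => tsum_indicator_eq_sum_atom S r fun m : {m // m ≠ q.1.1 ∧ m ≠ q.1.2} => pts m ω
    rw [e, indicator_eq_sum_atom S a, indicator_eq_sum_atom S b, Finset.sum_mul_sum,
      Finset.sum_mul]
    refine Finset.sum_congr rfl fun ε _ => ?_
    rw [Finset.sum_mul]
    refine Finset.sum_congr rfl fun ε' _ => ?_
    simp only [F']
    ring
  simp_rw [hL, hF1, hvol]
  simp_rw [← tsum_fintype (L := .unconditional _)]
  rw [ENNReal.tsum_comm]
  simp_rw [ENNReal.tsum_comm (α := {q : ℕ × ℕ // q.1 ≠ q.2}), ENNReal.tsum_mul_left,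
    h.mecke_atoms (fun ε : Label K => hma ε.1) hva hda hF', ← ENNReal.tsum_mul_right]
  refine tsum_congr fun ε => ?_
  rw [← ENNReal.tsum_mul_left, ← ENNReal.tsum_mul_right]
  refine tsum_congr fun ε' => ?_
  ring

end Poisson

/-! ### Poisson processes as random measures -/

section Config

variable {Ω : Type*} {pts : ℕ → Ω → Plane}

/-- The counting measure of the points with index in `s`. -/
def config (pts : ℕ → Ω → Plane) (s : Set ℕ) (ω : Ω) : Measure Plane :=
  Measure.sum fun m : s => Measure.dirac (pts m ω)

lemma config_apply (s : Set ℕ) (ω : Ω) {B : Set Plane} (hB : MeasurableSet B) :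
    config pts s ω B = ∑' m : s, B.indicator (fun _ => (1 : ℝ≥0∞)) (pts m ω) := by
  rw [config, Measure.sum_apply _ hB]
  exact tsum_congr fun m => Measure.dirac_apply' _ hB

lemma lintegral_config (s : Set ℕ) (ω : Ω) {f : Plane → ℝ≥0∞} (hf : Measurable f) :
    ∫⁻ z, f z ∂(config pts s ω) = ∑' m : s, f (pts m ω) := by
  rw [config, lintegral_sum_measure]
  exact tsum_congr fun m => lintegral_dirac' _ hf

lemma config_univ_apply (ω : Ω) {B : Set Plane} (hB : MeasurableSet B) :
    config pts Set.univ ω B = count pts B ω := by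
  rw [config_apply _ _ hB]
  exact tsum_univ fun m => B.indicator (fun _ => (1 : ℝ≥0∞)) (pts m ω)

lemma config_le_count (s : Set ℕ) (ω : Ω) {B : Set Plane} (hB : MeasurableSet B) :
    config pts s ω B ≤ count pts B ω := by
  rw [config_apply _ _ hB]
  exact ENNReal.tsum_comp_le_tsum_of_injective Subtype.val_injective
    (fun m => B.indicator (fun _ => (1 : ℝ≥0∞)) (pts m ω))

lemma measurable_config [MeasurableSpace Ω] (h : ∀ i, Measurable (pts i)) (s : Set ℕ) :
    Measurable (config pts s) :=
  Measure.measurable_of_measurable_coe _ fun B hB => by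
    simp_rw [config_apply _ _ hB]
    exact Measurable.tsum fun m => (measurable_const.indicator hB).comp (h m)

/-- The Borel sets of finite area. -/
abbrev FinSet : Type := {B : Set Plane // MeasurableSet B ∧ volume B ≠ ∞}

/-- The values of a measure on the Borel sets of finite area. -/
def finValues (N : Measure Plane) (B : FinSet) : ℝ≥0∞ := N B.1

lemma measurable_finValues : Measurable finValues :=
  measurable_pi_lambda _ fun B => Measure.measurable_coe B.2.1

/-- The value at any Borel set is the increasing limit of the values at its intersections with the
spanning sets. Hence laws of random measures can be compared on cylinder events in the counts of
sets of finite area. -/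
lemma comap_finValues :
    (MeasurableSpace.comap finValues inferInstance : MeasurableSpace (Measure Plane)) =
      Measure.instMeasurableSpace := by
  refine le_antisymm measurable_finValues.comap_le ?_
  refine iSup₂_le fun s hs => ?_
  rw [← measurable_iff_comap_le]
  have e : (fun N : Measure Plane => N s) =
      fun N => ⨆ n, finValues N ⟨s ∩ spanningSets volume n,
        hs.inter (measurableSet_spanningSets _ n),
        measure_ne_top_of_subset Set.inter_subset_right (measure_spanningSets_lt_top volume n).ne⟩ := by
    funext N
    simp only [finValues]
    rw [← Monotone.measure_iUnion, ← Set.inter_iUnion, iUnion_spanningSets, Set.inter_univ]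
    exact fun i j hij => Set.inter_subset_inter_right _ (monotone_spanningSets _ hij)
  have : @Measurable _ _ (MeasurableSpace.comap finValues inferInstance) (borel ℝ≥0∞)
      fun N : Measure Plane => N s := by
    rw [e, ← BorelSpace.measurable_eq (α := ℝ≥0∞)]
    refine Measurable.iSup fun n => ?_
    exact (measurable_pi_apply (X := fun _ : FinSet => ℝ≥0∞) _).comp
      (@comap_measurable _ _ inferInstance finValues)
  exact this

end Config

/-! ### Mecke's equation for random measures -/

section Mecke

variable {Ω : Type*} [MeasurableSpace Ω] {P : Measure Ω} {pts : ℕ → Ω → Plane} {lam : ℝ}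

/-- The points other than those with index `i` or `k`. -/
abbrev others (i k : ℕ) : Set ℕ := {m | m ≠ i ∧ m ≠ k}

lemma IsPoissonProcess.mecke_cylinder [IsProbabilityMeasure P] (h : IsPoissonProcess pts lam P)
    (hlam : 0 ≤ lam) (A B : FinSet) (I : Finset FinSet) {T : Set (I → ℝ≥0∞)}
    (hT : MeasurableSet T) :
    ∑' q : {q : ℕ × ℕ // q.1 ≠ q.2}, P ((pts q.1.1 ⁻¹' A.1 ∩ pts q.1.2 ⁻¹' B.1) ∩
        {ω | I.restrict (finValues (config pts (others q.1.1 q.1.2) ω)) ∈ T}) =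
      ENNReal.ofReal lam * volume A.1 * (ENNReal.ofReal lam * volume B.1) *
        P {ω | I.restrict (finValues (config pts Set.univ ω)) ∈ T} := by
  classical
  -- One finite family holds the sets `A`, `B` for the two points and the sets of the cylinder. They
  -- may overlap, which is why the version for overlapping sets is needed.
  let S : Option (Option I) → Set Plane := fun r => r.elim A.1 fun r => r.elim B.1 fun r => r.1.1
  have hm : ∀ r, MeasurableSet (S r) := by
    rintro (_ | _ | r)
    exacts [A.2.1, B.2.1, r.1.2.1]
  have hv : ∀ r, volume (S r) ≠ ∞ := by
    rintro (_ | _ | r)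
    exacts [A.2.2, B.2.2, r.1.2.2]
  let F : (Option (Option I) → ℝ≥0∞) → ℝ≥0∞ := fun v =>
    T.indicator (fun _ => 1) fun i => v (some (some i))
  have hF : Measurable F := (measurable_const.indicator hT).comp (by fun_prop)
  have hI : ∀ s, Measurable fun ω => I.restrict (finValues (config pts s ω)) := fun s =>
    (Finset.measurable_restrict I).comp
      (measurable_finValues.comp (measurable_config h.measurable s))
  have hmec := h.mecke_counts hlam hm hv hF none (some none)
  have e1 : ∫⁻ ω, F (fun r => count pts (S r) ω) ∂P =
      P {ω | I.restrict (finValues (config pts Set.univ ω)) ∈ T} := by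
    have hs : MeasurableSet {ω | I.restrict (finValues (config pts Set.univ ω)) ∈ T} := hI _ hT
    rw [← lintegral_indicator_one hs]
    refine lintegral_congr fun ω => ?_
    have : (fun i : I => count pts (S (some (some i))) ω) =
        I.restrict (finValues (config pts Set.univ ω)) :=
      funext fun i => (config_univ_apply ω i.1.2.1).symm
    simp only [F, this]
    rfl
  rw [e1] at hmec
  rw [← show S none = A.1 from rfl, ← show S (some none) = B.1 from rfl, ← hmec]
  refine tsum_congr fun q => ?_
  have hs : MeasurableSet ((pts q.1.1 ⁻¹' S none ∩ pts q.1.2 ⁻¹' S (some none)) ∩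
        {ω | I.restrict (finValues (config pts (others q.1.1 q.1.2) ω)) ∈ T}) :=
    (((h.measurable _) (hm _)).inter ((h.measurable _) (hm _))).inter (hI _ hT)
  rw [← lintegral_indicator_one hs]
  refine lintegral_congr fun ω => ?_
  have : (fun i : I => ∑' m : {m // m ≠ q.1.1 ∧ m ≠ q.1.2},
      (S (some (some i))).indicator (fun _ => (1 : ℝ≥0∞)) (pts m ω)) =
      I.restrict (finValues (config pts (others q.1.1 q.1.2) ω)) :=
    funext fun i => (config_apply _ ω i.1.2.1).symm
  simp only [F, this]
  rw [Set.inter_indicator_one, Set.inter_indicator_one]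
  rfl

/-- For fixed `A` and `B` of finite area both sides are finite measures in `T`. They agree on the
π-system of cylinders, hence everywhere. -/
lemma IsPoissonProcess.mecke_sets [IsProbabilityMeasure P] (h : IsPoissonProcess pts lam P)
    (hlam : 0 ≤ lam) (A B : FinSet) {T : Set (Measure Plane)} (hT : MeasurableSet T) :
    ∑' q : {q : ℕ × ℕ // q.1 ≠ q.2}, P ((pts q.1.1 ⁻¹' A.1 ∩ pts q.1.2 ⁻¹' B.1) ∩
        config pts (others q.1.1 q.1.2) ⁻¹' T) =
      ENNReal.ofReal lam * volume A.1 * (ENNReal.ofReal lam * volume B.1) *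
        P (config pts Set.univ ⁻¹' T) := by
  set c := ENNReal.ofReal lam * volume A.1 * (ENNReal.ofReal lam * volume B.1) with hc
  have hc' : c ≠ ∞ := ENNReal.mul_ne_top (ENNReal.mul_ne_top (by simp) A.2.2)
    (ENNReal.mul_ne_top (by simp) B.2.2)
  have hmf : ∀ s, Measurable fun ω => finValues (config pts s ω) := fun s =>
    measurable_finValues.comp (measurable_config h.measurable s)
  have hAB : ∀ q : {q : ℕ × ℕ // q.1 ≠ q.2},
      MeasurableSet (pts q.1.1 ⁻¹' A.1 ∩ pts q.1.2 ⁻¹' B.1) := fun q =>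
    ((h.measurable _) A.2.1).inter ((h.measurable _) B.2.1)
  let m₁ : Measure (FinSet → ℝ≥0∞) := Measure.sum fun q : {q : ℕ × ℕ // q.1 ≠ q.2} =>
    (P.restrict (pts q.1.1 ⁻¹' A.1 ∩ pts q.1.2 ⁻¹' B.1)).map
      fun ω => finValues (config pts (others q.1.1 q.1.2) ω)
  let m₂ : Measure (FinSet → ℝ≥0∞) := c • P.map fun ω => finValues (config pts Set.univ ω)
  have hm₁ : ∀ T, MeasurableSet T → m₁ T = ∑' q : {q : ℕ × ℕ // q.1 ≠ q.2},
      P ((pts q.1.1 ⁻¹' A.1 ∩ pts q.1.2 ⁻¹' B.1) ∩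
        {ω | finValues (config pts (others q.1.1 q.1.2) ω) ∈ T}) := by
    intro T hT
    rw [Measure.sum_apply _ hT]
    refine tsum_congr fun q => ?_
    rw [Measure.map_apply (hmf _) hT, Measure.restrict_apply (hmf _ hT), Set.inter_comm]
    rfl
  have hm₂ : ∀ T, MeasurableSet T →
      m₂ T = c * P {ω | finValues (config pts Set.univ ω) ∈ T} := by
    intro T hT
    rw [Measure.smul_apply, Measure.map_apply (hmf _) hT]
    rfl
  have hcyl : ∀ T ∈ measurableCylinders fun _ : FinSet => ℝ≥0∞, m₁ T = m₂ T := by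
    intro T hT
    obtain ⟨I, T', hT', rfl⟩ := (mem_measurableCylinders _).1 hT
    have hc := MeasurableSet.cylinder (α := fun _ : FinSet => ℝ≥0∞) I hT'
    rw [hm₁ _ hc, hm₂ _ hc]
    exact h.mecke_cylinder hlam A B I hT'
  have huniv : m₁ Set.univ = m₂ Set.univ := hcyl _ (univ_mem_measurableCylinders _)
  have hfin : IsFiniteMeasure m₁ := by
    refine ⟨?_⟩
    rw [huniv, hm₂ _ .univ]
    exact ENNReal.mul_lt_top hc'.lt_top (measure_lt_top _ _)
  have hm : m₁ = m₂ := ext_of_generate_finite _ generateFrom_measurableCylinders.symm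
    isPiSystem_measurableCylinders hcyl huniv
  rw [← comap_finValues] at hT
  obtain ⟨T', hT', rfl⟩ := hT
  have := hm₁ T' hT'
  rw [hm, hm₂ _ hT'] at this
  exact this.symm

lemma generateFrom_finSet :
    MeasurableSpace.generateFrom {B : Set Plane | MeasurableSet B ∧ volume B ≠ ∞} =
      (inferInstance : MeasurableSpace Plane) := by
  refine le_antisymm (MeasurableSpace.generateFrom_le fun s hs => hs.1) fun s hs => ?_
  rw [← Set.inter_univ s, ← iUnion_spanningSets (volume : Measure Plane), Set.inter_iUnion]
  refine MeasurableSet.iUnion fun n => MeasurableSpace.measurableSet_generateFrom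
    ⟨hs.inter (measurableSet_spanningSets _ n), measure_ne_top_of_subset Set.inter_subset_right
      (measure_spanningSets_lt_top volume n).ne⟩

lemma isPiSystem_finSet : IsPiSystem {B : Set Plane | MeasurableSet B ∧ volume B ≠ ∞} :=
  fun _ hs _ ht _ => ⟨hs.1.inter ht.1, measure_ne_top_of_subset Set.inter_subset_left hs.2⟩

/-- The Borel sets of finite area contain a sequence that exhausts the plane. -/
def spanningFinSet (lam : ℝ) : (ENNReal.ofReal lam • (volume : Measure Plane)).FiniteSpanningSetsIn
    {B : Set Plane | MeasurableSet B ∧ volume B ≠ ∞} where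
  set n := spanningSets volume n
  set_mem n := ⟨measurableSet_spanningSets _ n, (measure_spanningSets_lt_top volume n).ne⟩
  finite n := by
    rw [Measure.smul_apply]
    exact ENNReal.mul_lt_top (by simp) (measure_spanningSets_lt_top volume n)
  spanning := iUnion_spanningSets _

/-- Mecke's equation of order two, as an identity of measures. -/
lemma IsPoissonProcess.mecke_measure [IsProbabilityMeasure P] (h : IsPoissonProcess pts lam P)
    (hlam : 0 ≤ lam) :
    (Measure.sum fun q : {q : ℕ × ℕ // q.1 ≠ q.2} => P.map fun ω =>
      ((pts q.1.1 ω, pts q.1.2 ω), config pts (others q.1.1 q.1.2) ω)) =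
    ((ENNReal.ofReal lam • (volume : Measure Plane)).prod
      (ENNReal.ofReal lam • (volume : Measure Plane))).prod (P.map (config pts Set.univ)) := by
  have hmc : ∀ s, Measurable (config pts s) := measurable_config h.measurable
  have : IsProbabilityMeasure (P.map (config pts Set.univ)) :=
    Measure.isProbabilityMeasure_map (hmc _).aemeasurable
  symm
  -- A product of σ-finite measures is determined by its values on a π-system of rectangles; the
  -- case of a rectangle (A × B) × T is `mecke_sets`.
  refine Measure.prod_eq_generateFrom
    (generateFrom_eq_prod generateFrom_finSet generateFrom_finSet
      (spanningFinSet lam).isCountablySpanning (spanningFinSet lam).isCountablySpanning)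
    MeasurableSpace.generateFrom_measurableSet (isPiSystem_finSet.prod isPiSystem_finSet)
    MeasurableSpace.isPiSystem_measurableSet ((spanningFinSet lam).prod (spanningFinSet lam))
    (Measure.toFiniteSpanningSetsIn _) ?_
  rintro _ ⟨A, hA, B, hB, rfl⟩ T hT
  have hT : MeasurableSet T := hT
  have hq : ∀ q : {q : ℕ × ℕ // q.1 ≠ q.2}, Measurable fun ω =>
      ((pts q.1.1 ω, pts q.1.2 ω), config pts (others q.1.1 q.1.2) ω) := fun q =>
    ((h.measurable _).prodMk (h.measurable _)).prodMk (hmc _)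
  have hABT := (hA.1.prod hB.1).prod hT
  rw [Measure.sum_apply _ hABT, Measure.prod_prod, Measure.smul_apply, Measure.smul_apply,
    Measure.map_apply (hmc _) hT, smul_eq_mul, smul_eq_mul,
    ← h.mecke_sets hlam ⟨A, hA⟩ ⟨B, hB⟩ hT]
  refine tsum_congr fun q => ?_
  rw [Measure.map_apply (hq q) hABT]
  rfl

/-! ### Integration against a random measure with finite values -/

/-- The measures with finite value on the `n`-th annulus, sorted by the integer part of this value
and restricted to the annulus. -/
def pieceKernel (n k : ℕ) : Kernel (Measure Plane) Plane where
  toFun N := (if N (disjointed (spanningSets volume) n) ≠ ∞ ∧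
      ⌊(N (disjointed (spanningSets volume) n)).toReal⌋₊ = k then (1 : ℝ≥0∞) else 0) •
    N.restrict (disjointed (spanningSets volume) n)
  measurable' := by
    have hW : MeasurableSet (disjointed (spanningSets (volume : Measure Plane)) n) :=
      MeasurableSet.disjointed (measurableSet_spanningSets _) n
    have hN := Measure.measurable_coe hW
    refine Measure.measurable_of_measurable_coe _ fun s hs => ?_
    simp only [Measure.smul_apply, Measure.restrict_apply hs, smul_eq_mul]
    refine Measurable.mul (Measurable.ite ?_ measurable_const measurable_const)
      (Measure.measurable_coe (hs.inter hW))
    refine MeasurableSet.inter ?_ ?_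
    · exact (hN (measurableSet_singleton ∞)).compl
    · exact (Nat.measurable_floor.comp hN.ennreal_toReal) (measurableSet_singleton k)

lemma pieceKernel_apply (n k : ℕ) (N : Measure Plane) : pieceKernel n k N =
    (if N (disjointed (spanningSets volume) n) ≠ ∞ ∧
      ⌊(N (disjointed (spanningSets volume) n)).toReal⌋₊ = k then (1 : ℝ≥0∞) else 0) •
    N.restrict (disjointed (spanningSets volume) n) := rfl

/-- A mass with integer part k is at most k + 1, uniformly in the measure. -/
instance (n k : ℕ) : IsFiniteKernel (pieceKernel n k) := by
  refine ⟨⟨(k + 1 : ℝ≥0∞), by simp [ENNReal.add_lt_top], fun N => ?_⟩⟩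
  rw [pieceKernel_apply, Measure.smul_apply, Measure.restrict_apply_univ]
  split_ifs with h
  · rw [one_smul, ← ENNReal.ofReal_toReal h.1]
    have := (Nat.lt_floor_add_one (N (disjointed (spanningSets volume) n)).toReal).le
    rw [h.2] at this
    refine (ENNReal.ofReal_le_ofReal this).trans (le_of_eq ?_)
    rw [ENNReal.ofReal_add (by positivity) zero_le_one]
    simp
  · simp

/-- The identity on measures that are finite on each annulus. -/
def idKernel : Kernel (Measure Plane) Plane :=
  Kernel.sum fun n => Kernel.sum fun k => pieceKernel n k

/-- Being s-finite makes ∫ g v dN measurable jointly in (v, N), as is needed to integrate Mecke's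
identity of measures. -/
instance : IsSFiniteKernel idKernel := by
  have : ∀ n, IsSFiniteKernel (Kernel.sum fun k => pieceKernel n k) := fun n => inferInstance
  unfold idKernel
  infer_instance

/-- On each annulus the mass is finite, so exactly one `k` contributes; the annuli partition the
plane. -/
lemma idKernel_apply {N : Measure Plane}
    (hN : ∀ n, N (spanningSets volume n) ≠ ∞) : idKernel N = N := by
  have hW : ∀ n, MeasurableSet (disjointed (spanningSets (volume : Measure Plane)) n) :=
    MeasurableSet.disjointed (measurableSet_spanningSets _)
  have hn : ∀ n, (Kernel.sum fun k => pieceKernel n k) N =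
      N.restrict (disjointed (spanningSets volume) n) := by
    intro n
    rw [Kernel.sum_apply]
    have hfin := measure_ne_top_of_subset (disjointed_subset (spanningSets volume) n) (hN n)
    ext s hs
    rw [Measure.sum_apply _ hs, tsum_eq_single
      ⌊(N (disjointed (spanningSets volume) n)).toReal⌋₊]
    · rw [pieceKernel_apply, if_pos ⟨hfin, rfl⟩, one_smul]
    · intro k hk
      rw [pieceKernel_apply, if_neg fun h => hk h.2.symm, zero_smul]
      rfl
  rw [idKernel, Kernel.sum_apply]
  simp_rw [hn]
  rw [← Measure.restrict_iUnion (disjoint_disjointed _) hW, iUnion_disjointed,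
    iUnion_spanningSets, Measure.restrict_univ]

end Mecke

/-! ### Laplace functional and Mecke's equation for multiplicative functionals -/

section Functionals

variable {Ω : Type*} [MeasurableSpace Ω] {P : Measure Ω} {pts : ℕ → Ω → Plane} {lam : ℝ}

/-- The Laplace functional of a Poisson process at a simple function. -/
lemma IsPoissonProcess.laplace_simpleFunc [IsProbabilityMeasure P]
    (h : IsPoissonProcess pts lam P) (hlam : 0 ≤ lam) (φ : SimpleFunc Plane ℝ≥0∞)
    (hφ : volume (Function.support φ) ≠ ∞) :
    ∫⁻ ω, negexp (∑' m, φ (pts m ω)) ∂P =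
      negexp (ENNReal.ofReal lam * ∫⁻ z, (1 - negexp (φ z))) := by
  classical
  -- The value 0 is left out because its fibre has infinite area; the other fibres lie in the
  -- support.
  let L := {c // c ∈ φ.range.erase 0}
  let Q : L → Set Plane := fun c => φ ⁻¹' {c.1}
  have hc : ∀ c : L, c.1 ≠ 0 := fun c => (Finset.mem_erase.1 c.2).1
  have hm : ∀ c, MeasurableSet (Q c) := fun c => φ.measurableSet_fiber _
  have hv : ∀ c, volume (Q c) ≠ ∞ := fun c =>
    measure_ne_top_of_subset (fun z (hz : φ z = c.1) => by simp [hz, hc]) hφ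
  have hd : Pairwise fun c c' => Disjoint (Q c) (Q c') := fun c c' hne =>
    Set.disjoint_left.2 fun z (hz : φ z = _) (hz' : φ z = _) =>
      hne (Subtype.ext (hz.symm.trans hz'))
  -- Needed twice: for the identity, to write the exponent as a combination of counts, and for c ↦ 1
  -- - e^{-c}, to evaluate the integral on the right.
  have hsum : ∀ (f : ℝ≥0∞ → ℝ≥0∞), f 0 = 0 → ∀ z,
      f (φ z) = ∑ c : L, f c.1 * (Q c).indicator (fun _ => (1 : ℝ≥0∞)) z := by
    intro f hf z
    by_cases hz : φ z = 0
    · rw [hz, hf, Finset.sum_eq_zero]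
      intro c _
      have : z ∉ Q c := fun h' => hc c (Eq.symm (hz.symm.trans h'))
      simp [this]
    · rw [Finset.sum_eq_single ⟨φ z, Finset.mem_erase.2 ⟨hz, φ.mem_range_self z⟩⟩]
      · have : z ∈ Q ⟨φ z, Finset.mem_erase.2 ⟨hz, φ.mem_range_self z⟩⟩ := rfl
        simp [this]
      · intro c _ hne
        have : z ∉ Q c := fun h' => hne (Subtype.ext (Eq.symm h'))
        simp [this]
      · simp
  have hG : Measurable fun v : L → ℝ≥0∞ => negexp (∑ c : L, c.1 * v c) := by fun_prop
  have e1 : ∀ ω, negexp (∑' m, φ (pts m ω)) = negexp (∑ c : L, c.1 * count pts (Q c) ω) := by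
    intro ω
    have hid : ∀ z, φ z = ∑ c : L, c.1 * (Q c).indicator (fun _ => (1 : ℝ≥0∞)) z := hsum id rfl
    simp_rw [hid, count, ← tsum_fintype (L := .unconditional _)]
    rw [ENNReal.tsum_comm]
    simp_rw [ENNReal.tsum_mul_left]
  simp_rw [e1]
  rw [h.lintegral_counts hm hv hd hG]
  simp_rw [negexp_sum]
  -- Independence over the fibres turns the mean of the product into a product of Laplace transforms
  -- of Poisson variables.
  rw [lintegral_prod_eq_prod_lintegral_of_indepFun Finset.univ
    (fun (c : L) (n : L → ℕ) => negexp (c.1 * (n c : ℝ≥0∞)))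
    (iIndepFun_pi (X := fun (c : L) (k : ℕ) => negexp (c.1 * (k : ℝ≥0∞)))
      fun c => (measurable_of_countable _).aemeasurable)
    fun c => measurable_of_countable _]
  have e3 : ∀ c : L, ∫⁻ n : L → ℕ, negexp (c.1 * (n c : ℝ≥0∞))
      ∂(Measure.pi fun l => poissonMeasure (lam * volume.real (Q l)).toNNReal) =
      ∫⁻ k, negexp (c.1 * (k : ℝ≥0∞)) ∂(poissonMeasure (lam * volume.real (Q c)).toNNReal) :=
    fun c => (measurePreserving_eval (fun l => poissonMeasure (lam * volume.real (Q l)).toNNReal)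
      c).lintegral_comp (f := fun k : ℕ => negexp (c.1 * (k : ℝ≥0∞))) (measurable_of_countable _)
  simp_rw [e3, mul_comm (_ : ℝ≥0∞) (Nat.cast _), lintegral_poisson_negexp]
  rw [← negexp_sum]
  congr 1
  have e2 : ∀ z, 1 - negexp (φ z) =
      ∑ c : L, (1 - negexp c.1) * (Q c).indicator (fun _ => (1 : ℝ≥0∞)) z :=
    hsum (fun c => 1 - negexp c) (by simp)
  simp_rw [e2]
  rw [lintegral_finsetSum _ fun c _ => (measurable_const.indicator (hm c)).const_mul _,
    Finset.mul_sum]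
  refine Finset.sum_congr rfl fun c _ => ?_
  rw [lintegral_const_mul _ (measurable_const.indicator (hm c)), lintegral_indicator_const (hm c),
    one_mul]
  change ENNReal.ofReal _ * _ = _
  rw [ENNReal.ofReal_mul hlam, ofReal_measureReal (hv c)]
  ring

/-- The Laplace functional of a Poisson process. -/
theorem IsPoissonProcess.laplace [IsProbabilityMeasure P]
    (h : IsPoissonProcess pts lam P) (hlam : 0 ≤ lam) {g : Plane → ℝ≥0∞} (hg : Measurable g) :
    ∫⁻ ω, negexp (∑' m, g (pts m ω)) ∂P =
      negexp (ENNReal.ofReal lam * ∫⁻ z, (1 - negexp (g z))) := by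
  -- Simple functions increasing to `g`, cut off to the spanning sets so that their supports have
  -- finite area.
  let φ : ℕ → SimpleFunc Plane ℝ≥0∞ := fun n =>
    (SimpleFunc.eapprox g n).restrict (spanningSets volume n)
  have hS : ∀ n, MeasurableSet (spanningSets (volume : Measure Plane) n) :=
    measurableSet_spanningSets _
  have hφ : ∀ n z, φ n z = (spanningSets volume n).indicator (SimpleFunc.eapprox g n) z :=
    fun n z => by simp only [φ, SimpleFunc.restrict_apply _ (hS n)]
  have hmono : ∀ z, Monotone fun n => φ n z := by
    intro z m n hmn
    simp only [hφ]
    refine (Set.indicator_le_indicator_of_subset (monotone_spanningSets _ hmn)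
      (fun _ => zero_le) z).trans ?_
    exact Set.indicator_le_indicator (SimpleFunc.monotone_eapprox g hmn z)
  have hsup : ∀ z, ⨆ n, φ n z = g z := by
    intro z
    refine le_antisymm (iSup_le fun n => ?_) ?_
    · rw [hφ]
      refine (Set.indicator_le_self _ _ z).trans ?_
      rw [← SimpleFunc.iSup_eapprox_apply hg z]
      exact le_iSup (fun n => SimpleFunc.eapprox g n z) n
    · rw [← SimpleFunc.iSup_eapprox_apply hg z]
      refine iSup_le fun n => ?_
      obtain ⟨k, hk⟩ : ∃ k, z ∈ spanningSets (volume : Measure Plane) k :=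
        Set.mem_iUnion.1 ((iUnion_spanningSets (volume : Measure Plane)).symm ▸ Set.mem_univ z)
      refine le_trans ?_ (le_iSup _ (max n k))
      rw [hφ, Set.indicator_of_mem (monotone_spanningSets _ (le_max_right n k) hk)]
      exact SimpleFunc.monotone_eapprox g (le_max_left n k) z
  have hfin : ∀ n, volume (Function.support (φ n)) ≠ ∞ := fun n =>
    measure_ne_top_of_subset (fun z hz => by
      by_contra hc
      exact hz (by rw [hφ, Set.indicator_of_notMem hc])) (measure_spanningSets_lt_top volume n).ne
  have key := fun n => h.laplace_simpleFunc hlam (φ n) (hfin n)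
  have hmeas : ∀ n, Measurable fun ω => ∑' m, φ n (pts m ω) := fun n =>
    Measurable.tsum fun m => (φ n).measurable.comp (h.measurable m)
  have e1 : ∀ ω, ∑' m, g (pts m ω) = ⨆ n, ∑' m, φ n (pts m ω) := by
    intro ω
    simp_rw [← hsup]
    have := lintegral_iSup (μ := (Measure.count : Measure ℕ)) (f := fun n m => φ n (pts m ω))
      (fun n => measurable_of_countable _) (fun i j hij m => hmono _ hij)
    simpa [lintegral_count] using this
  have hanti : ∀ ω, Antitone fun n => negexp (∑' m, φ n (pts m ω)) := fun ω i j hij =>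
    negexp_antitone (ENNReal.tsum_le_tsum fun m => hmono _ hij)
  have e2 : ∫⁻ z, (1 - negexp (g z)) = ⨆ n, ∫⁻ z, (1 - negexp (φ n z)) := by
    rw [← lintegral_iSup (f := fun n z => 1 - negexp (φ n z))
      (fun n => (measurable_negexp.comp (φ n).measurable).const_sub 1)]
    · refine lintegral_congr fun z => ?_
      rw [← hsup, negexp_iSup, ENNReal.sub_iInf]
    · exact fun i j hij z => tsub_le_tsub_left (negexp_antitone (hmono z hij)) _
  simp_rw [e1, negexp_iSup]
  -- The exponentials decrease, so monotone convergence needs one finite integral; that of index 0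
  -- is a value of `negexp`.
  rw [lintegral_iInf (f := fun n ω => negexp (∑' m, φ n (pts m ω)))
    (fun n => measurable_negexp.comp (hmeas n)) (fun i j hij ω => hanti ω hij)]
  · simp_rw [key]
    rw [e2, ENNReal.mul_iSup, negexp_iSup]
  · rw [key 0]
    exact negexp_ne_top _

/-- Mecke's equation of order two for multiplicative functionals. -/
theorem IsPoissonProcess.mecke [IsProbabilityMeasure P]
    (h : IsPoissonProcess pts lam P) (hlam : 0 ≤ lam) {F : Plane × Plane → ℝ≥0∞}
    (hF : Measurable F) {g : Plane × Plane → Plane → ℝ≥0∞} (hg : Measurable (Function.uncurry g)) :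
    ∑' q : {q : ℕ × ℕ // q.1 ≠ q.2}, ∫⁻ ω, F (pts q.1.1 ω, pts q.1.2 ω) *
        negexp (∑' m : others q.1.1 q.1.2, g (pts q.1.1 ω, pts q.1.2 ω) (pts m ω)) ∂P =
      ENNReal.ofReal lam ^ 2 * ∫⁻ v : Plane × Plane,
        F v * negexp (ENNReal.ofReal lam * ∫⁻ z, (1 - negexp (g v z))) := by
  have hgv : ∀ v, Measurable (g v) := fun v => hg.comp measurable_prodMk_left
  -- The functional is written on all measures through `idKernel`, to be measurable; it has the
  -- intended value at locally finite ones.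
  let Φ : (Plane × Plane) × Measure Plane → ℝ≥0∞ := fun w =>
    F w.1 * negexp (∫⁻ z, g w.1 z ∂(idKernel w.2))
  have hΦ : Measurable Φ := by
    refine (hF.comp measurable_fst).mul (measurable_negexp.comp ?_)
    have h1 : Measurable (Function.uncurry fun (w : (Plane × Plane) × Measure Plane) z =>
      g w.1 z) := hg.comp ((measurable_fst.comp measurable_fst).prodMk measurable_snd)
    exact h1.lintegral_kernel_prod_right (κ := idKernel.comap Prod.snd measurable_snd)
  have hmc : ∀ s, Measurable (config pts s) := measurable_config h.measurable
  -- Almost surely every configuration is finite on each spanning set, so that `idKernel` acts on it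
  -- as the identity.
  have hgood : ∀ᵐ ω ∂P, ∀ s n, config pts s ω (spanningSets volume n) ≠ ∞ := by
    have : ∀ᵐ ω ∂P, ∀ n, count pts (spanningSets volume n) ω ≠ ∞ := ae_all_iff.2 fun n =>
      h.count_ne_top_ae (measurableSet_spanningSets _ n) (measure_spanningSets_lt_top volume n).ne
    filter_upwards [this] with ω hω s n
    exact ((config_le_count s ω (measurableSet_spanningSets _ n)).trans_lt (hω n).lt_top).ne
  have hq : ∀ q : {q : ℕ × ℕ // q.1 ≠ q.2}, Measurable fun ω =>
      ((pts q.1.1 ω, pts q.1.2 ω), config pts (others q.1.1 q.1.2) ω) := fun q =>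
    ((h.measurable _).prodMk (h.measurable _)).prodMk (hmc _)
  have : IsProbabilityMeasure (P.map (config pts Set.univ)) :=
    Measure.isProbabilityMeasure_map (hmc _).aemeasurable
  have key := congrArg (fun m => ∫⁻ w, Φ w ∂m) (h.mecke_measure hlam)
  simp only [lintegral_sum_measure] at key
  simp_rw [lintegral_map hΦ (hq _)] at key
  rw [lintegral_prod _ hΦ.aemeasurable, Measure.prod_smul_left, Measure.prod_smul_right,
    smul_smul, lintegral_smul_measure] at key
  refine Eq.trans (tsum_congr fun q => ?_) (key.trans ?_)
  · refine lintegral_congr_ae (hgood.mono fun ω hω => ?_)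
    simp only [Φ]
    rw [idKernel_apply (hω _), lintegral_config _ _ (hgv _)]
  · rw [smul_eq_mul, sq]
    congr 1
    refine lintegral_congr fun v => ?_
    have hv : Measurable fun N => Φ (v, N) := hΦ.comp measurable_prodMk_left
    have hne : Measurable fun ω => negexp (∑' m, g v (pts m ω)) :=
      measurable_negexp.comp (Measurable.tsum fun m => (hgv v).comp (h.measurable m))
    rw [lintegral_map hv (hmc _), ← h.laplace hlam (hgv v), ← lintegral_const_mul _ hne]
    refine lintegral_congr_ae (hgood.mono fun ω hω => ?_)
    simp only [Φ]
    rw [idKernel_apply (hω _), lintegral_config _ _ (hgv _), tsum_univ fun m => g v (pts m ω)]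

end Functionals

/-! ### Independence and infinite products of probabilities -/

section Independence

lemma comap_pi_eq_iSup {Ω A : Type*} (X : A → Ω → ℝ) :
    MeasurableSpace.comap (fun ω a => X a ω) MeasurableSpace.pi =
      ⨆ a, MeasurableSpace.comap (X a) inferInstance := by
  rw [MeasurableSpace.pi, MeasurableSpace.comap_iSup]
  simp_rw [MeasurableSpace.comap_comp]
  rfl

variable {Ω : Type*} [MeasurableSpace Ω] {P : Measure Ω}

/-- Disjoint parts of an independent family are independent. -/
lemma indepFun_inl_inr {A B : Type*} {X : A ⊕ B → Ω → ℝ} (hm : ∀ a, Measurable (X a))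
    (h : iIndepFun X P) :
    IndepFun (fun ω a => X (.inl a) ω) (fun ω b => X (.inr b) ω) P := by
  have hd : Disjoint (Set.range (Sum.inl : A → A ⊕ B)) (Set.range (Sum.inr : B → A ⊕ B)) :=
    Set.isCompl_range_inl_range_inr.disjoint
  have := indep_iSup_of_disjoint (fun a => (hm a).comap_le) ((iIndepFun_iff_iIndep _ _ _).1 h) hd
  rw [IndepFun_iff_Indep, comap_pi_eq_iSup fun a => X (.inl a), comap_pi_eq_iSup fun b => X (.inr b)]
  rw [iSup_range, iSup_range] at this
  exact this

/-- The rows of an independent double array are independent. -/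
lemma iIndepFun_curry {ι κ : Type*} {X : ι × κ → Ω → ℝ} (hm : ∀ a, Measurable (X a))
    (h : iIndepFun X P) : iIndepFun (fun i ω k => X (i, k) ω) P := by
  have := h.isProbabilityMeasure
  have hp : ∀ a, IsProbabilityMeasure (P.map (X a)) := fun a =>
    Measure.isProbabilityMeasure_map (hm a).aemeasurable
  have h1 : iIndepFun (fun (p : (_ : ι) × κ) => X (p.1, p.2)) P :=
    h.precomp (g := fun p : (_ : ι) × κ => (p.1, p.2)) (Equiv.sigmaEquivProd ι κ).injective
  have hrow : ∀ i, P.map (fun ω k => X (i, k) ω) = Measure.infinitePi fun k => P.map (X (i, k)) :=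
    fun i => (iIndepFun_iff_map_fun_eq_infinitePi_map fun k => hm _).1
      (h.precomp (g := fun k => (i, k)) (Prod.mk_right_injective i))
  rw [iIndepFun_iff_map_fun_eq_infinitePi_map fun i => measurable_pi_lambda _ fun k => hm _]
  simp_rw [hrow]
  -- Independence is the statement that the joint law is a product, and a product measure over ι × κ
  -- curries to a product over ι of products over κ.
  rw [← Measure.infinitePi_map_piCurry (X := fun _ _ => ℝ) (fun (i : ι) (k : κ) => P.map (X (i, k))),
    ← (iIndepFun_iff_map_fun_eq_infinitePi_map fun p => hm _).1 h1,
    Measure.map_map (by fun_prop) (measurable_pi_lambda _ fun p => hm _)]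
  rfl

/-- The probability that all events of an independent family occur. -/
lemma measure_forall_eq_negexp [IsProbabilityMeasure P] {ι κ : Type*} [Countable ι]
    [MeasurableSpace κ] {Z : ι → Ω → κ} (hm : ∀ g, Measurable (Z g)) (h : iIndepFun Z P)
    {E : ι → Set κ} (hE : ∀ g, MeasurableSet (E g)) :
    P {ω | ∀ g, Z g ω ∈ E g} = negexp (∑' g, neglog (P.map (Z g) (E g))) := by
  have e1 : {ω | ∀ g, Z g ω ∈ E g} = ⋂ s : Finset ι, ⋂ g ∈ s, Z g ⁻¹' E g := by
    ext ω
    simp only [Set.mem_ofPred_eq, Set.mem_iInter, Set.mem_preimage]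
    exact ⟨fun h s g _ => h g, fun h g => h {g} g (by simp)⟩
  have hms : ∀ s : Finset ι, MeasurableSet (⋂ g ∈ s, Z g ⁻¹' E g) := fun s =>
    Finset.measurableSet_biInter s fun g _ => hm g (hE g)
  -- Continuity from above over finite index sets: the finite products decrease, while the sums of
  -- their `neglog`s increase to the infinite sum.
  rw [e1, Directed.measure_iInter (fun s => (hms s).nullMeasurableSet)
    (directed_of_isDirected_le fun s t hst => Set.biInter_subset_biInter_left hst)
    ⟨∅, measure_ne_top _ _⟩, ENNReal.tsum_eq_iSup_sum, negexp_iSup]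
  refine iInf_congr fun s => ?_
  rw [h.measure_inter_preimage_eq_mul s fun g _ => hE g, negexp_sum]
  refine Finset.prod_congr rfl fun g _ => ?_
  have := Measure.isProbabilityMeasure_map (hm g).aemeasurable (μ := P)
  rw [negexp_neglog prob_le_one, Measure.map_apply (hm g) (hE g)]

/-- If `U` and `V` are independent, the probability of an event in terms of `(U, V)` is the mean over
`U` of the probabilities over `V`. -/
lemma IndepFun.measure_pair [IsFiniteMeasure P] {α β : Type*} [MeasurableSpace α]
    [MeasurableSpace β] {U : Ω → α} {V : Ω → β} (hU : Measurable U) (hV : Measurable V)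
    (h : IndepFun U V P) {W : Set (α × β)} (hW : MeasurableSet W) :
    P {ω | (U ω, V ω) ∈ W} = ∫⁻ u, P {ω | (u, V ω) ∈ W} ∂(P.map U) := by
  have := Measure.map_apply (μ := P) (hU.prodMk hV) hW
  rw [h.map_prod_eq_prod_map_map hU.aemeasurable hV.aemeasurable, Measure.prod_apply hW] at this
  refine this.symm.trans (lintegral_congr fun u => ?_)
  rw [Measure.map_apply hV (measurable_prodMk_left hW)]
  rfl

/-- The probability that events hold which are conditionally independent given finitely many of the
variables. -/
lemma measure_forall_cond [IsProbabilityMeasure P] {ι A κ : Type*} [Countable ι] [Countable A]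
    [Countable κ] {X : A ⊕ (ι × κ) → Ω → ℝ} (hm : ∀ a, Measurable (X a)) (h : iIndepFun X P)
    {E₀ : Set (A → ℝ)} (hE₀ : MeasurableSet E₀) {E : ι → Set ((A → ℝ) × (κ → ℝ))}
    (hE : ∀ g, MeasurableSet (E g)) :
    P {ω | (fun a => X (.inl a) ω) ∈ E₀ ∧
        ∀ g, ((fun a => X (.inl a) ω), (fun b => X (.inr (g, b)) ω)) ∈ E g} =
      ∫⁻ z, E₀.indicator (fun _ => 1) z *
        negexp (∑' g, neglog (P.map (fun ω b => X (.inr (g, b)) ω) {ζ | (z, ζ) ∈ E g}))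
        ∂(P.map fun ω a => X (.inl a) ω) := by
  let W : Set ((A → ℝ) × (ι × κ → ℝ)) :=
    {w | w.1 ∈ E₀ ∧ ∀ g, (w.1, fun b => w.2 (g, b)) ∈ E g}
  have hW : MeasurableSet W := by
    refine (measurable_fst hE₀).inter ?_
    have : {w : (A → ℝ) × (ι × κ → ℝ) | ∀ g, (w.1, fun b => w.2 (g, b)) ∈ E g} =
      ⋂ g, (fun w : (A → ℝ) × (ι × κ → ℝ) => (w.1, fun b => w.2 (g, b))) ⁻¹' E g := by
      ext; simp
    change MeasurableSet {w : (A → ℝ) × (ι × κ → ℝ) | ∀ g, (w.1, fun b => w.2 (g, b)) ∈ E g}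
    rw [this]
    exact MeasurableSet.iInter fun g => (show Measurable _ by fun_prop) (hE g)
  have hmr : ∀ g, Measurable fun ω b => X (.inr (g, b)) ω := fun g =>
    measurable_pi_lambda _ fun b => hm _
  -- Once the variables indexed by `A` are fixed, condition `g` involves only row `g`, and the rows
  -- are independent.
  have key := IndepFun.measure_pair (measurable_pi_lambda _ fun a => hm (.inl a))
    (measurable_pi_lambda _ fun b => hm (.inr b)) (indepFun_inl_inr hm h) hW
  refine key.trans (lintegral_congr fun z => ?_)
  by_cases hz : z ∈ E₀
  · have hrows := iIndepFun_curry (fun b => hm (.inr b)) (h.precomp Sum.inr_injective)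
    have e := measure_forall_eq_negexp hmr hrows (E := fun g => {ζ | (z, ζ) ∈ E g})
      fun g => measurable_prodMk_left (hE g)
    rw [Set.indicator_of_mem hz, one_mul, ← e]
    simp [W, hz]
  · simp [W, hz]

end Independence

lemma measurableSet_forall_mem {α ι : Type*} [MeasurableSpace α] [Countable ι] {s : ι → Set α}
    (hs : ∀ i, MeasurableSet (s i)) : MeasurableSet {w | ∀ i, w ∈ s i} := by
  have : {w | ∀ i, w ∈ s i} = ⋂ i, s i := by ext; simp
  exact this ▸ MeasurableSet.iInter hs

/-! ### The marks relevant to a pair of eNBs -/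

namespace Network

/-- The timers of eNBs `i`, `k` and the fading variables between them. -/
def pairIndex (i k : ℕ) : Fin 4 → MarkIndex :=
  ![.inl (.inr i), .inl (.inr k), .inr (.inr (k, i)), .inr (.inr (i, k))]

/-- The timer of AP `j` and the fading from it to eNBs `i`, `k`. -/
def apIndex (i k j : ℕ) : Fin 3 → MarkIndex :=
  ![.inl (.inl j), .inr (.inl (j, i)), .inr (.inl (j, k))]

/-- The timer of eNB `m` and the fading from it to eNBs `i`, `k`. -/
def enbIndex (i k m : ℕ) : Fin 3 → MarkIndex :=
  ![.inl (.inr m), .inr (.inr (m, i)), .inr (.inr (m, k))]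

/-- All marks that matter for the transmissions of eNBs `i` and `k`. -/
def relevantIndex (i k : ℕ) : Fin 4 ⊕ ((ℕ ⊕ others i k) × Fin 3) → MarkIndex
  | .inl a => pairIndex i k a
  | .inr (.inl j, b) => apIndex i k j b
  | .inr (.inr m, b) => enbIndex i k m b

/-- No mark is shared between the pair and the third devices or between two third devices, so these
blocks of marks are independent. Excluding `i` and `k` from the third eNBs is essential: their
timers and mutual fading already belong to the pair. -/
lemma relevantIndex_injective {i k : ℕ} (hik : i ≠ k) :
    Function.Injective (relevantIndex i k) := by
  rintro (a | ⟨j | ⟨m, hm⟩, b⟩) (a' | ⟨j' | ⟨m', hm'⟩, b'⟩) h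
  all_goals
    first
    | (fin_cases a <;> fin_cases a')
    | (fin_cases a <;> fin_cases b')
    | (fin_cases b <;> fin_cases a')
    | (fin_cases b <;> fin_cases b')
  all_goals
    try simp_all [relevantIndex, pairIndex, apIndex, enbIndex]
  all_goals
    first
    | exact (hm'.1 h.symm).elim
    | exact (hm'.2 h.symm).elim
    | exact (hm.1 h).elim
    | exact (hm.2 h).elim

end Network

/-- The law of a timer is uniform, the law of a fading variable is exponential. -/
def pairLaw (mu : ℝ) : Fin 4 → Measure ℝ :=
  ![volume.restrict (Set.Icc 0 1), volume.restrict (Set.Icc 0 1), expMeasure mu, expMeasure mu]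

/-- The law of the timer of a third device and its fading to the two eNBs of a pair. -/
def thirdLaw (mu : ℝ) : Fin 3 → Measure ℝ :=
  ![volume.restrict (Set.Icc 0 1), expMeasure mu, expMeasure mu]

instance : IsProbabilityMeasure (volume.restrict (Set.Icc (0 : ℝ) 1)) :=
  ⟨by simp⟩

lemma isProbabilityMeasure_pairLaw {mu : ℝ} (hmu : 0 < mu) (a : Fin 4) :
    IsProbabilityMeasure (pairLaw mu a) := by
  have := isProbabilityMeasure_expMeasure hmu
  fin_cases a <;> simp [pairLaw] <;> infer_instance

lemma isProbabilityMeasure_thirdLaw {mu : ℝ} (hmu : 0 < mu) (a : Fin 3) :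
    IsProbabilityMeasure (thirdLaw mu a) := by
  have := isProbabilityMeasure_expMeasure hmu
  fin_cases a <;> simp [thirdLaw] <;> infer_instance

/-! ### Pair events given the locations -/

section Abstract

variable {Ω : Type*} [MeasurableSpace Ω] {P : Measure Ω} {p : Params} {net : Network Ω}

namespace Network.IsLBTNetwork

lemma map_pairIndex [IsProbabilityMeasure P] (h : net.IsLBTNetwork p P) {i k : ℕ} (hik : i ≠ k) :
    P.map (fun ω a => net.mark (pairIndex i k a) ω) = Measure.pi (pairLaw p.mu) := by
  have hi : Function.Injective (pairIndex i k) := fun a b hab =>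
    Sum.inl_injective (relevantIndex_injective hik (a₁ := .inl a) (a₂ := .inl b) hab)
  rw [(h.indep_marks.precomp hi).map_fun_eq_pi_map fun a => (h.measurable_mark _).aemeasurable]
  congr 1
  funext a
  fin_cases a
  exacts [(h.law_tL i).map_eq, (h.law_tL k).map_eq, (h.law_GLL k i).map_eq, (h.law_GLL i k).map_eq]

lemma map_apIndex [IsProbabilityMeasure P] (h : net.IsLBTNetwork p P) {i k : ℕ} (hik : i ≠ k)
    (j : ℕ) :
    P.map (fun ω a => net.mark (apIndex i k j a) ω) = Measure.pi (thirdLaw p.mu) := by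
  have hi : Function.Injective (apIndex i k j) := fun a b hab => by
    simpa using relevantIndex_injective hik (a₁ := .inr (.inl j, a)) (a₂ := .inr (.inl j, b)) hab
  rw [(h.indep_marks.precomp hi).map_fun_eq_pi_map fun a => (h.measurable_mark _).aemeasurable]
  congr 1
  funext a
  fin_cases a
  exacts [(h.law_tW j).map_eq, (h.law_GWL j i).map_eq, (h.law_GWL j k).map_eq]

lemma map_enbIndex [IsProbabilityMeasure P] (h : net.IsLBTNetwork p P) {i k : ℕ} (hik : i ≠ k)
    (m : others i k) :
    P.map (fun ω a => net.mark (enbIndex i k m a) ω) = Measure.pi (thirdLaw p.mu) := by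
  have hi : Function.Injective (enbIndex i k m) := fun a b hab => by
    simpa using relevantIndex_injective hik (a₁ := .inr (.inr m, a)) (a₂ := .inr (.inr m, b)) hab
  rw [(h.indep_marks.precomp hi).map_fun_eq_pi_map fun a => (h.measurable_mark _).aemeasurable]
  congr 1
  funext a
  fin_cases a
  exacts [(h.law_tL m).map_eq, (h.law_GLL m i).map_eq, (h.law_GLL m k).map_eq]

end Network.IsLBTNetwork

/-- The locations of two eNBs, their timers and the fading variables between them. -/
abbrev PairState : Type := (Plane × Plane) × (Fin 4 → ℝ)

/-- The location of a third device, its timer and the fading from it to the two eNBs. -/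
abbrev ThirdState : Type := Plane × (Fin 3 → ℝ)

/-- The state of the eNBs `i` and `k`. -/
def Network.pairState (net : Network Ω) (i k : ℕ) (ω : Ω) : PairState :=
  ((net.y i ω, net.y k ω), fun a => net.mark (Network.pairIndex i k a) ω)

/-- An event that imposes one condition on the eNBs `i` and `k`, and conditions on each AP and on
each other eNB in relation to them. -/
def Network.pairEvent (net : Network Ω) (E₀ : Set PairState) (EW EL : Set (PairState × ThirdState))
    (i k : ℕ) : Set Ω :=
  {ω | net.pairState i k ω ∈ E₀ ∧
    (∀ j, (net.pairState i k ω,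
      (net.x j ω, fun a => net.mark (Network.apIndex i k j a) ω)) ∈ EW) ∧
    ∀ m : others i k, (net.pairState i k ω,
      (net.y m ω, fun a => net.mark (Network.enbIndex i k m a) ω)) ∈ EL}

/-- The probability that a third device at `z` satisfies the condition `E`. -/
def thirdProb (mu : ℝ) (E : Set (PairState × ThirdState)) (c : PairState) (z : Plane) : ℝ≥0∞ :=
  Measure.pi (thirdLaw mu) {ζ | (c, (z, ζ)) ∈ E}

lemma measurable_thirdProb {mu : ℝ} (hmu : 0 < mu) {E : Set (PairState × ThirdState)}
    (hE : MeasurableSet E) : Measurable (Function.uncurry (thirdProb mu E)) := by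
  have := isProbabilityMeasure_thirdLaw hmu
  have hs : MeasurableSet {w : (PairState × Plane) × (Fin 3 → ℝ) | (w.1.1, (w.1.2, w.2)) ∈ E} :=
    (show Measurable fun w : (PairState × Plane) × (Fin 3 → ℝ) => (w.1.1, (w.1.2, w.2)) by
      fun_prop) hE
  exact measurable_measure_prodMk_left (ν := Measure.pi (thirdLaw mu)) hs

lemma thirdProb_le_one {mu : ℝ} (hmu : 0 < mu) (E : Set (PairState × ThirdState)) (c : PairState)
    (z : Plane) : thirdProb mu E c z ≤ 1 := by
  have := isProbabilityMeasure_thirdLaw hmu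
  exact prob_le_one

/-- The probability of a pair event, given the locations. -/
lemma Network.IsLBTNetwork.measure_pairEvent [IsProbabilityMeasure P] (h : net.IsLBTNetwork p P)
    {E₀ : Set PairState} (hE₀ : MeasurableSet E₀) {EW EL : Set (PairState × ThirdState)}
    (hEW : MeasurableSet EW) (hEL : MeasurableSet EL) {i k : ℕ} (hik : i ≠ k) :
    P (net.pairEvent E₀ EW EL i k) = ∫⁻ ω, ∫⁻ z, E₀.indicator (fun _ => 1) ((net.y i ω, net.y k ω), z) *
      (negexp (∑' j, neglog (thirdProb p.mu EW ((net.y i ω, net.y k ω), z) (net.x j ω))) *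
        negexp (∑' m : others i k,
          neglog (thirdProb p.mu EL ((net.y i ω, net.y k ω), z) (net.y m ω))))
      ∂(Measure.pi (pairLaw p.mu)) ∂P := by
  let U : Ω → (ℕ → Plane) × (ℕ → Plane) := fun ω => (fun i => net.x i ω, fun i => net.y i ω)
  let V : Ω → MarkIndex → ℝ := fun ω m => net.mark m ω
  have hU : Measurable U := (measurable_pi_lambda _ h.poissonW.measurable).prodMk
    (measurable_pi_lambda _ h.poissonL.measurable)
  have hV : Measurable V := measurable_pi_lambda _ h.measurable_mark
  let st : ((ℕ → Plane) × (ℕ → Plane)) × (MarkIndex → ℝ) → PairState := fun w =>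
    ((w.1.2 i, w.1.2 k), fun a => w.2 (pairIndex i k a))
  have hst : Measurable st := by fun_prop
  let W : Set (((ℕ → Plane) × (ℕ → Plane)) × (MarkIndex → ℝ)) :=
    {w | st w ∈ E₀ ∧ (∀ j, (st w, (w.1.1 j, fun a => w.2 (apIndex i k j a))) ∈ EW) ∧
      ∀ m : others i k, (st w, (w.1.2 m, fun a => w.2 (enbIndex i k m a))) ∈ EL}
  have hW : MeasurableSet W := by
    refine (hst hE₀).inter (MeasurableSet.inter ?_ ?_)
    · have : ∀ j, MeasurableSet {w : ((ℕ → Plane) × (ℕ → Plane)) × (MarkIndex → ℝ) |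
          (st w, (w.1.1 j, fun a => w.2 (apIndex i k j a))) ∈ EW} := fun j =>
        (show Measurable fun w => (st w, (w.1.1 j, fun a => w.2 (apIndex i k j a))) by fun_prop) hEW
      exact measurableSet_forall_mem this
    · have : ∀ m : others i k, MeasurableSet {w : ((ℕ → Plane) × (ℕ → Plane)) × (MarkIndex → ℝ) |
          (st w, (w.1.2 m, fun a => w.2 (enbIndex i k m a))) ∈ EL} := fun m =>
        (show Measurable fun w => (st w, (w.1.2 m, fun a => w.2 (enbIndex i k m a))) by
          fun_prop) hEL
      exact measurableSet_forall_mem this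
  -- The marks are independent of the locations, so all locations can be frozen first.
  have key := IndepFun.measure_pair hU hV h.indep_marks_locations hW
  have hev : net.pairEvent E₀ EW EL i k = {ω | (U ω, V ω) ∈ W} := rfl
  have hmeas : Measurable fun u => P {ω | (u, V ω) ∈ W} := by
    have e : (fun u => P {ω | (u, V ω) ∈ W}) = fun u => P.map V (Prod.mk u ⁻¹' W) :=
      funext fun u => (Measure.map_apply hV (measurable_prodMk_left hW)).symm
    exact e ▸ measurable_measure_prodMk_left hW
  rw [hev, key, lintegral_map hmeas hU]
  refine lintegral_congr fun ω => ?_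
  -- APs and other eNBs are treated as one family of third devices; the exponent is split again into
  -- two sums at the end.
  let E : ℕ ⊕ others i k → Set ((Fin 4 → ℝ) × (Fin 3 → ℝ)) := Sum.elim
    (fun j => {w | (((net.y i ω, net.y k ω), w.1), (net.x j ω, w.2)) ∈ EW})
    (fun m => {w | (((net.y i ω, net.y k ω), w.1), (net.y m ω, w.2)) ∈ EL})
  have hE : ∀ g, MeasurableSet (E g) := by
    rintro (j | m)
    · exact (show Measurable fun w : (Fin 4 → ℝ) × (Fin 3 → ℝ) =>
        (((net.y i ω, net.y k ω), w.1), (net.x j ω, w.2)) by fun_prop) hEW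
    · exact (show Measurable fun w : (Fin 4 → ℝ) × (Fin 3 → ℝ) =>
        (((net.y i ω, net.y k ω), w.1), (net.y m ω, w.2)) by fun_prop) hEL
  have hc := measure_forall_cond (fun a => h.measurable_mark (relevantIndex i k a))
    (h.indep_marks.precomp (relevantIndex_injective hik))
    (E₀ := {z | ((net.y i ω, net.y k ω), z) ∈ E₀}) (measurable_prodMk_left hE₀) hE
  refine Eq.trans ?_ (hc.trans ?_)
  · congr 1
    ext ω'
    simp only [Set.mem_ofPred_eq, Sum.forall]
    rfl
  · rw [show (fun ω a => net.mark (relevantIndex i k (.inl a)) ω) =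
      fun ω a => net.mark (pairIndex i k a) ω from rfl, h.map_pairIndex hik]
    refine lintegral_congr fun z => ?_
    rw [← negexp_add]
    refine congrArg₂ (· * ·) rfl (congrArg negexp ?_)
    refine (HasSum.sum ENNReal.summable.hasSum ENNReal.summable.hasSum).tsum_eq.trans
      (congrArg₂ (· + ·) (tsum_congr fun j => ?_) (tsum_congr fun m => ?_))
    · refine congrArg neglog ?_
      change P.map (fun ω a => net.mark (apIndex i k j a) ω) _ = _
      rw [h.map_apIndex hik]
      rfl
    · refine congrArg neglog ?_
      change P.map (fun ω a => net.mark (enbIndex i k m a) ω) _ = _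
      rw [h.map_enbIndex hik]
      rfl

end Abstract

/-! ### Expected numbers of pairs of eNBs -/

section Campbell

variable {Ω : Type*} [MeasurableSpace Ω] {P : Measure Ω} {p : Params} {net : Network Ω}

/-- The Laplace functional of the APs is independent of the eNBs. -/
lemma Network.IsLBTNetwork.lintegral_mul_laplace [IsProbabilityMeasure P]
    (h : net.IsLBTNetwork p P) {f : (ℕ → Plane) → ℝ≥0∞} (hf : Measurable f)
    {v : (ℕ → Plane) → Plane × Plane} (hv : Measurable v) {g : Plane × Plane → Plane → ℝ≥0∞}
    (hg : Measurable (Function.uncurry g)) :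
    ∫⁻ ω, f (fun i => net.y i ω) *
        negexp (∑' j, g (v fun i => net.y i ω) (net.x j ω)) ∂P =
      ∫⁻ ω, f (fun i => net.y i ω) * negexp (ENNReal.ofReal p.lamW *
        ∫⁻ u, (1 - negexp (g (v fun i => net.y i ω) u))) ∂P := by
  have hX : Measurable fun ω i => net.x i ω := measurable_pi_lambda _ h.poissonW.measurable
  have hY : Measurable fun ω i => net.y i ω := measurable_pi_lambda _ h.poissonL.measurable
  have hgv : ∀ c, Measurable (g c) := fun c => hg.comp measurable_prodMk_left
  let Ψ : (ℕ → Plane) × (ℕ → Plane) → ℝ≥0∞ := fun w => f w.2 * negexp (∑' j, g (v w.2) (w.1 j))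
  have hΨ : Measurable Ψ := by
    refine (hf.comp measurable_snd).mul (measurable_negexp.comp (Measurable.tsum fun j => ?_))
    exact hg.comp ((hv.comp measurable_snd).prodMk ((measurable_pi_apply j).comp measurable_fst))
  have e1 : ∫⁻ ω, f (fun i => net.y i ω) *
      negexp (∑' j, g (v fun i => net.y i ω) (net.x j ω)) ∂P =
      ∫⁻ w, Ψ w ∂(P.map fun ω => (fun i => net.x i ω, fun i => net.y i ω)) :=
    (lintegral_map hΨ (hX.prodMk hY)).symm
  rw [e1, h.indep_locations.map_prod_eq_prod_map_map hX.aemeasurable hY.aemeasurable,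
    lintegral_prod_symm _ hΨ.aemeasurable, lintegral_map hΨ.lintegral_prod_left' hY]
  refine lintegral_congr fun ω => ?_
  have hΨ' : Measurable fun x => Ψ (x, fun i => net.y i ω) := hΨ.comp measurable_prodMk_right
  have hne : Measurable fun ω' => negexp (∑' j, g (v fun i => net.y i ω) (net.x j ω')) :=
    measurable_negexp.comp (Measurable.tsum fun m => (hgv _).comp (h.poissonW.measurable m))
  rw [lintegral_map hΨ' hX, ← h.poissonW.laplace p.lamW_pos.le (hgv _), ← lintegral_const_mul _ hne]

/-- The expected number of pairs of eNBs for which a pair event occurs. -/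
theorem Network.IsLBTNetwork.tsum_pairEvent [IsProbabilityMeasure P] (h : net.IsLBTNetwork p P)
    {E₀ : Set PairState} (hE₀ : MeasurableSet E₀) {EW EL : Set (PairState × ThirdState)}
    (hEW : MeasurableSet EW) (hEL : MeasurableSet EL) :
    ∑' q : {q : ℕ × ℕ // q.1 ≠ q.2}, P (net.pairEvent E₀ EW EL q.1.1 q.1.2) =
      ENNReal.ofReal p.lamL ^ 2 * ∫⁻ v : Plane × Plane, ∫⁻ z,
        E₀.indicator (fun _ => 1) (v, z) *
          negexp (ENNReal.ofReal p.lamW * ∫⁻ u, (1 - thirdProb p.mu EW (v, z) u)) *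
          negexp (ENNReal.ofReal p.lamL * ∫⁻ u, (1 - thirdProb p.mu EL (v, z) u))
        ∂(Measure.pi (pairLaw p.mu)) := by
  have hpi := isProbabilityMeasure_pairLaw p.mu_pos
  set ν := Measure.pi (pairLaw p.mu)
  have hI : Measurable (E₀.indicator fun _ => (1 : ℝ≥0∞)) := measurable_const.indicator hE₀
  have hW := measurable_thirdProb p.mu_pos hEW
  have hL := measurable_thirdProb p.mu_pos hEL
  -- These exponents satisfy `negexp (g c u) = thirdProb ...`, the form required by the Laplace
  -- functional and Mecke's equation; a zero probability corresponds to the exponent ∞.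
  let gW : PairState → Plane → ℝ≥0∞ := fun c u => neglog (thirdProb p.mu EW c u)
  let gL : PairState → Plane → ℝ≥0∞ := fun c u => neglog (thirdProb p.mu EL c u)
  have hgW : Measurable (Function.uncurry gW) := measurable_neglog.comp hW
  have hgL : Measurable (Function.uncurry gL) := measurable_neglog.comp hL
  have hgWe : ∀ c u, negexp (gW c u) = thirdProb p.mu EW c u := fun c u =>
    negexp_neglog (thirdProb_le_one p.mu_pos EW c u)
  have hgLe : ∀ c u, negexp (gL c u) = thirdProb p.mu EL c u := fun c u =>
    negexp_neglog (thirdProb_le_one p.mu_pos EL c u)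
  let st : ℕ → ℕ → (Fin 4 → ℝ) → (ℕ → Plane) → PairState := fun i k z y => ((y i, y k), z)
  let Lap : PairState → ℝ≥0∞ := fun c =>
    negexp (ENNReal.ofReal p.lamW * ∫⁻ u, (1 - thirdProb p.mu EW c u))
  have hLap : Measurable Lap :=
    measurable_negexp.comp ((hW.const_sub 1).lintegral_prod_right'.const_mul _)
  have hLap' : Measurable fun c : PairState =>
      negexp (ENNReal.ofReal p.lamL * ∫⁻ u, (1 - thirdProb p.mu EL c u)) :=
    measurable_negexp.comp ((hL.const_sub 1).lintegral_prod_right'.const_mul _)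
  have hY := h.poissonL.measurable
  have hX := h.poissonW.measurable
  -- The pair's marks are moved to the outer integral and the APs are integrated out; what they
  -- contribute, `Lap`, depends only on the state of the pair.
  have e1 : ∀ q : {q : ℕ × ℕ // q.1 ≠ q.2}, P (net.pairEvent E₀ EW EL q.1.1 q.1.2) =
      ∫⁻ z, ∫⁻ ω, (E₀.indicator (fun _ => 1) ((net.y q.1.1 ω, net.y q.1.2 ω), z) *
        Lap ((net.y q.1.1 ω, net.y q.1.2 ω), z)) * negexp (∑' m : others q.1.1 q.1.2,
          gL ((net.y q.1.1 ω, net.y q.1.2 ω), z) (net.y m ω)) ∂P ∂ν := by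
    rintro ⟨⟨i, k⟩, hik⟩
    have hst : Measurable fun w : Ω × (Fin 4 → ℝ) => (((net.y i w.1, net.y k w.1), w.2) : PairState) :=
      (((hY i).comp measurable_fst).prodMk ((hY k).comp measurable_fst)).prodMk measurable_snd
    rw [h.measure_pairEvent hE₀ hEW hEL hik, lintegral_lintegral_swap]
    · refine lintegral_congr fun z => ?_
      have hv : Measurable fun y : ℕ → Plane => (y i, y k) := by fun_prop
      have hs : Measurable fun y : ℕ → Plane => (((y i, y k), z) : PairState) := by fun_prop
      have hf : Measurable fun y : ℕ → Plane => E₀.indicator (fun _ => 1) ((y i, y k), z) *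
          negexp (∑' m : others i k, gL ((y i, y k), z) (y m)) :=
        (hI.comp hs).mul (measurable_negexp.comp (Measurable.tsum fun m =>
          hgL.comp (hs.prodMk (measurable_pi_apply _))))
      have hg : Measurable (Function.uncurry fun (c : Plane × Plane) u => gW (c, z) u) :=
        hgW.comp (f := fun w : (Plane × Plane) × Plane => ((w.1, z), w.2)) (by fun_prop)
      have := h.lintegral_mul_laplace hf hv hg
      simp_rw [hgWe] at this
      refine Eq.trans (lintegral_congr fun ω => ?_) (this.trans (lintegral_congr fun ω => ?_))
      · simp only [gL, gW]; ring
      · simp only [Lap]; ring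
    · refine Measurable.aemeasurable ?_
      refine (hI.comp hst).mul (Measurable.mul ?_ ?_)
      · exact measurable_negexp.comp (Measurable.tsum fun j =>
          hgW.comp (hst.prodMk ((hX j).comp measurable_fst)))
      · exact measurable_negexp.comp (Measurable.tsum fun m =>
          hgL.comp (hst.prodMk ((hY _).comp measurable_fst)))
  have hmz : ∀ q : {q : ℕ × ℕ // q.1 ≠ q.2}, Measurable fun z =>
      ∫⁻ ω, (E₀.indicator (fun _ => 1) ((net.y q.1.1 ω, net.y q.1.2 ω), z) *
        Lap ((net.y q.1.1 ω, net.y q.1.2 ω), z)) * negexp (∑' m : others q.1.1 q.1.2,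
          gL ((net.y q.1.1 ω, net.y q.1.2 ω), z) (net.y m ω)) ∂P := by
    intro q
    have hst : Measurable fun w : (Fin 4 → ℝ) × Ω =>
        (((net.y q.1.1 w.2, net.y q.1.2 w.2), w.1) : PairState) :=
      (((hY _).comp measurable_snd).prodMk ((hY _).comp measurable_snd)).prodMk measurable_fst
    exact Measurable.lintegral_prod_right' (f := fun w : (Fin 4 → ℝ) × Ω =>
      (E₀.indicator (fun _ => 1) ((net.y q.1.1 w.2, net.y q.1.2 w.2), w.1) *
        Lap ((net.y q.1.1 w.2, net.y q.1.2 w.2), w.1)) * negexp (∑' m : others q.1.1 q.1.2,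
          gL ((net.y q.1.1 w.2, net.y q.1.2 w.2), w.1) (net.y m w.2)))
      (((hI.comp hst).mul (hLap.comp hst)).mul (measurable_negexp.comp (Measurable.tsum fun m =>
        hgL.comp (hst.prodMk ((hY _).comp measurable_snd)))))
  rw [tsum_congr e1, ← lintegral_tsum fun q => (hmz q).aemeasurable]
  -- Mecke's equation for the eNBs, with the marks `z` of the pair held fixed.
  have e2 : ∀ z, ∑' q : {q : ℕ × ℕ // q.1 ≠ q.2},
      ∫⁻ ω, (E₀.indicator (fun _ => 1) ((net.y q.1.1 ω, net.y q.1.2 ω), z) *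
        Lap ((net.y q.1.1 ω, net.y q.1.2 ω), z)) * negexp (∑' m : others q.1.1 q.1.2,
          gL ((net.y q.1.1 ω, net.y q.1.2 ω), z) (net.y m ω)) ∂P =
      ENNReal.ofReal p.lamL ^ 2 * ∫⁻ v : Plane × Plane,
        E₀.indicator (fun _ => 1) (v, z) * Lap (v, z) *
          negexp (ENNReal.ofReal p.lamL * ∫⁻ u, (1 - thirdProb p.mu EL (v, z) u)) := by
    intro z
    have hs : Measurable fun v : Plane × Plane => ((v, z) : PairState) := by fun_prop
    have hg : Measurable (Function.uncurry fun (c : Plane × Plane) u => gL (c, z) u) :=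
      hgL.comp (f := fun w : (Plane × Plane) × Plane => ((w.1, z), w.2)) (by fun_prop)
    have := h.poissonL.mecke p.lamL_pos.le ((hI.comp hs).mul (hLap.comp hs)) hg
    simp_rw [hgLe] at this
    exact this
  have hf : Measurable fun c : PairState => E₀.indicator (fun _ => 1) c * Lap c *
      negexp (ENNReal.ofReal p.lamL * ∫⁻ u, (1 - thirdProb p.mu EL c u)) :=
    (hI.mul hLap).mul hLap'
  simp_rw [e2]
  rw [lintegral_const_mul, lintegral_lintegral_swap]
  · exact (hf.comp measurable_swap).aemeasurable
  · exact hf.lintegral_prod_left'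

end Campbell

/-! ### Blocking probabilities -/

lemma expMeasure_real_Ioi {mu c : ℝ} (hmu : 0 < mu) (hc : 0 ≤ c) :
    (expMeasure mu).real (Set.Ioi c) = Real.exp (-(mu * c)) := by
  have := isProbabilityMeasure_expMeasure hmu
  have h := cdf_expMeasure_eq hmu c
  rw [cdf_eq_real, if_pos hc] at h
  rw [← Set.compl_Iic, probReal_compl_eq_one_sub measurableSet_Iic, h]
  ring

lemma uniform_real_Iio {s : ℝ} (hs : s ∈ Set.Icc (0 : ℝ) 1) :
    (volume.restrict (Set.Icc (0 : ℝ) 1)).real (Set.Iio s) = s := by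
  have : Set.Iio s ∩ Set.Icc 0 1 = Set.Ico 0 s := by
    ext x
    simp only [Set.mem_inter_iff, Set.mem_Iio, Set.mem_Icc, Set.mem_Ico]
    exact ⟨fun h => ⟨h.2.1, h.1⟩, fun h => ⟨h.2, h.1, h.2.le.trans hs.2⟩⟩
  rw [measureReal_restrict_apply measurableSet_Iio, this, Real.volume_real_Ico_of_le hs.1, sub_zero]

lemma thirdLaw_real_box (mu : ℝ) (hmu : 0 < mu) (A B C : Set ℝ) :
    (Measure.pi (thirdLaw mu)).real {ζ | ζ 0 ∈ A ∧ ζ 1 ∈ B ∧ ζ 2 ∈ C} =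
      (volume.restrict (Set.Icc (0 : ℝ) 1)).real A * (expMeasure mu).real B *
        (expMeasure mu).real C := by
  have := isProbabilityMeasure_thirdLaw hmu
  have e : {ζ : Fin 3 → ℝ | ζ 0 ∈ A ∧ ζ 1 ∈ B ∧ ζ 2 ∈ C} = Set.univ.pi ![A, B, C] := by
    ext ζ
    simp [Set.mem_pi, Fin.forall_fin_succ]
  rw [e, measureReal_def, Measure.pi_pi, Fin.prod_univ_three, ENNReal.toReal_mul,
    ENNReal.toReal_mul]
  rfl

/-- The probability that a third device blocks an eNB with timer `s` that receives it with probability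
`q₁` or, if `b`, another eNB with timer `t` that receives it with probability `q₂`, if both receive it
with probability `q₁₂`. -/
def blockProb (b : Bool) (s t q₁ q₂ q₁₂ : ℝ) : ℝ :=
  if b then s * q₁ + t * q₂ - min s t * q₁₂ else s * q₁

/-- Inclusion–exclusion. A device that blocks both eNBs has a single timer, below min(s, t), but two
independent fading variables. -/
lemma thirdLaw_blocked {mu : ℝ} (hmu : 0 < mu) {s t c₁ c₂ : ℝ} (hs : s ∈ Set.Icc (0 : ℝ) 1)
    (ht : t ∈ Set.Icc (0 : ℝ) 1) (hc₁ : 0 ≤ c₁) (hc₂ : 0 ≤ c₂) (b : Bool) :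
    (Measure.pi (thirdLaw mu)).real
      {ζ | (ζ 0 < s ∧ c₁ < ζ 1) ∨ (b = true ∧ ζ 0 < t ∧ c₂ < ζ 2)} =
      blockProb b s t (Real.exp (-(mu * c₁))) (Real.exp (-(mu * c₂)))
        (Real.exp (-(mu * c₁)) * Real.exp (-(mu * c₂))) := by
  have := isProbabilityMeasure_thirdLaw hmu
  have hexp := isProbabilityMeasure_expMeasure hmu
  have hst : min s t ∈ Set.Icc (0 : ℝ) 1 := ⟨le_min hs.1 ht.1, (min_le_left _ _).trans hs.2⟩
  have e1 : (Measure.pi (thirdLaw mu)).real {ζ | ζ 0 < s ∧ c₁ < ζ 1} =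
      s * Real.exp (-(mu * c₁)) := by
    have := thirdLaw_real_box mu hmu (Set.Iio s) (Set.Ioi c₁) Set.univ
    rw [uniform_real_Iio hs, expMeasure_real_Ioi hmu hc₁, probReal_univ, mul_one] at this
    simpa using this
  cases b
  · simpa [blockProb] using e1
  have e2 : (Measure.pi (thirdLaw mu)).real {ζ | ζ 0 < t ∧ c₂ < ζ 2} =
      t * Real.exp (-(mu * c₂)) := by
    have := thirdLaw_real_box mu hmu (Set.Iio t) Set.univ (Set.Ioi c₂)
    rw [uniform_real_Iio ht, expMeasure_real_Ioi hmu hc₂, probReal_univ, mul_one] at this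
    simpa using this
  have e3 : (Measure.pi (thirdLaw mu)).real
      ({ζ | ζ 0 < s ∧ c₁ < ζ 1} ∩ {ζ | ζ 0 < t ∧ c₂ < ζ 2}) =
      min s t * (Real.exp (-(mu * c₁)) * Real.exp (-(mu * c₂))) := by
    have := thirdLaw_real_box mu hmu (Set.Iio (min s t)) (Set.Ioi c₁) (Set.Ioi c₂)
    rw [uniform_real_Iio hst, expMeasure_real_Ioi hmu hc₁, expMeasure_real_Ioi hmu hc₂,
      mul_assoc] at this
    rw [← this]
    congr 1
    ext ζ
    simp only [Set.mem_inter_iff, Set.mem_ofPred_eq, Set.mem_Iio, Set.mem_Ioi, lt_min_iff]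
    tauto
  have hm : MeasurableSet {ζ : Fin 3 → ℝ | ζ 0 < t ∧ c₂ < ζ 2} :=
    (measurableSet_lt (measurable_pi_apply 0) measurable_const).inter
      (measurableSet_lt measurable_const (measurable_pi_apply 2))
  have := measureReal_union_add_inter (μ := Measure.pi (thirdLaw mu))
    (s := {ζ : Fin 3 → ℝ | ζ 0 < s ∧ c₁ < ζ 1}) hm
  rw [e1, e2, e3] at this
  simp only [true_and, blockProb, if_true]
  rw [Set.ofPred_or]
  linarith

lemma measurableSet_imp_mem {α : Type*} [MeasurableSpace α] (q : Prop) {s : Set α}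
    (hs : MeasurableSet s) : MeasurableSet {w | q → w ∈ s} := by
  by_cases hq : q
  · have : {w | q → w ∈ s} = s := by ext; simp [hq]
    rwa [this]
  · have : {w | q → w ∈ s} = Set.univ := by ext; simp [hq]
    rw [this]
    exact MeasurableSet.univ

namespace Params

variable (p : Params)

/-- The probability that a transmission is received above the threshold `θ` at distance `d`. -/
def sense (θ d : ℝ) : ℝ := Real.exp (-(p.mu * θ * p.pathLoss d))

/-- An AP blocks neither the first nor, if `b`, the second eNB of a pair. -/
def apCond (b : Bool) : Set (PairState × ThirdState) :=
  {w | (w.1.2 0 ≤ w.2.2 0 ∨ w.2.2 1 / p.pathLoss ‖w.1.1.1 - w.2.1‖ ≤ p.Gam / p.PW) ∧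
    (b = true → (w.1.2 1 ≤ w.2.2 0 ∨ w.2.2 2 / p.pathLoss ‖w.1.1.2 - w.2.1‖ ≤ p.Gam / p.PW))}

/-- A third eNB is not closer to the origin than the first eNB of a pair, and blocks neither the first
nor, if `b`, the second eNB of the pair. -/
def enbCond (b : Bool) : Set (PairState × ThirdState) :=
  {w | ‖w.1.1.1‖ ≤ ‖w.2.1‖ ∧
    (w.1.2 0 ≤ w.2.2 0 ∨ w.2.2 1 / p.pathLoss ‖w.2.1 - w.1.1.1‖ ≤ p.Gam / p.PL) ∧
    (b = true → (w.1.2 1 ≤ w.2.2 0 ∨ w.2.2 2 / p.pathLoss ‖w.2.1 - w.1.1.2‖ ≤ p.Gam / p.PL))}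

/-- The first eNB of a pair is not farther from the origin than the second one, which does not block
it, and, if `b`, is not blocked by it. -/
def pairCond (b : Bool) : Set PairState :=
  {c | ‖c.1.1‖ ≤ ‖c.1.2‖ ∧ (c.2 0 ≤ c.2 1 ∨ c.2 2 / p.pathLoss ‖c.1.2 - c.1.1‖ ≤ p.Gam / p.PL) ∧
    (b = true → (c.2 1 ≤ c.2 0 ∨ c.2 3 / p.pathLoss ‖c.1.1 - c.1.2‖ ≤ p.Gam / p.PL))}

@[fun_prop]
lemma measurable_pathLoss : Measurable p.pathLoss := by
  unfold pathLoss
  fun_prop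

lemma pathLoss_pos {d : ℝ} (hd : 0 < d) : 0 < p.pathLoss d := by
  have := p.lamC_pos
  unfold pathLoss
  positivity

lemma pathLoss_nonneg {d : ℝ} (hd : 0 ≤ d) : 0 ≤ p.pathLoss d := by
  unfold pathLoss
  positivity

lemma measurableSet_le_or_div_le {α : Type*} [MeasurableSpace α] {s t g d : α → ℝ} {θ : ℝ}
    (hs : Measurable s) (ht : Measurable t) (hg : Measurable g) (hd : Measurable d) :
    MeasurableSet {w | s w ≤ t w ∨ g w / p.pathLoss (d w) ≤ θ} :=
  (measurableSet_le hs ht).union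
    (measurableSet_le (hg.div (p.measurable_pathLoss.comp hd)) measurable_const)

lemma measurableSet_apCond (b : Bool) : MeasurableSet (p.apCond b) := by
  have h1 : MeasurableSet {w : PairState × ThirdState |
      w.1.2 0 ≤ w.2.2 0 ∨ w.2.2 1 / p.pathLoss ‖w.1.1.1 - w.2.1‖ ≤ p.Gam / p.PW} :=
    p.measurableSet_le_or_div_le (by fun_prop) (by fun_prop) (by fun_prop) (by fun_prop)
  have h2 : MeasurableSet {w : PairState × ThirdState |
      w.1.2 1 ≤ w.2.2 0 ∨ w.2.2 2 / p.pathLoss ‖w.1.1.2 - w.2.1‖ ≤ p.Gam / p.PW} :=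
    p.measurableSet_le_or_div_le (by fun_prop) (by fun_prop) (by fun_prop) (by fun_prop)
  exact h1.inter (measurableSet_imp_mem _ h2)

lemma measurableSet_enbCond (b : Bool) : MeasurableSet (p.enbCond b) := by
  have h0 : MeasurableSet {w : PairState × ThirdState | ‖w.1.1.1‖ ≤ ‖w.2.1‖} :=
    measurableSet_le (by fun_prop) (by fun_prop)
  have h1 : MeasurableSet {w : PairState × ThirdState |
      w.1.2 0 ≤ w.2.2 0 ∨ w.2.2 1 / p.pathLoss ‖w.2.1 - w.1.1.1‖ ≤ p.Gam / p.PL} :=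
    p.measurableSet_le_or_div_le (by fun_prop) (by fun_prop) (by fun_prop) (by fun_prop)
  have h2 : MeasurableSet {w : PairState × ThirdState |
      w.1.2 1 ≤ w.2.2 0 ∨ w.2.2 2 / p.pathLoss ‖w.2.1 - w.1.1.2‖ ≤ p.Gam / p.PL} :=
    p.measurableSet_le_or_div_le (by fun_prop) (by fun_prop) (by fun_prop) (by fun_prop)
  exact h0.inter (h1.inter (measurableSet_imp_mem _ h2))

lemma measurableSet_pairCond (b : Bool) : MeasurableSet (p.pairCond b) := by
  have h0 : MeasurableSet {c : PairState | ‖c.1.1‖ ≤ ‖c.1.2‖} :=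
    measurableSet_le (by fun_prop) (by fun_prop)
  have h1 : MeasurableSet {c : PairState |
      c.2 0 ≤ c.2 1 ∨ c.2 2 / p.pathLoss ‖c.1.2 - c.1.1‖ ≤ p.Gam / p.PL} :=
    p.measurableSet_le_or_div_le (by fun_prop) (by fun_prop) (by fun_prop) (by fun_prop)
  have h2 : MeasurableSet {c : PairState |
      c.2 1 ≤ c.2 0 ∨ c.2 3 / p.pathLoss ‖c.1.1 - c.1.2‖ ≤ p.Gam / p.PL} :=
    p.measurableSet_le_or_div_le (by fun_prop) (by fun_prop) (by fun_prop) (by fun_prop)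
  exact h0.inter (h1.inter (measurableSet_imp_mem _ h2))

/-- Being received above θ means that the fading exceeds θ times the path loss. Distance zero is
excluded: there division by the zero path loss gives 0 and nothing is received, whereas `sense` is
1. This concerns only a null set of locations. -/
lemma one_sub_thirdLaw {θ d₁ d₂ s t : ℝ} (hθ : 0 < θ) (hs : s ∈ Set.Icc (0 : ℝ) 1)
    (ht : t ∈ Set.Icc (0 : ℝ) 1) (hd₁ : 0 < d₁) (hd₂ : 0 < d₂) (b : Bool) :
    1 - Measure.pi (thirdLaw p.mu) {ζ | (s ≤ ζ 0 ∨ ζ 1 / p.pathLoss d₁ ≤ θ) ∧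
      (b = true → (t ≤ ζ 0 ∨ ζ 2 / p.pathLoss d₂ ≤ θ))} =
    ENNReal.ofReal (blockProb b s t (p.sense θ d₁) (p.sense θ d₂)
      (p.sense θ d₁ * p.sense θ d₂)) := by
  have := isProbabilityMeasure_thirdLaw p.mu_pos
  have hl₁ := p.pathLoss_pos hd₁
  have hl₂ := p.pathLoss_pos hd₂
  have hm : MeasurableSet {ζ : Fin 3 → ℝ | (s ≤ ζ 0 ∨ ζ 1 / p.pathLoss d₁ ≤ θ) ∧
      (b = true → (t ≤ ζ 0 ∨ ζ 2 / p.pathLoss d₂ ≤ θ))} := by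
    have h1 : MeasurableSet {ζ : Fin 3 → ℝ | s ≤ ζ 0 ∨ ζ 1 / p.pathLoss d₁ ≤ θ} :=
      p.measurableSet_le_or_div_le (d := fun _ => d₁) (by fun_prop) (by fun_prop) (by fun_prop)
        (by fun_prop)
    have h2 : MeasurableSet {ζ : Fin 3 → ℝ | t ≤ ζ 0 ∨ ζ 2 / p.pathLoss d₂ ≤ θ} :=
      p.measurableSet_le_or_div_le (d := fun _ => d₂) (by fun_prop) (by fun_prop) (by fun_prop)
        (by fun_prop)
    exact h1.inter (measurableSet_imp_mem _ h2)
  rw [← prob_compl_eq_one_sub hm, ← ofReal_measureReal]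
  congr 1
  have hb := thirdLaw_blocked p.mu_pos hs ht (mul_nonneg hθ.le hl₁.le) (mul_nonneg hθ.le hl₂.le) b
  rw [sense, sense, mul_assoc, mul_assoc, ← hb]
  congr 1
  ext ζ
  simp only [Set.mem_compl_iff, Set.mem_ofPred_eq, div_le_iff₀ hl₁, div_le_iff₀ hl₂, not_and_or,
    not_or, not_le, Classical.not_imp]

lemma one_sub_thirdProb_apCond {v : Plane × Plane} {z : Fin 4 → ℝ} {u : Plane} (b : Bool)
    (h₀ : z 0 ∈ Set.Icc (0 : ℝ) 1) (h₁ : z 1 ∈ Set.Icc (0 : ℝ) 1) (hu₁ : u ≠ v.1) (hu₂ : u ≠ v.2) :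
    1 - thirdProb p.mu (p.apCond b) (v, z) u =
      ENNReal.ofReal (blockProb b (z 0) (z 1) (p.sense (p.Gam / p.PW) ‖u - v.1‖)
        (p.sense (p.Gam / p.PW) ‖u - v.2‖)
        (p.sense (p.Gam / p.PW) ‖u - v.1‖ * p.sense (p.Gam / p.PW) ‖u - v.2‖)) := by
  have h := p.one_sub_thirdLaw (div_pos p.Gam_pos p.PW_pos) h₀ h₁ (norm_sub_pos_iff.2 hu₁)
    (norm_sub_pos_iff.2 hu₂) b
  rw [norm_sub_rev, norm_sub_rev u] at h ⊢
  exact h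

/-- An eNB in the open disc through `v.1` violates the tagging condition whatever its marks, hence
the value 1 there, which produces the area of the disc in the exponent. -/
lemma one_sub_thirdProb_enbCond {v : Plane × Plane} {z : Fin 4 → ℝ} {u : Plane} (b : Bool)
    (h₀ : z 0 ∈ Set.Icc (0 : ℝ) 1) (h₁ : z 1 ∈ Set.Icc (0 : ℝ) 1) (hu₁ : u ≠ v.1) (hu₂ : u ≠ v.2) :
    1 - thirdProb p.mu (p.enbCond b) (v, z) u =
      if ‖v.1‖ ≤ ‖u‖ then
        ENNReal.ofReal (blockProb b (z 0) (z 1) (p.sense (p.Gam / p.PL) ‖u - v.1‖)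
          (p.sense (p.Gam / p.PL) ‖u - v.2‖)
          (p.sense (p.Gam / p.PL) ‖u - v.1‖ * p.sense (p.Gam / p.PL) ‖u - v.2‖)) else 1 := by
  have h := p.one_sub_thirdLaw (div_pos p.Gam_pos p.PL_pos) h₀ h₁ (norm_sub_pos_iff.2 hu₁)
    (norm_sub_pos_iff.2 hu₂) b
  by_cases hc : ‖v.1‖ ≤ ‖u‖
  · rw [if_pos hc, ← h]
    simp [thirdProb, enbCond, hc]
  · rw [if_neg hc]
    simp [thirdProb, enbCond, hc]

end Params

/-! ### Integrals over the timers -/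

lemma integral_exp_neg_mul {c : ℝ} (hc : c ≠ 0) (a b : ℝ) :
    ∫ t in a..b, Real.exp (-(t * c)) = (Real.exp (-(a * c)) - Real.exp (-(b * c))) / c := by
  have hd : ∀ t ∈ Set.uIcc a b, HasDerivAt (fun t => -(Real.exp (-(t * c)) / c))
      (Real.exp (-(t * c))) t := by
    intro t _
    have h : HasDerivAt (fun t => Real.exp (-(t * c))) (Real.exp (-(t * c)) * -(1 * c)) t :=
      ((hasDerivAt_id t).mul_const c).neg.exp
    refine (h.div_const c).neg.congr_deriv ?_
    field_simp
  rw [intervalIntegral.integral_eq_sub_of_hasDerivAt hd (Continuous.intervalIntegrable (by fun_prop) _ _)]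
  ring

lemma lintegral_Icc_ofReal {f : ℝ → ℝ} (hf : Continuous f) (h0 : ∀ t ∈ Set.Icc (0 : ℝ) 1, 0 ≤ f t) :
    ∫⁻ t in Set.Icc (0 : ℝ) 1, ENNReal.ofReal (f t) = ENNReal.ofReal (∫ t in (0 : ℝ)..1, f t) := by
  rw [intervalIntegral.integral_of_le zero_le_one, ← integral_Icc_eq_integral_Ioc,
    ofReal_integral_eq_lintegral_ofReal]
  · exact hf.continuousOn.integrableOn_Icc
  · exact (ae_restrict_iff' measurableSet_Icc).2 (Filter.Eventually.of_forall h0)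

/-- The integral splits at t = s, where the minimum switches. The first summand, from t < s,
integrates over s to M(A, B, C). -/
lemma integral_exp_neg_min {A B C s : ℝ} (hB : B ≠ 0) (hBC : B - C ≠ 0) (hs : s ∈ Set.Icc (0 : ℝ) 1) :
    ∫ t in (0 : ℝ)..1, Real.exp (-(s * A + t * B - min s t * C)) =
      (Real.exp (-(s * A)) - Real.exp (-(s * (A + B - C)))) / (B - C) +
        (Real.exp (-(s * (A + B - C))) - Real.exp (-B) * Real.exp (-(s * (A - C)))) / B := by
  have hc : Continuous fun t => Real.exp (-(s * A + t * B - min s t * C)) := by fun_prop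
  rw [← intervalIntegral.integral_add_adjacent_intervals (hc.intervalIntegrable 0 s)
    (hc.intervalIntegrable s 1)]
  congr 1
  · have : ∫ t in (0 : ℝ)..s, Real.exp (-(s * A + t * B - min s t * C)) =
        ∫ t in (0 : ℝ)..s, Real.exp (-(s * A)) * Real.exp (-(t * (B - C))) := by
      refine intervalIntegral.integral_congr fun t ht => ?_
      rw [Set.uIcc_of_le hs.1] at ht
      simp only [min_eq_right ht.2]
      rw [← Real.exp_add]
      ring_nf
    rw [this, intervalIntegral.integral_const_mul, integral_exp_neg_mul hBC, mul_div_assoc', mul_sub,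
      ← Real.exp_add, ← Real.exp_add]
    ring_nf
  · have : ∫ t in s..1, Real.exp (-(s * A + t * B - min s t * C)) =
        ∫ t in s..1, Real.exp (-(s * (A - C))) * Real.exp (-(t * B)) := by
      refine intervalIntegral.integral_congr fun t ht => ?_
      rw [Set.uIcc_of_le hs.2] at ht
      simp only [min_eq_left ht.1]
      rw [← Real.exp_add]
      ring_nf
    rw [this, intervalIntegral.integral_const_mul, integral_exp_neg_mul hB, mul_div_assoc', mul_sub,
      ← Real.exp_add, ← Real.exp_add, ← Real.exp_add]
    ring_nf

/-- The mean over both timers of the probability that no third device blocks either eNB. -/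
lemma lintegral_exp_neg_min {A B C : ℝ} (hA : 0 < A) (hB : 0 < B) (hAC : 0 < A - C)
    (hBC : 0 < B - C) :
    ∫⁻ s in Set.Icc (0 : ℝ) 1, ∫⁻ t in Set.Icc (0 : ℝ) 1,
      ENNReal.ofReal (Real.exp (-(s * A + t * B - min s t * C))) =
      ENNReal.ofReal (Params.M A B C + Params.M B A C) := by
  have hS : A + B - C ≠ 0 := by linarith
  have h1 : ∀ s ∈ Set.Icc (0 : ℝ) 1, ∫⁻ t in Set.Icc (0 : ℝ) 1,
      ENNReal.ofReal (Real.exp (-(s * A + t * B - min s t * C))) =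
      ENNReal.ofReal ((Real.exp (-(s * A)) - Real.exp (-(s * (A + B - C)))) / (B - C) +
        (Real.exp (-(s * (A + B - C))) - Real.exp (-B) * Real.exp (-(s * (A - C)))) / B) := by
    intro s hs
    rw [lintegral_Icc_ofReal (by fun_prop) fun t _ => (Real.exp_pos _).le,
      integral_exp_neg_min hB.ne' hBC.ne' hs]
  rw [setLIntegral_congr_fun measurableSet_Icc h1, lintegral_Icc_ofReal (by fun_prop)]
  · congr 1
    have hi : ∀ c : ℝ, IntervalIntegrable (fun s => Real.exp (-(s * c))) volume 0 1 := fun c =>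
      Continuous.intervalIntegrable (by fun_prop) _ _
    rw [intervalIntegral.integral_add (((hi _).sub (hi _)).div_const _)
        (((hi _).sub ((hi _).const_mul _)).div_const _), intervalIntegral.integral_div,
      intervalIntegral.integral_div, intervalIntegral.integral_sub (hi _) (hi _),
      intervalIntegral.integral_sub (hi _) ((hi _).const_mul _),
      intervalIntegral.integral_const_mul, integral_exp_neg_mul hA.ne', integral_exp_neg_mul hS,
      integral_exp_neg_mul hAC.ne']
    simp only [Params.M, zero_mul, neg_zero, Real.exp_zero, one_mul]
    -- The part with t > s comes out in a different shape than M(B, A, C). With x = e^{-B}, y =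
    -- e^{-(A-C)} and d = A - C the two agree as rational expressions.
    have e1 : Real.exp (-A - B + C) = Real.exp (-B) * Real.exp (-(A - C)) := by
      rw [← Real.exp_add]; ring_nf
    have e2 : Real.exp (-B - A + C) = Real.exp (-B) * Real.exp (-(A - C)) := by
      rw [← Real.exp_add]; ring_nf
    have e3 : Real.exp (-(A + B - C)) = Real.exp (-B) * Real.exp (-(A - C)) := by
      rw [← Real.exp_add]; ring_nf
    rw [e1, e2, e3, show B + A - C = A + B - C by ring]
    congr 1
    have hAC' := hAC.ne'
    have hB' := hB.ne'
    generalize Real.exp (-B) = x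
    generalize Real.exp (-(A - C)) = y
    obtain ⟨d, hd⟩ : ∃ d, d = A - C := ⟨_, rfl⟩
    have hS' : d + B ≠ 0 := by rw [hd]; linarith
    rw [show A + B - C = d + B by rw [hd]; ring, ← hd]
    rw [← hd] at hAC'
    field_simp
    ring
  · intro s hs
    rw [← integral_exp_neg_min hB.ne' hBC.ne' hs]
    exact intervalIntegral.integral_nonneg zero_le_one fun t _ => (Real.exp_pos _).le

/-- A uniform timer lies below s with probability s, and only then does the reception probability q
matter. -/
lemma lintegral_Icc_ite {s q : ℝ} (hs : s ∈ Set.Icc (0 : ℝ) 1) (hq : q ≤ 1) :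
    ∫⁻ t in Set.Icc (0 : ℝ) 1, (if s ≤ t then 1 else ENNReal.ofReal (1 - q)) =
      ENNReal.ofReal (1 - s * q) := by
  have h1 : ∀ t : ℝ, (if s ≤ t then 1 else ENNReal.ofReal (1 - q)) =
      (Set.Ici s).indicator (fun _ => 1) t + (Set.Iio s).indicator (fun _ => ENNReal.ofReal (1 - q)) t := by
    intro t
    by_cases h : s ≤ t
    · simp [h]
    · simp [h, not_le.1 h]
  simp_rw [h1]
  rw [lintegral_add_left (measurable_const.indicator measurableSet_Ici),
    lintegral_indicator_const measurableSet_Ici, lintegral_indicator_const measurableSet_Iio,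
    ← ofReal_measureReal (s := Set.Iio s), uniform_real_Iio hs, ← ofReal_measureReal (s := Set.Ici s),
    ← Set.compl_Iio, probReal_compl_eq_one_sub measurableSet_Iio, uniform_real_Iio hs, one_mul,
    ← ENNReal.ofReal_mul (by linarith), ← ENNReal.ofReal_add (by linarith [hs.2])
      (mul_nonneg (by linarith) hs.1)]
  ring_nf

lemma integral_one_sub_mul_exp {A : ℝ} (hA : A ≠ 0) (q : ℝ) :
    ∫ s in (0 : ℝ)..1, (1 - s * q) * Real.exp (-(s * A)) =
      (1 - Real.exp (-A)) / A - q * ((1 - Real.exp (-A)) / A ^ 2 - Real.exp (-A) / A) := by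
  -- The antiderivative is found with the ansatz affine function times e^{-sA}.
  have hd : ∀ s ∈ Set.uIcc (0 : ℝ) 1,
      HasDerivAt (fun s => (q * s / A + q / A ^ 2 - 1 / A) * Real.exp (-(s * A)))
        ((1 - s * q) * Real.exp (-(s * A))) s := by
    intro s _
    have h1 : HasDerivAt (fun s => Real.exp (-(s * A))) (Real.exp (-(s * A)) * -(1 * A)) s :=
      ((hasDerivAt_id s).mul_const A).neg.exp
    have h2 : HasDerivAt (fun s => q * s / A + q / A ^ 2 - 1 / A) (q * 1 / A) s :=
      ((((hasDerivAt_id s).const_mul q).div_const A).add_const _).sub_const _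
    refine (h2.mul h1).congr_deriv ?_
    field_simp
    ring
  rw [intervalIntegral.integral_eq_sub_of_hasDerivAt hd (Continuous.intervalIntegrable (by fun_prop) _ _)]
  simp
  field_simp
  ring

/-- The mean over both timers of the probability that no other eNB or AP blocks the first eNB. -/
lemma lintegral_ite_mul_exp {A q : ℝ} (hA : 0 < A) (hq : q ≤ 1) :
    ∫⁻ s in Set.Icc (0 : ℝ) 1, ∫⁻ t in Set.Icc (0 : ℝ) 1,
      (if s ≤ t then 1 else ENNReal.ofReal (1 - q)) * ENNReal.ofReal (Real.exp (-(s * A))) =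
      ENNReal.ofReal ((1 - Real.exp (-A)) / A -
        q * ((1 - Real.exp (-A)) / A ^ 2 - Real.exp (-A) / A)) := by
  have h0 : ∀ s ∈ Set.Icc (0 : ℝ) 1, 0 ≤ 1 - s * q := fun s hs => by nlinarith [hs.1, hs.2]
  have h1 : ∀ s ∈ Set.Icc (0 : ℝ) 1, ∫⁻ t in Set.Icc (0 : ℝ) 1,
      (if s ≤ t then 1 else ENNReal.ofReal (1 - q)) * ENNReal.ofReal (Real.exp (-(s * A))) =
      ENNReal.ofReal ((1 - s * q) * Real.exp (-(s * A))) := by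
    intro s hs
    rw [lintegral_mul_const _ (Measurable.ite measurableSet_Ici measurable_const measurable_const),
      lintegral_Icc_ite hs hq, ← ENNReal.ofReal_mul (h0 s hs)]
  rw [setLIntegral_congr_fun measurableSet_Icc h1, lintegral_Icc_ofReal (by fun_prop)
    fun s hs => mul_nonneg (h0 s hs) (Real.exp_pos _).le, integral_one_sub_mul_exp hA.ne']

/-- It is the integral of (1 - s q) e^{-sA}, positive for 0 < s < 1. This makes the denominator `U`
positive. -/
lemma one_sub_mul_exp_pos {A q : ℝ} (hA : A ≠ 0) (hq : q ≤ 1) :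
    0 < (1 - Real.exp (-A)) / A - q * ((1 - Real.exp (-A)) / A ^ 2 - Real.exp (-A) / A) := by
  rw [← integral_one_sub_mul_exp hA]
  refine intervalIntegral.intervalIntegral_pos_of_pos_on (Continuous.intervalIntegrable (by fun_prop) _ _)
    (fun s hs => mul_pos ?_ (Real.exp_pos _)) zero_lt_one
  nlinarith [hs.1, hs.2]

/-! ### Integrals over the marks of a pair -/

lemma lintegral_pi_fin_succ {n : ℕ} (μ : Fin (n + 1) → Measure ℝ) [∀ i, SigmaFinite (μ i)]
    {f : (Fin (n + 1) → ℝ) → ℝ≥0∞} (hf : Measurable f) :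
    ∫⁻ z, f z ∂(Measure.pi μ) =
      ∫⁻ x, ∫⁻ y, f (Fin.cons x y) ∂(Measure.pi fun i => μ (Fin.succ i)) ∂(μ 0) := by
  have h := (measurePreserving_piFinSuccAbove μ 0).symm
  rw [← h.lintegral_comp hf, lintegral_prod]
  · simp only [MeasurableEquiv.piFinSuccAbove_symm_apply, Fin.insertNthEquiv, Fin.insertNth_zero,
      Fin.zero_succAbove]
    rfl
  · exact (hf.comp h.measurable).aemeasurable

lemma lintegral_pairLaw {mu : ℝ} (hmu : 0 < mu) {f : (Fin 4 → ℝ) → ℝ≥0∞} (hf : Measurable f) :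
    ∫⁻ z, f z ∂(Measure.pi (pairLaw mu)) =
      ∫⁻ s in Set.Icc (0 : ℝ) 1, ∫⁻ t in Set.Icc (0 : ℝ) 1, ∫⁻ g, ∫⁻ g', f ![s, t, g, g']
        ∂(expMeasure mu) ∂(expMeasure mu) := by
  have := isProbabilityMeasure_pairLaw hmu
  have := isProbabilityMeasure_expMeasure hmu
  rw [lintegral_pi_fin_succ _ hf]
  refine lintegral_congr fun s => ?_
  rw [lintegral_pi_fin_succ _ (by fun_prop)]
  refine lintegral_congr fun t => ?_
  rw [lintegral_pi_fin_succ _ (by fun_prop)]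
  refine lintegral_congr fun g => ?_
  rw [lintegral_pi_fin_succ _ (by fun_prop)]
  refine lintegral_congr fun g' => ?_
  rw [lintegral_congr fun y => congrArg f (show (Fin.cons s (Fin.cons t (Fin.cons g
    (Fin.cons g' y))) : Fin 4 → ℝ) = ![s, t, g, g'] by rw [Subsingleton.elim y ![]]; rfl),
    lintegral_const, measure_univ, mul_one]

/-! ### Mean numbers of devices that are received above the threshold -/

lemma blockProb_nonneg (b : Bool) {s t q₁ q₂ : ℝ} (hs : s ∈ Set.Icc (0 : ℝ) 1)
    (ht : t ∈ Set.Icc (0 : ℝ) 1) (h₁ : q₁ ∈ Set.Icc (0 : ℝ) 1) (h₂ : q₂ ∈ Set.Icc (0 : ℝ) 1) :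
    0 ≤ blockProb b s t q₁ q₂ (q₁ * q₂) := by
  cases b
  · simpa [blockProb] using mul_nonneg hs.1 h₁.1
  · simp only [blockProb, if_true]
    have h : min s t * (q₁ * q₂) ≤ s * q₁ := by
      have := mul_le_mul (min_le_left s t) (mul_le_of_le_one_right h₁.1 h₂.2)
        (mul_nonneg h₁.1 h₂.1) hs.1
      exact this
    have := mul_nonneg ht.1 h₂.1
    linarith

lemma integrable_blockProb {α : Type*} [MeasurableSpace α] {μ : Measure α} (b : Bool) (s t : ℝ)
    {f₁ f₂ f₁₂ : α → ℝ} (h₁ : Integrable f₁ μ) (h₂ : Integrable f₂ μ) (h₁₂ : Integrable f₁₂ μ) :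
    Integrable (fun u => blockProb b s t (f₁ u) (f₂ u) (f₁₂ u)) μ := by
  cases b
  · simpa [blockProb] using h₁.const_mul s
  · simp only [blockProb, if_true]
    exact ((h₁.const_mul s).add (h₂.const_mul t)).sub (h₁₂.const_mul (min s t))

/-- `blockProb` is linear in its three reception probabilities. The joint one is a separate argument
because the integral of a product is not the product of the integrals. -/
lemma integral_blockProb {α : Type*} [MeasurableSpace α] {μ : Measure α} (b : Bool) (s t : ℝ)
    {f₁ f₂ f₁₂ : α → ℝ} (h₁ : Integrable f₁ μ) (h₂ : Integrable f₂ μ) (h₁₂ : Integrable f₁₂ μ) :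
    ∫ u, blockProb b s t (f₁ u) (f₂ u) (f₁₂ u) ∂μ =
      blockProb b s t (∫ u, f₁ u ∂μ) (∫ u, f₂ u ∂μ) (∫ u, f₁₂ u ∂μ) := by
  cases b
  · simp [blockProb, integral_const_mul]
  · simp only [blockProb, if_true]
    rw [integral_sub (f := fun u => s * f₁ u + t * f₂ u)
        ((h₁.const_mul s).add (h₂.const_mul t)) (h₁₂.const_mul _),
      integral_add (h₁.const_mul s) (h₂.const_mul t), integral_const_mul, integral_const_mul,
      integral_const_mul]

namespace Params

variable (p : Params)

lemma sense_pos (θ d : ℝ) : 0 < p.sense θ d := Real.exp_pos _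

lemma sense_le_one {θ d : ℝ} (hθ : 0 ≤ θ) (hd : 0 ≤ d) : p.sense θ d ≤ 1 :=
  Real.exp_le_one_iff.2
    (neg_nonpos.2 (mul_nonneg (mul_nonneg p.mu_pos.le hθ) (p.pathLoss_nonneg hd)))

lemma sense_lt_one {θ d : ℝ} (hθ : 0 < θ) (hd : 0 < d) : p.sense θ d < 1 :=
  Real.exp_lt_one_iff.2 (neg_lt_zero.2 (mul_pos (mul_pos p.mu_pos hθ) (p.pathLoss_pos hd)))

lemma sense_mem_Icc {θ d : ℝ} (hθ : 0 ≤ θ) (hd : 0 ≤ d) : p.sense θ d ∈ Set.Icc (0 : ℝ) 1 :=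
  ⟨(p.sense_pos θ d).le, p.sense_le_one hθ hd⟩

@[fun_prop]
lemma measurable_sense (θ : ℝ) : Measurable (p.sense θ) := by
  unfold sense
  fun_prop

lemma integrable_sense {θ : ℝ} (hθ : 0 < θ) (a : Plane) :
    Integrable fun u : Plane => p.sense θ ‖u - a‖ := by
  have h : Integrable fun u : Plane => p.sense θ ‖u‖ := by
    rw [integrable_fun_norm_addHaar volume (f := p.sense θ)]
    have hb : 0 < p.mu * θ * (4 * Real.pi / p.lamC) ^ 2 := by
      have := p.mu_pos
      have := p.lamC_pos
      positivity
    -- The exponent 1 is that of the Jacobian r^(dim - 1) of polar coordinates.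
    have := integrableOn_rpow_mul_exp_neg_mul_rpow (s := 1) (by norm_num) p.alpha_pos hb
    simp only [finrank_euclideanSpace, Fintype.card_fin, Real.rpow_one] at this ⊢
    refine this.congr_fun (fun y _ => ?_) measurableSet_Ioi
    simp only [sense, pathLoss, smul_eq_mul]
    ring_nf
  exact h.comp_sub_right a

lemma integrable_sense_mul {θ : ℝ} (hθ : 0 < θ) (a b : Plane) :
    Integrable fun u : Plane => p.sense θ ‖u - a‖ * p.sense θ ‖u - b‖ := by
  refine (p.integrable_sense hθ a).mono (Measurable.aestronglyMeasurable (by fun_prop))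
    (Filter.Eventually.of_forall fun u => ?_)
  rw [norm_mul, Real.norm_of_nonneg (p.sense_pos _ _).le, Real.norm_of_nonneg (p.sense_pos _ _).le]
  exact mul_le_of_le_one_right (p.sense_pos _ _).le (p.sense_le_one hθ.le (norm_nonneg _))

/-- The mean of the sum of `f` over the APs and over the eNBs at distance more than `r` from the
origin, where `f` may depend on the threshold for the fading. -/
def meanSum (r : ℝ) (f : ℝ → Plane → ℝ) : ℝ :=
  p.lamW * (∫ u, f (p.Gam / p.PW) u) +
    p.lamL * ∫ u in (Metric.closedBall (0 : Plane) r)ᶜ, f (p.Gam / p.PL) u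

/-- The mean number of devices that the first eNB of a pair receives above the threshold. -/
def meanFirst (v : Plane × Plane) : ℝ := p.meanSum ‖v.1‖ fun θ u => p.sense θ ‖u - v.1‖

/-- The mean number of devices that the second eNB of a pair receives above the threshold. -/
def meanSecond (v : Plane × Plane) : ℝ := p.meanSum ‖v.1‖ fun θ u => p.sense θ ‖u - v.2‖

/-- The mean number of devices that both eNBs of a pair receive above the threshold. -/
def meanBoth (v : Plane × Plane) : ℝ :=
  p.meanSum ‖v.1‖ fun θ u => p.sense θ ‖u - v.1‖ * p.sense θ ‖u - v.2‖

/-- The AP term, an integral over the whole plane, is already positive; a zero of `f` at the single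
point `a` does no harm. -/
lemma meanSum_pos {r : ℝ} {f : ℝ → Plane → ℝ} {a : Plane}
    (hf : ∀ θ, 0 < θ → Integrable (f θ)) (h0 : ∀ θ u, 0 < θ → 0 ≤ f θ u)
    (hpos : ∀ θ u, 0 < θ → u ≠ a → 0 < f θ u) : 0 < p.meanSum r f := by
  have hW := div_pos p.Gam_pos p.PW_pos
  have hL := div_pos p.Gam_pos p.PL_pos
  refine add_pos_of_pos_of_nonneg (mul_pos p.lamW_pos ?_)
    (mul_nonneg p.lamL_pos.le (integral_nonneg fun u => h0 _ u hL))
  rw [integral_pos_iff_support_of_nonneg (fun u => h0 _ u hW) (hf _ hW)]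
  refine lt_of_lt_of_le ?_ (measure_mono (s := {a}ᶜ) fun u hu => (hpos _ u hW hu).ne')
  rw [measure_compl (measurableSet_singleton a) (by simp)]
  simp

lemma meanSum_sub (r : ℝ) {f g : ℝ → Plane → ℝ} (hf : ∀ θ, 0 < θ → Integrable (f θ))
    (hg : ∀ θ, 0 < θ → Integrable (g θ)) :
    p.meanSum r f - p.meanSum r g = p.meanSum r fun θ u => f θ u - g θ u := by
  have hW := div_pos p.Gam_pos p.PW_pos
  have hL := div_pos p.Gam_pos p.PL_pos
  simp only [meanSum]
  rw [integral_sub (hf _ hW) (hg _ hW),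
    integral_sub (hf _ hL).integrableOn (hg _ hL).integrableOn]
  ring

lemma meanFirst_pos (v : Plane × Plane) : 0 < p.meanFirst v :=
  p.meanSum_pos (a := 0) (fun _ hθ => p.integrable_sense hθ _) (fun _ _ _ => (p.sense_pos _ _).le)
    fun _ _ _ _ => p.sense_pos _ _

lemma meanSecond_pos (v : Plane × Plane) : 0 < p.meanSecond v :=
  p.meanSum_pos (a := 0) (fun _ hθ => p.integrable_sense hθ _) (fun _ _ _ => (p.sense_pos _ _).le)
    fun _ _ _ _ => p.sense_pos _ _

/-- The integrand q₁ - q₁ q₂ = q₁ (1 - q₂) is positive except at `v.2`. Together with the analogue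
for the second eNB this makes the denominators N₂ - N₃ in `M` nonzero. -/
lemma meanFirst_sub_meanBoth_pos (v : Plane × Plane) : 0 < p.meanFirst v - p.meanBoth v := by
  rw [meanFirst, meanBoth, meanSum_sub _ _ (fun _ hθ => p.integrable_sense hθ _)
    (fun _ hθ => p.integrable_sense_mul hθ _ _)]
  refine p.meanSum_pos (a := v.2)
    (fun _ hθ => (p.integrable_sense hθ _).sub (p.integrable_sense_mul hθ _ _))
    (fun _ u hθ => ?_) fun _ u hθ hu => ?_
  · exact sub_nonneg.2 (mul_le_of_le_one_right (p.sense_pos _ _).le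
      (p.sense_le_one hθ.le (norm_nonneg _)))
  · exact sub_pos.2 (mul_lt_of_lt_one_right (p.sense_pos _ _)
      (p.sense_lt_one hθ (norm_sub_pos_iff.2 hu)))

lemma meanSecond_sub_meanBoth_pos (v : Plane × Plane) : 0 < p.meanSecond v - p.meanBoth v := by
  rw [meanSecond, meanBoth, meanSum_sub _ _ (fun _ hθ => p.integrable_sense hθ _)
    (fun _ hθ => p.integrable_sense_mul hθ _ _)]
  refine p.meanSum_pos (a := v.1)
    (fun _ hθ => (p.integrable_sense hθ _).sub (p.integrable_sense_mul hθ _ _))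
    (fun _ u hθ => ?_) fun _ u hθ hu => ?_
  · exact sub_nonneg.2 (mul_le_of_le_one_left (p.sense_pos _ _).le
      (p.sense_le_one hθ.le (norm_nonneg _)))
  · exact sub_pos.2 (mul_lt_of_lt_one_left (p.sense_pos _ _)
      (p.sense_lt_one hθ (norm_sub_pos_iff.2 hu)))

/-- The probability, given the locations and timers of a pair of eNBs, that no third device is closer
to the origin than the first one or blocks it or, if `b`, blocks the second one. -/
lemma negexp_mul_negexp_thirdProb {v : Plane × Plane} {z : Fin 4 → ℝ} (b : Bool)
    (h₀ : z 0 ∈ Set.Icc (0 : ℝ) 1) (h₁ : z 1 ∈ Set.Icc (0 : ℝ) 1) :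
    negexp (ENNReal.ofReal p.lamW * ∫⁻ u, (1 - thirdProb p.mu (p.apCond b) (v, z) u)) *
      negexp (ENNReal.ofReal p.lamL * ∫⁻ u, (1 - thirdProb p.mu (p.enbCond b) (v, z) u)) =
    negexp (ENNReal.ofReal p.lamL * volume (Metric.closedBall (0 : Plane) ‖v.1‖)) *
      ENNReal.ofReal (Real.exp (-blockProb b (z 0) (z 1) (p.meanFirst v) (p.meanSecond v)
        (p.meanBoth v))) := by
  have hW := div_pos p.Gam_pos p.PW_pos
  have hL := div_pos p.Gam_pos p.PL_pos
  let F : ℝ → Plane → ℝ := fun θ u => blockProb b (z 0) (z 1) (p.sense θ ‖u - v.1‖)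
    (p.sense θ ‖u - v.2‖) (p.sense θ ‖u - v.1‖ * p.sense θ ‖u - v.2‖)
  have hF0 : ∀ θ, 0 < θ → ∀ u, 0 ≤ F θ u := fun θ hθ u => blockProb_nonneg b h₀ h₁
    (p.sense_mem_Icc hθ.le (norm_nonneg _)) (p.sense_mem_Icc hθ.le (norm_nonneg _))
  have hFi : ∀ θ, 0 < θ → Integrable (F θ) := fun θ hθ => integrable_blockProb b _ _
    (p.integrable_sense hθ _) (p.integrable_sense hθ _) (p.integrable_sense_mul hθ _ _)
  -- The blocking formulas fail at the two eNB locations themselves, where the path loss vanishes.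
  have hne : ∀ᵐ u : Plane, u ≠ v.1 ∧ u ≠ v.2 := by
    have h : ∀ a : Plane, ∀ᵐ u : Plane, u ≠ a := fun a => by simp [ae_iff]
    exact (h v.1).and (h v.2)
  have eW : ∫⁻ u, (1 - thirdProb p.mu (p.apCond b) (v, z) u) =
      ENNReal.ofReal (∫ u, F (p.Gam / p.PW) u) := by
    rw [ofReal_integral_eq_lintegral_ofReal (hFi _ hW) (Filter.Eventually.of_forall (hF0 _ hW))]
    refine lintegral_congr_ae ?_
    filter_upwards [hne] with u hu
    exact p.one_sub_thirdProb_apCond b h₀ h₁ hu.1 hu.2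
  have eL : ∫⁻ u, (1 - thirdProb p.mu (p.enbCond b) (v, z) u) =
      volume (Metric.closedBall (0 : Plane) ‖v.1‖) +
      ENNReal.ofReal (∫ u in (Metric.closedBall (0 : Plane) ‖v.1‖)ᶜ, F (p.Gam / p.PL) u) := by
    rw [← lintegral_add_compl _ (Metric.isClosed_closedBall (x := (0 : Plane)) (ε := ‖v.1‖)).measurableSet]
    congr 1
    · rw [← setLIntegral_one]
      refine setLIntegral_congr_fun_ae Metric.isClosed_closedBall.measurableSet ?_
      -- On the circle `enbCond` allows a tie, but the circle belongs to the closed ball; it is a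
      -- null set.
      have hs : ∀ᵐ u : Plane, u ∉ Metric.sphere (0 : Plane) ‖v.1‖ :=
        measure_eq_zero_iff_ae_notMem.1 (Measure.addHaar_sphere _ _ _)
      filter_upwards [hne, hs] with u hu hus hub
      rw [p.one_sub_thirdProb_enbCond b h₀ h₁ hu.1 hu.2, if_neg]
      rw [mem_closedBall_zero_iff] at hub
      rw [mem_sphere_zero_iff_norm] at hus
      exact not_le.2 (lt_of_le_of_ne hub hus)
    · rw [ofReal_integral_eq_lintegral_ofReal (hFi _ hL).integrableOn
        (Filter.Eventually.of_forall (hF0 _ hL))]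
      refine setLIntegral_congr_fun_ae Metric.isClosed_closedBall.measurableSet.compl ?_
      filter_upwards [hne] with u hu hub
      rw [p.one_sub_thirdProb_enbCond b h₀ h₁ hu.1 hu.2, if_pos]
      rw [Set.mem_compl_iff, mem_closedBall_zero_iff, not_le] at hub
      exact hub.le
  have e : blockProb b (z 0) (z 1) (p.meanFirst v) (p.meanSecond v) (p.meanBoth v) =
      p.meanSum ‖v.1‖ F := by
    simp only [meanSum, F]
    rw [integral_blockProb b _ _ (p.integrable_sense hW _) (p.integrable_sense hW _)
      (p.integrable_sense_mul hW _ _), integral_blockProb b _ _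
      (p.integrable_sense hL _).integrableOn (p.integrable_sense hL _).integrableOn
      (p.integrable_sense_mul hL _ _).integrableOn]
    simp only [meanFirst, meanSecond, meanBoth, meanSum, blockProb]
    split_ifs <;> ring
  have h1 := mul_nonneg p.lamW_pos.le (integral_nonneg (μ := volume) (hF0 _ hW))
  have h2 := mul_nonneg p.lamL_pos.le (integral_nonneg
    (μ := volume.restrict (Metric.closedBall (0 : Plane) ‖v.1‖)ᶜ) (hF0 _ hL))
  rw [eW, eL, mul_add, ← ENNReal.ofReal_mul p.lamW_pos.le, ← ENNReal.ofReal_mul p.lamL_pos.le,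
    negexp_add, e, meanSum, ← negexp_ofReal (add_nonneg h1 h2), ENNReal.ofReal_add h1 h2, negexp_add]
  ring

end Params

/-! ### The density of the Campbell measures -/

namespace Params

variable (p : Params)

lemma lintegral_fading {θ d : ℝ} (hθ : 0 < θ) (hd : 0 < d) (q : Prop) [Decidable q] :
    ∫⁻ g, (if q ∨ g / p.pathLoss d ≤ θ then 1 else 0) ∂(expMeasure p.mu) =
      if q then 1 else ENNReal.ofReal (1 - p.sense θ d) := by
  have := isProbabilityMeasure_expMeasure p.mu_pos
  have hl := p.pathLoss_pos hd
  by_cases hq : q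
  · simp [hq]
  · have e : ∀ g, (if q ∨ g / p.pathLoss d ≤ θ then (1 : ℝ≥0∞) else 0) =
        (Set.Iic (θ * p.pathLoss d)).indicator 1 g := by
      intro g
      simp [hq, Set.indicator_apply, div_le_iff₀ hl]
    simp_rw [e]
    rw [lintegral_indicator_one measurableSet_Iic, if_neg hq, ← ofReal_measureReal, ← Set.compl_Ioi,
      probReal_compl_eq_one_sub measurableSet_Ioi,
      expMeasure_real_Ioi p.mu_pos (mul_nonneg hθ.le hl.le), sense, mul_assoc]

/-- The integrand of the density of the Campbell measure of pairs of eNBs of which the first one is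
closest to the origin and transmits and, if `b`, the second one transmits. -/
def pairIntegrand (b : Bool) (c : PairState) : ℝ≥0∞ :=
  (p.pairCond b).indicator (fun _ => 1) c *
    negexp (ENNReal.ofReal p.lamW * ∫⁻ u, (1 - thirdProb p.mu (p.apCond b) c u)) *
    negexp (ENNReal.ofReal p.lamL * ∫⁻ u, (1 - thirdProb p.mu (p.enbCond b) c u))

/-- The density of the Campbell measure of pairs of eNBs of which the first one is closest to the
origin and transmits and, if `b`, the second one transmits. -/
def pairDensity (b : Bool) (v : Plane × Plane) : ℝ≥0∞ :=
  ∫⁻ z, p.pairIntegrand b (v, z) ∂(Measure.pi (pairLaw p.mu))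

lemma measurable_pairIntegrand (b : Bool) : Measurable (p.pairIntegrand b) :=
  ((measurable_const.indicator (p.measurableSet_pairCond b)).mul
    (measurable_negexp.comp (((measurable_thirdProb p.mu_pos
      (p.measurableSet_apCond b)).const_sub 1).lintegral_prod_right'.const_mul _))).mul
    (measurable_negexp.comp (((measurable_thirdProb p.mu_pos
      (p.measurableSet_enbCond b)).const_sub 1).lintegral_prod_right'.const_mul _))

lemma measurable_pairDensity (b : Bool) : Measurable (p.pairDensity b) := by
  have := isProbabilityMeasure_pairLaw p.mu_pos
  exact (p.measurable_pairIntegrand b).lintegral_prod_right'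

/-- The probability that no eNB is in the disc around the origin with the first eNB of a pair on
its boundary. -/
def voidProb (v : Plane × Plane) : ℝ≥0∞ :=
  negexp (ENNReal.ofReal p.lamL * volume (Metric.closedBall (0 : Plane) ‖v.1‖))

/-- Separation of variables: `g` enters only the first factor and `g'` only the second, so the
fading can be integrated out factor by factor. -/
lemma pairIntegrand_eq {b : Bool} {v : Plane × Plane} (hv : ‖v.1‖ ≤ ‖v.2‖) {s t : ℝ}
    (hs : s ∈ Set.Icc (0 : ℝ) 1) (ht : t ∈ Set.Icc (0 : ℝ) 1) (g g' : ℝ) :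
    p.pairIntegrand b (v, ![s, t, g, g']) =
      (if s ≤ t ∨ g / p.pathLoss ‖v.2 - v.1‖ ≤ p.Gam / p.PL then 1 else 0) *
        ((if (b = false ∨ t ≤ s) ∨ g' / p.pathLoss ‖v.2 - v.1‖ ≤ p.Gam / p.PL then 1 else 0) *
        (p.voidProb v * ENNReal.ofReal (Real.exp (-blockProb b s t (p.meanFirst v) (p.meanSecond v)
          (p.meanBoth v))))) := by
  have h := p.negexp_mul_negexp_thirdProb (v := v) (z := ![s, t, g, g']) b hs ht
  rw [pairIntegrand, mul_assoc, h, ← mul_assoc _ _ (p.voidProb v * _)]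
  congr 1
  have e : (v, ![s, t, g, g']) ∈ p.pairCond b ↔
      (s ≤ t ∨ g / p.pathLoss ‖v.2 - v.1‖ ≤ p.Gam / p.PL) ∧
      ((b = false ∨ t ≤ s) ∨ g' / p.pathLoss ‖v.2 - v.1‖ ≤ p.Gam / p.PL) := by
    rw [norm_sub_rev v.2 v.1]
    cases b <;> simp [pairCond, hv, norm_sub_rev v.2 v.1]
  by_cases hc : (v, ![s, t, g, g']) ∈ p.pairCond b
  · rw [Set.indicator_of_mem hc, if_pos (e.1 hc).1, if_pos (e.1 hc).2, one_mul]
  · rw [Set.indicator_of_notMem hc]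
    by_cases h1 : s ≤ t ∨ g / p.pathLoss ‖v.2 - v.1‖ ≤ p.Gam / p.PL
    · rw [if_neg fun h2 => hc (e.2 ⟨h1, h2⟩), mul_zero]
    · rw [if_neg h1, zero_mul]

lemma pairDensity_eq_zero {b : Bool} {v : Plane × Plane} (hv : ¬‖v.1‖ ≤ ‖v.2‖) :
    p.pairDensity b v = 0 := by
  simp [pairDensity, pairIntegrand, pairCond, hv]

lemma pairDensity_eq {b : Bool} {v : Plane × Plane} (hv : ‖v.1‖ ≤ ‖v.2‖) (hne : v.1 ≠ v.2) :
    p.pairDensity b v = p.voidProb v *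
      ∫⁻ s in Set.Icc (0 : ℝ) 1, ∫⁻ t in Set.Icc (0 : ℝ) 1,
        (if s ≤ t then 1 else ENNReal.ofReal (1 - p.sense (p.Gam / p.PL) ‖v.2 - v.1‖)) *
        ((if b = false ∨ t ≤ s then 1 else
          ENNReal.ofReal (1 - p.sense (p.Gam / p.PL) ‖v.2 - v.1‖)) *
        ENNReal.ofReal (Real.exp (-blockProb b s t (p.meanFirst v) (p.meanSecond v)
          (p.meanBoth v)))) := by
  have hd : 0 < ‖v.2 - v.1‖ := norm_sub_pos_iff.2 hne.symm
  have hL := div_pos p.Gam_pos p.PL_pos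
  have hK : p.voidProb v ≠ ∞ := negexp_ne_top _
  rw [pairDensity, lintegral_pairLaw p.mu_pos (f := fun z => p.pairIntegrand b (v, z))
    ((p.measurable_pairIntegrand b).comp (measurable_const.prodMk measurable_id)),
    ← lintegral_const_mul' _ _ hK]
  refine setLIntegral_congr_fun measurableSet_Icc fun s hs => ?_
  rw [← lintegral_const_mul' _ _ hK]
  refine setLIntegral_congr_fun measurableSet_Icc fun t ht => ?_
  simp only [p.pairIntegrand_eq hv hs ht]
  have hm : ∀ q : Prop, ∀ _ : Decidable q, Measurable fun g : ℝ =>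
      if q ∨ g / p.pathLoss ‖v.2 - v.1‖ ≤ p.Gam / p.PL then (1 : ℝ≥0∞) else 0 := by
    intro q _
    by_cases hq : q
    · simp [hq]
    · simp only [hq, false_or]
      exact Measurable.ite (measurableSet_le (by fun_prop) (by fun_prop)) measurable_const
        measurable_const
  simp_rw [lintegral_const_mul _ ((hm _ _).mul_const _), lintegral_mul_const _ (hm _ _),
    p.lintegral_fading hL hd]
  ring

/-- The probability, up to `voidProb`, that both eNBs of a pair transmit. -/
lemma pairDensity_true {v : Plane × Plane} (hv : ‖v.1‖ ≤ ‖v.2‖) (hne : v.1 ≠ v.2) :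
    p.pairDensity true v = p.voidProb v *
      ENNReal.ofReal (p.V (v.2 - v.1) (p.Gam / p.PL) (p.Gam / p.PL) (p.meanFirst v) (p.meanSecond v)
        (p.meanBoth v)) := by
  have hd : 0 < ‖v.2 - v.1‖ := norm_sub_pos_iff.2 hne.symm
  have hq := p.sense_le_one (div_pos p.Gam_pos p.PL_pos).le hd.le
  rw [p.pairDensity_eq hv hne]
  congr 1
  -- For t ≠ s exactly one of the two mutual conditions is active, so the factor 1 - q is the same
  -- for both orders of the timers; ties are null.
  have e : ∀ s : ℝ, ∫⁻ t in Set.Icc (0 : ℝ) 1,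
        (if s ≤ t then 1 else ENNReal.ofReal (1 - p.sense (p.Gam / p.PL) ‖v.2 - v.1‖)) *
        ((if true = false ∨ t ≤ s then 1 else
          ENNReal.ofReal (1 - p.sense (p.Gam / p.PL) ‖v.2 - v.1‖)) *
        ENNReal.ofReal (Real.exp (-blockProb true s t (p.meanFirst v) (p.meanSecond v)
          (p.meanBoth v)))) =
      ENNReal.ofReal (1 - p.sense (p.Gam / p.PL) ‖v.2 - v.1‖) * ∫⁻ t in Set.Icc (0 : ℝ) 1,
        ENNReal.ofReal (Real.exp (-(s * p.meanFirst v + t * p.meanSecond v -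
          min s t * p.meanBoth v))) := by
    intro s
    rw [← lintegral_const_mul' _ _ ENNReal.ofReal_ne_top]
    refine lintegral_congr_ae (ae_restrict_of_ae ?_)
    have hs : ∀ᵐ t : ℝ, t ≠ s := by simp [ae_iff]
    filter_upwards [hs] with t ht
    simp only [blockProb, if_true]
    rcases lt_or_gt_of_ne ht with h | h
    · simp [h.le, h.not_ge]
    · simp [h.le, h.not_ge]
  simp_rw [e]
  rw [lintegral_const_mul' _ _ ENNReal.ofReal_ne_top, lintegral_exp_neg_min (p.meanFirst_pos v)
    (p.meanSecond_pos v) (p.meanFirst_sub_meanBoth_pos v) (p.meanSecond_sub_meanBoth_pos v),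
    ← ENNReal.ofReal_mul (sub_nonneg.2 hq)]
  congr 1
  simp only [V, sense]
  ring

/-- The probability, up to `voidProb`, that the first eNB of a pair transmits. -/
lemma pairDensity_false {v : Plane × Plane} (hv : ‖v.1‖ ≤ ‖v.2‖) (hne : v.1 ≠ v.2) :
    p.pairDensity false v = p.voidProb v *
      ENNReal.ofReal (p.U (v.2 - v.1) (p.Gam / p.PL) (p.meanFirst v)) := by
  have hd : 0 < ‖v.2 - v.1‖ := norm_sub_pos_iff.2 hne.symm
  have hq := p.sense_le_one (div_pos p.Gam_pos p.PL_pos).le hd.le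
  rw [p.pairDensity_eq hv hne]
  congr 1
  simp only [true_or, if_true, one_mul, blockProb, Bool.false_eq_true, if_false]
  exact lintegral_ite_mul_exp (p.meanFirst_pos v) hq

lemma U_pos (x : Plane) {N : ℝ} (hN : 0 < N) : 0 < p.U x (p.Gam / p.PL) N :=
  one_sub_mul_exp_pos hN.ne'
    (p.sense_le_one (div_pos p.Gam_pos p.PL_pos).le (norm_nonneg x))

/-- The second density is the first one times the conditional probability. -/
lemma pairDensity_true_eq_mul {v : Plane × Plane} (hne : v.1 ≠ v.2) :
    p.pairDensity true v = p.pairDensity false v *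
      ENNReal.ofReal (p.V (v.2 - v.1) (p.Gam / p.PL) (p.Gam / p.PL) (p.meanFirst v) (p.meanSecond v)
        (p.meanBoth v) / p.U (v.2 - v.1) (p.Gam / p.PL) (p.meanFirst v)) := by
  by_cases hv : ‖v.1‖ ≤ ‖v.2‖
  · have hU := p.U_pos (v.2 - v.1) (p.meanFirst_pos v)
    rw [p.pairDensity_true hv hne, p.pairDensity_false hv hne, mul_assoc,
      ← ENNReal.ofReal_mul hU.le, mul_div_cancel₀ _ hU.ne']
  · rw [p.pairDensity_eq_zero hv, p.pairDensity_eq_zero hv, zero_mul]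

end Params

/-! ### Rotations -/

/-- Lagrange's identity (a·y)² + (a×y)² = ‖a‖² ‖y‖². -/
lemma norm_rotateTo {a : Plane} (ha : a ≠ 0) (y : Plane) : ‖rotateTo a y‖ = ‖y‖ := by
  have hn : ‖a‖ ≠ 0 := norm_ne_zero_iff.2 ha
  rw [← sq_eq_sq₀ (norm_nonneg _) (norm_nonneg _)]
  have h : ‖a‖ ^ 2 = a 0 ^ 2 + a 1 ^ 2 := by
    simp [EuclideanSpace.real_norm_sq_eq, Fin.sum_univ_two]
  have h2 : ‖y‖ ^ 2 = y 0 ^ 2 + y 1 ^ 2 := by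
    simp [EuclideanSpace.real_norm_sq_eq, Fin.sum_univ_two]
  rw [EuclideanSpace.real_norm_sq_eq, Fin.sum_univ_two, h2]
  simp only [rotateTo, PiLp.toLp_apply, Matrix.cons_val_zero, Matrix.cons_val_one]
  rw [div_pow, div_pow, ← add_div, div_eq_iff (pow_ne_zero 2 hn), h]
  ring

/-- The rotation `rotateTo a` as a linear isometry. -/
def rotation {a : Plane} (ha : a ≠ 0) : Plane ≃ₗᵢ[ℝ] Plane :=
  LinearIsometry.toLinearIsometryEquiv
    { toFun := rotateTo a
      map_add' := fun x y => by
        ext i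
        fin_cases i <;> simp [rotateTo] <;> ring
      map_smul' := fun c x => by
        ext i
        fin_cases i <;> simp [rotateTo] <;> ring
      norm_map' := norm_rotateTo ha } rfl

lemma rotation_apply {a : Plane} (ha : a ≠ 0) (y : Plane) : rotation ha y = rotateTo a y := rfl

lemma rotateTo_self {a : Plane} (ha : a ≠ 0) : rotateTo a a = !₂[‖a‖, 0] := by
  have hn : ‖a‖ ≠ 0 := norm_ne_zero_iff.2 ha
  have h : ‖a‖ ^ 2 = a 0 ^ 2 + a 1 ^ 2 := by
    simp [EuclideanSpace.real_norm_sq_eq, Fin.sum_univ_two]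
  have e : (a 0 * a 0 + a 1 * a 1) / ‖a‖ = ‖a‖ := by
    rw [div_eq_iff hn]
    linarith
  ext i
  fin_cases i
  · simpa [rotateTo] using e
  · simp [rotateTo, mul_comm]

lemma norm_rotateTo_sub {a : Plane} (ha : a ≠ 0) (x y : Plane) :
    ‖rotateTo a x - rotateTo a y‖ = ‖x - y‖ := by
  rw [← rotation_apply ha, ← rotation_apply ha, ← map_sub, LinearIsometryEquiv.norm_map]

lemma setIntegral_comp_rotateTo {a : Plane} (ha : a ≠ 0) (r : ℝ) (f : Plane → ℝ) :
    ∫ x in (Metric.closedBall (0 : Plane) r)ᶜ, f (rotateTo a x) =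
      ∫ x in (Metric.closedBall (0 : Plane) r)ᶜ, f x := by
  have h := (rotation ha).measurePreserving.setIntegral_preimage_emb
    (rotation ha).toHomeomorph.measurableEmbedding f (Metric.closedBall (0 : Plane) r)ᶜ
  have e : rotation ha ⁻¹' (Metric.closedBall (0 : Plane) r)ᶜ = (Metric.closedBall (0 : Plane) r)ᶜ := by
    ext x
    simp
  rw [e] at h
  exact h

lemma setIntegral_compl_closedBall_zero (f : Plane → ℝ) :
    ∫ x in (Metric.closedBall (0 : Plane) 0)ᶜ, f x = ∫ x, f x := by
  rw [Metric.closedBall_zero, restrict_compl_singleton]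

namespace Params

variable (p : Params)

/-- The tagging puts no constraint on the APs, so by translation invariance the mean is the same
around every eNB. -/
lemma NW3_eq (Γ : ℝ) (a : Plane) : p.NW3 Γ = p.lamW * ∫ u, p.sense (Γ / p.PW) ‖u - a‖ := by
  rw [NW3, NW0, setIntegral_compl_closedBall_zero,
    integral_sub_right_eq_self (fun u => p.sense (Γ / p.PW) ‖u‖) a]
  simp [sense]

lemma NL0_rotateTo {a : Plane} (ha : a ≠ 0) (b : Plane) (r Γ : ℝ) :
    p.NL0 (rotateTo a b) r Γ =
      p.lamL * ∫ u in (Metric.closedBall (0 : Plane) r)ᶜ, p.sense (Γ / p.PL) ‖u - b‖ := by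
  rw [NL0, ← setIntegral_comp_rotateTo ha]
  simp only [norm_rotateTo_sub ha, sense]

/-- The removed ball has radius 0 and is null, so only the difference of the two centres matters; a
rotation and a translation by `b` restore them. -/
lemma CW0_rotateTo {a : Plane} (ha : a ≠ 0) (b : Plane) (Γ : ℝ) :
    p.CW0 (rotateTo a a - rotateTo a b) Γ 0 Γ =
      p.lamW * ∫ u, p.sense (Γ / p.PW) ‖u - a‖ * p.sense (Γ / p.PW) ‖u - b‖ := by
  rw [CW0, norm_zero, ← setIntegral_comp_rotateTo ha, setIntegral_compl_closedBall_zero,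
    ← integral_sub_right_eq_self _ b]
  congr 2
  funext u
  rw [← rotation_apply ha, ← rotation_apply ha, ← rotation_apply ha, ← map_sub, ← map_sub, sub_zero,
    LinearIsometryEquiv.norm_map, LinearIsometryEquiv.norm_map, sub_sub_sub_cancel_right, sense,
    sense, ← Real.exp_add, sub_eq_add_neg]

lemma CL0_rotateTo {a : Plane} (ha : a ≠ 0) (b : Plane) (Γ : ℝ) :
    p.CL0 (rotateTo a b) Γ (rotateTo a a) Γ =
      p.lamL * ∫ u in (Metric.closedBall (0 : Plane) ‖a‖)ᶜ,
        p.sense (Γ / p.PL) ‖u - a‖ * p.sense (Γ / p.PL) ‖u - b‖ := by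
  rw [CL0, norm_rotateTo ha, ← setIntegral_comp_rotateTo ha]
  congr 2
  funext u
  rw [norm_rotateTo_sub ha, norm_rotateTo_sub ha, mul_comm (p.sense _ _), sense, sense, ← Real.exp_add,
    sub_eq_add_neg]

lemma h3L_rotateTo {v : Plane × Plane} (hv : v.1 ≠ 0) :
    p.h3L ‖v.1‖ (rotateTo v.1 v.2) =
      p.V (v.2 - v.1) (p.Gam / p.PL) (p.Gam / p.PL) (p.meanFirst v) (p.meanSecond v) (p.meanBoth v) /
        p.U (v.2 - v.1) (p.Gam / p.PL) (p.meanFirst v) := by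
  have e4 : p.NW3 p.Gam + p.NL1 ‖v.1‖ p.Gam = p.meanFirst v := by
    rw [NL1, ← rotateTo_self hv, NL0_rotateTo p hv, p.NW3_eq _ v.1, meanFirst, meanSum]
  have e5 : p.NW3 p.Gam + p.NL0 (rotateTo v.1 v.2) ‖v.1‖ p.Gam = p.meanSecond v := by
    rw [NL0_rotateTo p hv, p.NW3_eq _ v.2, meanSecond, meanSum]
  have e6 : p.CW0 (rotateTo v.1 v.1 - rotateTo v.1 v.2) p.Gam 0 p.Gam +
      p.CL0 (rotateTo v.1 v.2) p.Gam (rotateTo v.1 v.1) p.Gam = p.meanBoth v := by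
    rw [CW0_rotateTo p hv, CL0_rotateTo p hv, meanBoth, meanSum]
  simp only [h3L, ← rotateTo_self hv, V, U, norm_rotateTo_sub hv]
  rw [e4, e5, e6]

/-! ### Measurability of the conditional probability -/

lemma measurable_setIntegral_compl_closedBall {γ : Type*} [MeasurableSpace γ] {r : γ → ℝ}
    (hr : Measurable r) {f : γ → Plane → ℝ} (hf : Measurable (Function.uncurry f)) :
    Measurable fun c => ∫ x in (Metric.closedBall (0 : Plane) (r c))ᶜ, f c x := by
  have hs : MeasurableSet {w : γ × Plane | r w.1 < ‖w.2‖} :=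
    measurableSet_lt (by fun_prop) (by fun_prop)
  -- The variable domain moves into the integrand as the indicator of a measurable set in the
  -- product.
  have e : ∀ c, ∫ x in (Metric.closedBall (0 : Plane) (r c))ᶜ, f c x =
      ∫ x, {w : γ × Plane | r w.1 < ‖w.2‖}.indicator (Function.uncurry f) (c, x) := by
    intro c
    rw [← integral_indicator Metric.isClosed_closedBall.measurableSet.compl]
    congr 1
    funext x
    by_cases hx : r c < ‖x‖
    · rw [Set.indicator_of_mem (by simpa using hx), Set.indicator_of_mem (by simpa using hx)]
      rfl
    · rw [Set.indicator_of_notMem (by simpa using hx), Set.indicator_of_notMem (by simpa using hx)]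
  simp_rw [e]
  exact ((hf.indicator hs).stronglyMeasurable.integral_prod_right').measurable

lemma measurable_toLp_fin_two {γ : Type*} [MeasurableSpace γ] {f g : γ → ℝ} (hf : Measurable f)
    (hg : Measurable g) : Measurable fun c => (!₂[f c, g c] : Plane) := by
  refine (MeasurableEquiv.toLp 2 (Fin 2 → ℝ)).measurable.comp (measurable_pi_lambda _ fun i => ?_)
  fin_cases i
  · exact hf
  · exact hg

lemma measurable_NL0 {γ : Type*} [MeasurableSpace γ] {y : γ → Plane} (hy : Measurable y) {r : γ → ℝ}
    (hr : Measurable r) (Γ : ℝ) : Measurable fun c => p.NL0 (y c) (r c) Γ :=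
  (measurable_setIntegral_compl_closedBall hr (f := fun c x =>
    Real.exp (-(p.mu * (Γ / p.PL) * p.pathLoss ‖x - y c‖))) (by unfold Function.uncurry; fun_prop)).const_mul _

lemma measurable_CL0 {γ : Type*} [MeasurableSpace γ] {y₁ y₂ : γ → Plane} (h₁ : Measurable y₁)
    (h₂ : Measurable y₂) (Γ₁ Γ₂ : ℝ) : Measurable fun c => p.CL0 (y₁ c) Γ₁ (y₂ c) Γ₂ :=
  (measurable_setIntegral_compl_closedBall h₂.norm (f := fun c x =>
    Real.exp (-(p.mu * (Γ₁ / p.PL) * p.pathLoss ‖x - y₁ c‖)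
      - p.mu * (Γ₂ / p.PL) * p.pathLoss ‖x - y₂ c‖)) (by unfold Function.uncurry; fun_prop)).const_mul _

lemma measurable_CW0 {γ : Type*} [MeasurableSpace γ] {y₁ y₂ : γ → Plane} (h₁ : Measurable y₁)
    (h₂ : Measurable y₂) (Γ₁ Γ₂ : ℝ) : Measurable fun c => p.CW0 (y₁ c) Γ₁ (y₂ c) Γ₂ :=
  (measurable_setIntegral_compl_closedBall h₂.norm (f := fun c x =>
    Real.exp (-(p.mu * (Γ₁ / p.PW) * p.pathLoss ‖x - y₁ c‖)
      - p.mu * (Γ₂ / p.PW) * p.pathLoss ‖x - y₂ c‖)) (by unfold Function.uncurry; fun_prop)).const_mul _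

lemma measurable_h3L_rotateTo :
    Measurable fun v : Plane × Plane => p.h3L ‖v.1‖ (rotateTo v.1 v.2) := by
  have hy : Measurable fun v : Plane × Plane => rotateTo v.1 v.2 :=
    measurable_toLp_fin_two (by fun_prop) (by fun_prop)
  have hy0 : Measurable fun v : Plane × Plane => (!₂[‖v.1‖, 0] : Plane) :=
    measurable_toLp_fin_two (by fun_prop) (by fun_prop)
  have h4 : Measurable fun v : Plane × Plane => p.NW3 p.Gam + p.NL1 ‖v.1‖ p.Gam :=
    (p.measurable_NL0 hy0 measurable_fst.norm _).const_add _
  have h5 : Measurable fun v : Plane × Plane =>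
      p.NW3 p.Gam + p.NL0 (rotateTo v.1 v.2) ‖v.1‖ p.Gam :=
    (p.measurable_NL0 hy measurable_fst.norm _).const_add _
  have h6 : Measurable fun v : Plane × Plane =>
      p.CW0 (!₂[‖v.1‖, 0] - rotateTo v.1 v.2) p.Gam 0 p.Gam +
        p.CL0 (rotateTo v.1 v.2) p.Gam !₂[‖v.1‖, 0] p.Gam :=
    (p.measurable_CW0 (hy0.sub hy) measurable_const _ _).add (p.measurable_CL0 hy hy0 _ _)
  simp only [h3L, V, U, M]
  fun_prop

end Params

/-! ### The Campbell measures -/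

namespace Network

variable {Ω : Type*} (net : Network Ω) (p : Params)

/-- eNB `i` is the tagged one and transmits and, if `b`, eNB `k` transmits. -/
def taggedTransmits (b : Bool) (i k : ℕ) : Set Ω :=
  net.tagged i ∩ net.transmits p i ∩ {ω | b = true → ω ∈ net.transmits p k}

lemma taggedTransmits_true (i k : ℕ) : net.taggedTransmits p true i k =
    net.tagged i ∩ net.transmits p i ∩ net.transmits p k := by
  ext ω
  simp [taggedTransmits]

lemma taggedTransmits_false (i k : ℕ) : net.taggedTransmits p false i k =
    net.tagged i ∩ net.transmits p i := by
  ext ω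
  simp [taggedTransmits]

/-- Conditions over all eNBs `m` split into m = i, m = k and the rest. The first two concern only
the pair and form `pairCond`; an eNB imposes no blocking condition on itself. -/
lemma mem_pairEvent_iff (b : Bool) (A : Set (Plane × Plane)) {i k : ℕ} (hik : i ≠ k) (ω : Ω) :
    ω ∈ net.pairEvent ({c | c.1 ∈ A} ∩ p.pairCond b) (p.apCond b) (p.enbCond b) i k ↔
      (net.y i ω, net.y k ω) ∈ A ∧ ω ∈ net.taggedTransmits p b i k := by
  constructor
  · rintro ⟨⟨hA, hn, h1, h2⟩, hW, hL⟩
    have hm : ∀ {q : ℕ → Prop}, q i → q k → (∀ m : others i k, q m) → ∀ m, q m := by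
      intro q hi hk ho m
      by_cases hmi : m = i
      · exact hmi ▸ hi
      by_cases hmk : m = k
      · exact hmk ▸ hk
      exact ho ⟨m, hmi, hmk⟩
    refine ⟨hA, ⟨hm le_rfl hn fun m => (hL m).1, fun j => (hW j).1,
      hm (fun h => (h rfl).elim) (fun _ => h1) fun m _ => (hL m).2.1⟩, fun hb => ⟨fun j => (hW j).2 hb,
      hm (fun _ => h2 hb) (fun h => (h rfl).elim) fun m _ => (hL m).2.2 hb⟩⟩
  · rintro ⟨hA, ⟨ht, hW, hL⟩, hk⟩
    exact ⟨⟨hA, ht k, hL k hik.symm, fun hb => (hk hb).2 i hik⟩,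
      fun j => ⟨hW j, fun hb => (hk hb).1 j⟩,
      fun m => ⟨ht m, hL m m.2.1, fun hb => (hk hb).2 m m.2.2⟩⟩

variable {net p} [MeasurableSpace Ω] {P : Measure Ω} [IsProbabilityMeasure P]

/-- The Campbell measure of pairs of eNBs of which the first one is tagged and transmits and, if `b`,
the second one transmits, has a density. -/
theorem IsLBTNetwork.campbell_taggedTransmits (h : net.IsLBTNetwork p P) (b : Bool) :
    net.campbell P (net.taggedTransmits p b) =
      volume.withDensity fun v => ENNReal.ofReal p.lamL ^ 2 * p.pairDensity b v := by
  ext A hA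
  have hy : ∀ i k, Measurable fun ω => (net.y i ω, net.y k ω) := fun i k =>
    (h.poissonL.measurable i).prodMk (h.poissonL.measurable k)
  rw [campbell, Measure.sum_apply _ hA, withDensity_apply _ hA,
    lintegral_const_mul _ (p.measurable_pairDensity b), ← lintegral_indicator hA]
  have e : ∀ q : {q : ℕ × ℕ // q.1 ≠ q.2},
      ((P.restrict (net.taggedTransmits p b q.1.1 q.1.2)).map
        fun ω => (net.y q.1.1 ω, net.y q.1.2 ω)) A =
      P (net.pairEvent ({c | c.1 ∈ A} ∩ p.pairCond b) (p.apCond b) (p.enbCond b) q.1.1 q.1.2) := by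
    intro q
    rw [Measure.map_apply (hy _ _) hA, Measure.restrict_apply (hy _ _ hA)]
    congr 1
    ext ω
    exact (net.mem_pairEvent_iff p b A q.2 ω).symm
  rw [tsum_congr e, h.tsum_pairEvent
    (E₀ := {c | c.1 ∈ A} ∩ p.pairCond b) ((measurable_fst hA).inter (p.measurableSet_pairCond b))
    (p.measurableSet_apCond b) (p.measurableSet_enbCond b)]
  congr 1
  refine lintegral_congr fun v => ?_
  by_cases hv : v ∈ A
  · rw [Set.indicator_of_mem hv]
    refine lintegral_congr fun z => ?_
    rw [Params.pairIntegrand]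
    congr 2
    by_cases hc : (v, z) ∈ p.pairCond b
    · rw [Set.indicator_of_mem hc]
      exact Set.indicator_of_mem (s := {c : PairState | c.1 ∈ A} ∩ p.pairCond b) ⟨hv, hc⟩ _
    · rw [Set.indicator_of_notMem hc]
      exact Set.indicator_of_notMem (s := {c : PairState | c.1 ∈ A} ∩ p.pairCond b)
        (fun h => hc h.2) _
  · rw [Set.indicator_of_notMem hv]
    simp [hv]

end Network

/-- The exceptional pairs: at `v.1 = 0` division by zero makes `rotateTo` vanish, and for coinciding
points the path loss is zero. -/
lemma ae_fst_ne_zero_and_ne : ∀ᵐ v : Plane × Plane, v.1 ≠ 0 ∧ v.1 ≠ v.2 := by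
  refine Filter.Eventually.and ?_ ?_
  · have h : ∀ᵐ u : Plane, u ≠ 0 := by simp [ae_iff]
    exact (Measure.quasiMeasurePreserving_fst (μ := volume) (ν := volume)).ae h
  · have hs : MeasurableSet {v : Plane × Plane | v.1 = v.2} :=
      measurableSet_eq_fun measurable_fst measurable_snd
    rw [ae_iff]
    simp only [not_not]
    rw [Measure.volume_eq_prod, Measure.measure_prod_null hs]
    refine Filter.Eventually.of_forall fun x => ?_
    have : Prod.mk x ⁻¹' {v : Plane × Plane | v.1 = v.2} = {x} := by
      ext y
      simp [eq_comm]
    simp [this]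

end

end LBT

theorem mainTheorem9 {Ω : Type*} [MeasurableSpace Ω] (P : MeasureTheory.Measure Ω)
    [MeasureTheory.IsProbabilityMeasure P] (p : LBT.Params) (net : LBT.Network Ω)
    (hnet : net.IsLBTNetwork p P) :
    net.IsCondTransmitProb p P (fun y₀ y => p.h3L ‖y₀‖ (LBT.rotateTo y₀ y)) := by
  refine ⟨p.measurable_h3L_rotateTo, ?_⟩
  have h1 := hnet.campbell_taggedTransmits true
  have h0 := hnet.campbell_taggedTransmits false
  rw [show net.taggedTransmits p true = _ from
    funext fun i => funext fun k => net.taggedTransmits_true p i k] at h1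
  rw [show net.taggedTransmits p false = _ from
    funext fun i => funext fun k => net.taggedTransmits_false p i k] at h0
  -- Both measures now have densities with respect to Lebesgue measure, so an almost everywhere
  -- identity of densities suffices.
  rw [h1, h0, ← withDensity_mul _ ((p.measurable_pairDensity false).const_mul _)
    p.measurable_h3L_rotateTo.ennreal_ofReal]
  refine withDensity_congr_ae ?_
  filter_upwards [LBT.ae_fst_ne_zero_and_ne] with v hv
  simp only [Pi.mul_apply]
  rw [p.pairDensity_true_eq_mul hv.2, p.h3L_rotateTo hv.1, mul_assoc]
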